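/- Identify $\mathbb{R}^2$ with $\mathbb{C}$ through $z=u+iv$. A minimal surface is a smooth conformal immersion $X:D\to\mathbb{R}^3$ of a simply connected domain $D\subset\mathbb{R}^2$ with mean curvature zero. It has planar curvature lines if every curvature line (regular curve whose tangent is everywhere a principal direction) lies in a plane. Up to isometries and homotheties of $\mathbb{R}^3$, $X$ is a *piece of* a surface $Y:\mathbb{R}^2\to\mathbb{R}^3$ if $X=r\cdot A\circ Y\circ\varphi$ on $D$ for some $r>0$, some isometry $A$ of $\mathbb{R}^3$ and some smooth local diffeomorphism $\varphi:D\to\mathbb{R}^2$ (a change of parameters). For $\theta\in[-\frac{\pi}{4},\frac{3\pi}{4}]$ let $R^\theta=\left(1-\sin(\theta+\frac{\pi}{4})\right)|\cos 2\theta|+\sin(\theta+\frac{\pi}{4})$ and $$\tilde X^{\theta}(u,v)=\begin{cases} R^\theta\begin{pmatrix} \dfrac{u\cos\theta\sqrt{\cos 2\theta}-\sin\theta\sinh(u\sqrt{\cos 2\theta})\cos(v\sqrt{\cos 2\theta})}{(\cos 2\theta)^{3/2}}\\ \dfrac{v\sin\theta\sqrt{\cos 2\theta}-\cos\theta\cosh(u\sqrt{\cos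 2\theta})\sin(v\sqrt{\cos 2\theta})}{(\cos 2\theta)^{3/2}}\\ \dfrac{\cosh(u\sqrt{\cos 2\theta})\cos(v\sqrt{\cos 2\theta})-1}{\cos 2\theta} \end{pmatrix}^t,&\theta\neq-\frac{\pi}{4},\frac{\pi}{4},\frac{3\pi}{4},\\ \left(-\dfrac{u(-6+u^2-3v^2)}{6\sqrt2},\ \dfrac{v(-6-3u^2+v^2)}{6\sqrt2},\ \dfrac{u^2-v^2}{2}\right),&\theta=\frac{\pi}{4},\\ \dfrac{3}{\sqrt2}(u,-v,0),&\theta=-\frac{\pi}{4},\frac{3\pi}{4}, \end{cases}$$ where $\sqrt{\cos 2\theta}$ and $(\cos 2\theta)^{3/2}$ are principal complex powers (the values of the formula are real also when $\cos 2\theta<0$). **Theorem.** Let $X$ be a minimal surface with planar curvature lines in $\mathbb{R}^3$. Then, up to isometries and homotheties of $\mathbb{R}^3$, $X$ is a piece of $\tilde X^\theta$ for some $\theta\in[-\frac{\pi}{4},\frac{3\pi}{4}]$. In fact, up to isometries and homotheties, it is a piece of a surface of one, and only one, of the following types, where a surface with Weierstrass data $(h,\eta\,dz)$ means $\mathrm{Re}\int_0^z(1-h^2,\,i(1+h^2),\,2h)\,\eta\,dz$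 on $\mathbb{C}$: - the plane $(0,1\,dz)$, for $\theta=-\frac{\pi}{4},\frac{3\pi}{4}$; - the catenoid $(e^z,e^{-z}dz)$, for $\theta=0,\frac{\pi}{2}$; - Enneper's surface $(z,1\,dz)$, for $\theta=\frac{\pi}{4}$; - a surface $(e^z+t,e^{-z}dz)$, $t>0$, in the Bonnet family, for $\theta\in(-\frac{\pi}{4},\frac{3\pi}{4})\setminus\{0,\frac{\pi}{4},\frac{\pi}{2}\}$. Here the type of $X$ is the one listed for $\theta$, for every $\theta$ such that $X$ is a piece of $\tilde X^\theta$; and each $\tilde X^\theta$ is itself, in the same sense, of exactly the type listed for $\theta$. Moreover, the deformation $\tilde X^\theta$ is continuous in $\theta\in[-\frac{\pi}{4},\frac{3\pi}{4}]$: as $\theta\to\theta_0$ in this interval, $\tilde X^\theta\to\tilde X^{\theta_0}$ uniformly on every compact subset of $\mathbb{R}^2$. -/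

import Mathlib

open Set Filter Topology
open scoped ContDiff

noncomputable section

namespace PlanarCurvature

/-- Euclidean three-space. -/
abbrev E3 : Type := EuclideanSpace ℝ (Fin 3)

/-- The cross product of `ℝ³`. -/
def cross (a b : E3) : E3 := WithLp.toLp 2 (crossProduct a.ofLp b.ofLp)

/-! ### Surfaces in conformal parameters

A parametrized surface is a map `X` on an open set `D` of the `(u, v)`-plane, which is identified
with `ℂ` through `z = u + i v`. -/

/-- The partial derivative `X_u`. -/
def du (X : ℂ → E3) (z : ℂ) : E3 := fderiv ℝ X z 1

/-- The partial derivative `X_v`. -/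
def dv (X : ℂ → E3) (z : ℂ) : E3 := fderiv ℝ X z Complex.I

/-- The unit normal vector field `N = (X_u × X_v) / |X_u × X_v|`. -/
def unitNormal (X : ℂ → E3) (z : ℂ) : E3 :=
  ‖cross (du X z) (dv X z)‖⁻¹ • cross (du X z) (dv X z)

/-- `X` is a smooth conformal immersion of `D`: the induced metric is
`e ^ (2 ω) (du² + dv²)`, where `e ^ (2 ω) = |X_u|² = |X_v|²` is positive. -/
structure IsConformalImmersion (D : Set ℂ) (X : ℂ → E3) : Prop where
  smooth : ContDiffOn ℝ ∞ X D
  norm_eq : ∀ z ∈ D, ‖du X z‖ = ‖dv X z‖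
  orthogonal : ∀ z ∈ D, inner ℝ (du X z) (dv X z) = 0
  immersion : ∀ z ∈ D, du X z ≠ 0

/-- The mean curvature `H = ⟨X_uu + X_vv, N⟩ / (2 e ^ (2 ω))` of a conformal immersion. -/
def meanCurvature (X : ℂ → E3) (z : ℂ) : ℝ :=
  inner ℝ (du (du X) z + dv (dv X) z) (unitNormal X z) / (2 * ‖du X z‖ ^ 2)

/-- A (conformally parametrized) minimal surface `X : D → ℝ³`
over a simply connected domain `D` of the plane. -/
structure IsMinimalSurface (D : Set ℂ) (X : ℂ → E3) : Prop where
  isOpen : IsOpen D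
  simplyConnected : IsSimplyConnected D
  conformal : IsConformalImmersion D X
  minimal : ∀ z ∈ D, meanCurvature X z = 0

/-- The tangent direction `w` (a vector of the parameter plane) is principal at `z`:
`dN(w) = -κ dX(w)` for a real number `κ`, the principal curvature (Rodrigues' formula). -/
def IsPrincipal (X : ℂ → E3) (z w : ℂ) : Prop :=
  w ≠ 0 ∧ ∃ κ : ℝ, fderiv ℝ (unitNormal X) z w = -κ • fderiv ℝ X z w

/-- `γ : (a, b) → D` is (the parameter curve of) a curvature line of `X`:
a smooth regular curve whose tangent is principal at every point. -/
def IsCurvatureLine (D : Set ℂ) (X : ℂ → E3) (a b : ℝ) (γ : ℝ → ℂ) : Prop :=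
  ContDiffOn ℝ ∞ γ (Ioo a b) ∧ ∀ t ∈ Ioo a b, γ t ∈ D ∧ IsPrincipal X (γ t) (deriv γ t)

/-- Every curvature line of `X` lies in a plane `{x | ⟨n, x⟩ = c}` of `ℝ³`. -/
def HasPlanarCurvatureLines (D : Set ℂ) (X : ℂ → E3) : Prop :=
  ∀ (a b : ℝ) (γ : ℝ → ℂ), IsCurvatureLine D X a b γ →
    ∃ n : E3, n ≠ 0 ∧ ∃ c : ℝ, ∀ t ∈ Ioo a b, inner ℝ n (X (γ t)) = c

/-- Up to isometries and homotheties of `ℝ³`, the surface `X : D → ℝ³` is a piece of the surface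
parametrized by `Y : ℂ → ℝ³`: after a change of parameters `φ : D → ℂ` (a smooth local
diffeomorphism), `X` is given by the parametrization `Y`, followed by an isometry `A` and
a homothety with ratio `r`. -/
def IsPieceOf (D : Set ℂ) (X Y : ℂ → E3) : Prop :=
  ∃ (r : ℝ) (A : E3 ≃ᵃⁱ[ℝ] E3) (φ : ℂ → ℂ), 0 < r ∧
    ContDiffOn ℝ ∞ φ D ∧ (∀ z ∈ D, Function.Bijective (fderiv ℝ φ z)) ∧
    ∀ z ∈ D, X z = r • A (Y (φ z))

/-! ### The four types of surfaces, through their Weierstrass data -/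

/-- The surface `Re ∫ (1 - h², i (1 + h²), 2 h) η dz` with Weierstrass data `(h, η dz)`, for entire
functions `h` and `η`; the integral runs along the segment from `0` to `z`. -/
def weierstrass (h η : ℂ → ℂ) (z : ℂ) : E3 :=
  !₂[(∫ t in (0 : ℝ)..1, (1 - h (t * z) ^ 2) * η (t * z) * z).re,
     (∫ t in (0 : ℝ)..1, Complex.I * (1 + h (t * z) ^ 2) * η (t * z) * z).re,
     (∫ t in (0 : ℝ)..1, 2 * h (t * z) * η (t * z) * z).re]

/-- The plane `(0, 1 dz)`. -/
def plane : ℂ → E3 := weierstrass (fun _ => 0) (fun _ => 1)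

/-- The catenoid `(e ^ z, e ^ (-z) dz)`. -/
def catenoid : ℂ → E3 := weierstrass (fun z => Complex.exp z) (fun z => Complex.exp (-z))

/-- Enneper's surface `(z, 1 dz)`. -/
def enneper : ℂ → E3 := weierstrass (fun z => z) (fun _ => 1)

/-- The surface `(e ^ z + t, e ^ (-z) dz)` of the Bonnet family (for `t > 0`). -/
def bonnet (t : ℝ) : ℂ → E3 :=
  weierstrass (fun z => Complex.exp z + t) (fun z => Complex.exp (-z))

inductive SurfaceType : Type
  | plane
  | catenoid
  | enneper
  | bonnet

/-- The surfaces of each type. -/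
def SurfaceType.models : SurfaceType → Set (ℂ → E3)
  | .plane => {PlanarCurvature.plane}
  | .catenoid => {PlanarCurvature.catenoid}
  | .enneper => {PlanarCurvature.enneper}
  | .bonnet => {Y | ∃ t : ℝ, 0 < t ∧ Y = PlanarCurvature.bonnet t}

/-- The parameters `θ` that belong to each type. -/
def SurfaceType.angles : SurfaceType → Set ℝ
  | .plane => {-(Real.pi / 4), 3 * Real.pi / 4}
  | .catenoid => {0, Real.pi / 2}
  | .enneper => {Real.pi / 4}
  | .bonnet => Ioo (-(Real.pi / 4)) (3 * Real.pi / 4) \ {0, Real.pi / 4, Real.pi / 2}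

/-- Up to isometries and homotheties, `X : D → ℝ³` is a piece of a surface of type `τ`. -/
def IsPieceOfType (D : Set ℂ) (X : ℂ → E3) (τ : SurfaceType) : Prop :=
  ∃ Y ∈ τ.models, IsPieceOf D X Y

/-! ### The explicit family -/

/-- The homothety factor `R ^ θ`. -/
def R (θ : ℝ) : ℝ :=
  (1 - Real.sin (θ + Real.pi / 4)) * |Real.cos (2 * θ)| + Real.sin (θ + Real.pi / 4)

/-- `√(cos 2θ)` as a complex number: it is imaginary when `cos 2θ < 0`. -/
def rootCos (θ : ℝ) : ℂ := (Real.cos (2 * θ) : ℂ) ^ (1 / 2 : ℂ)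

/-- The trigonometric / hyperbolic formula, for `cos 2θ ≠ 0`. Its square roots may be imaginary,
but its values are real (`generic_im`). -/
def generic (θ u v : ℝ) : Fin 3 → ℂ :=
  ![(u * Real.cos θ * rootCos θ
        - Real.sin θ * Complex.sinh (u * rootCos θ) * Complex.cos (v * rootCos θ))
      / (Real.cos (2 * θ) : ℂ) ^ (3 / 2 : ℂ),
    (v * Real.sin θ * rootCos θ
        - Real.cos θ * Complex.cosh (u * rootCos θ) * Complex.sin (v * rootCos θ))
      / (Real.cos (2 * θ) : ℂ) ^ (3 / 2 : ℂ),
    (Complex.cosh (u * rootCos θ) * Complex.cos (v * rootCos θ) - 1)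
      / (Real.cos (2 * θ) : ℂ)]

/-- The family `X̃ ^ θ (u, v)`, with `z = u + i v`, for `-π/4 ≤ θ ≤ 3π/4`. -/
def Xtilde (θ : ℝ) (z : ℂ) : E3 :=
  if θ = -(Real.pi / 4) ∨ θ = 3 * Real.pi / 4 then
    (3 / √2) • !₂[z.re, -z.im, 0]
  else if θ = Real.pi / 4 then
    !₂[-(z.re * (-6 + z.re ^ 2 - 3 * z.im ^ 2) / (6 * √2)),
       z.im * (-6 - 3 * z.re ^ 2 + z.im ^ 2) / (6 * √2),
       (z.re ^ 2 - z.im ^ 2) / 2]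
  else
    R θ • WithLp.toLp 2 fun i => (generic θ z.re z.im i).re

theorem cpow_three_halves (c : ℂ) (hc : c ≠ 0) : c ^ (3 / 2 : ℂ) = c * c ^ (1 / 2 : ℂ) := by
  rw [show (3 / 2 : ℂ) = 1 + 1 / 2 by norm_num, Complex.cpow_add _ _ hc, Complex.cpow_one]

/-- `√(cos 2θ)` is real or imaginary. -/
theorem rootCos_cases (θ : ℝ) :
    (∃ k : ℝ, rootCos θ = k) ∨ ∃ k : ℝ, rootCos θ = k * Complex.I := by
  have h2 : rootCos θ ^ 2 = (Real.cos (2 * θ) : ℂ) := by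
    unfold rootCos
    rw [one_div]
    exact_mod_cast Complex.cpow_nat_inv_pow (Real.cos (2 * θ) : ℂ) (n := 2) (by norm_num)
  have him := congrArg Complex.im h2
  simp only [pow_two, Complex.mul_im, Complex.ofReal_im] at him
  have h0 : (rootCos θ).re = 0 ∨ (rootCos θ).im = 0 := by
    rw [← mul_eq_zero]; linarith
  rcases h0 with h | h
  · exact Or.inr ⟨(rootCos θ).im, by apply Complex.ext <;> simp [h]⟩
  · exact Or.inl ⟨(rootCos θ).re, by apply Complex.ext <;> simp [h]⟩

/-- The generic formula is real-valued. -/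
theorem generic_im (θ u v : ℝ) (hθ : Real.cos (2 * θ) ≠ 0) (i : Fin 3) :
    (generic θ u v i).im = 0 := by
  have hc : (Real.cos (2 * θ) : ℂ) ≠ 0 := by exact_mod_cast hθ
  rw [← Complex.conj_eq_iff_im]
  have h3 := cpow_three_halves _ hc
  have hk : (Real.cos (2 * θ) : ℂ) ^ (1 / 2 : ℂ) = rootCos θ := rfl
  rw [hk] at h3
  have hconj : (starRingEnd ℂ) (rootCos θ) = rootCos θ ∨
      (starRingEnd ℂ) (rootCos θ) = -rootCos θ := by
    rcases rootCos_cases θ with ⟨k, h⟩ | ⟨k, h⟩ <;> rw [h] <;> simp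
  fin_cases i <;>
    simp only [generic, h3, Fin.zero_eta, Fin.mk_one, Fin.reduceFinMk, Matrix.cons_val,
      Matrix.cons_val_zero, Matrix.cons_val_one, map_div₀, map_sub, map_mul, Complex.conj_ofReal,
      map_one, ← Complex.sinh_conj, ← Complex.cosh_conj, ← Complex.cos_conj, ← Complex.sin_conj] <;>
    rcases hconj with h | h <;> rw [h] <;>
    simp only [mul_neg, Complex.sinh_neg, Complex.cosh_neg, Complex.sin_neg, Complex.cos_neg,
      neg_mul, sub_neg_eq_add, div_neg]
  all_goals ring

end PlanarCurvature

end

/-! A conformal minimal immersion is the real part of the integral of `Φ = X_u - i X_v`, which is a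
holomorphic null curve without zeros (`IsMinimalSurface.isNullData`). Every geometric question is
moved to `Φ`. The product `Φ' ⬝ Φ'` is the square of the normal component `ν` of `Φ'`; a direction
`v` is principal when `ν v²` is real, and umbilics are the zeros of `Φ' ⬝ Φ'`.

Away from umbilics, choose `p` with `4 p⁴ = Φ' ⬝ Φ'` and a local coordinate `w` with `dw = p dz`.
The curves on which only `Re w` varies are curvature lines. Let `f₀ = Φ / p` and let `f₁, f₂, f₃` be
its `w`-derivatives. The Gram matrix of `f₀, f₁, f₂` is constant except for the entry `f₂ ⬝ f₂ = -16
q`. If such a line lies in a plane with normal `n`, then `f₀ ⬝ n`, `f₁ ⬝ n`, `f₂ ⬝ n` are purely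
imaginary on it, and expressing `|n|²` through them forces `q` to be real
(`IsHopfRoot.im_frameInvariant`). One family of curvature lines is enough for this. A real
holomorphic function is locally constant, so `f₃ = 4 q f₁` is a linear equation with constant
coefficients. For `q = 0` the solution `f₀` is quadratic in `w` and a rotation makes it Enneper's
(`exists_enneper_normal_form`); for `q ≠ 0` it is `C₀ + e^ζ C₁ + e^(-ζ) C₂`, and a rotation makes it
that of `bonnet t` with `t ≥ 0`, where `t = 0` is the catenoid (`exists_bonnet_normal_form`).

An isolated umbilic is impossible: on a disc with the umbilic on its boundary the normal forms give
`|Φ|⁴ ≤ K |Φ' ⬝ Φ'|`, so `Φ` would vanish at the umbilic (`IsNullData.hopf_eq_zero_or_ne_zero`). If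
`Φ' ⬝ Φ'` vanishes identically, the normal is constant and the surface is planar.

The types exclude each other because a smooth change of parameters between two conformal surfaces is
locally holomorphic, up to a reflection of the model, and all non-planar models satisfy `Ψ' ⬝ Ψ' =
4`. Two representations of one surface then have proportional parameters, and differentiating their
identity separates Enneper from Bonnet and recovers `t` (`IsPieceOfType.unique`).

Finally, the normal form applied to `Xtilde θ` gives `|cos 2θ| (2 t² + 1) = 1`, which matches angles
with types, and Taylor remainders in integral form give one formula, continuous in `(θ, z)`, for the
whole family (`Xtilde_eq_uniformFormula`). -/

noncomputable section

namespace PlanarCurvature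

open Matrix

/-! ### Complex vectors and their real parts -/

/-- The real-linear map `w ↦ Re (w a)` from `ℂ` to `ℝ³` given by a complex vector `a`. -/
def reMul (a : Fin 3 → ℂ) : ℂ →L[ℝ] E3 :=
  LinearMap.toContinuousLinearMap
    { toFun := fun w => WithLp.toLp 2 fun i => (a i * w).re
      map_add' := fun v w => by ext i; simp [mul_add]
      map_smul' := fun c w => by
        ext i
        simp only [Complex.real_smul, PiLp.smul_apply, smul_eq_mul, RingHom.id_apply]
        rw [show a i * (c * w) = c * (a i * w) by ring, Complex.re_ofReal_mul] }

@[simp] theorem reMul_apply (a : Fin 3 → ℂ) (w : ℂ) (i : Fin 3) :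
    reMul a w i = (a i * w).re := rfl

theorem reMul_injective {a b : Fin 3 → ℂ} (h : ∀ w, reMul a w = reMul b w) : a = b := by
  ext i
  have h1 := congrArg (fun x : E3 => x i) (h 1)
  have h2 := congrArg (fun x : E3 => x i) (h Complex.I)
  simp only [reMul_apply, mul_one, Complex.mul_I_re] at h1 h2
  exact Complex.ext h1 (by linarith)

theorem hasFDerivAt_of_apply {X : ℂ → E3} {X' : ℂ →L[ℝ] E3} {z : ℂ}
    (h : ∀ i, HasFDerivAt (fun w => X w i) ((EuclideanSpace.proj i : E3 →L[ℝ] ℝ).comp X') z) :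
    HasFDerivAt X X' z := by
  rw [← hasFDerivWithinAt_univ] at *
  exact (hasFDerivWithinAt_piLp 2).2 fun i => (h i).hasFDerivWithinAt

theorem hasFDerivAt_re {F : ℂ → Fin 3 → ℂ} {a : Fin 3 → ℂ} {z : ℂ}
    (h : ∀ i, HasDerivAt (fun w => F w i) (a i) z) :
    HasFDerivAt (fun w => (WithLp.toLp 2 fun i => (F w i).re : E3)) (reMul a) z := by
  refine hasFDerivAt_of_apply fun i => ?_
  have h1 := (Complex.reCLM.hasFDerivAt).comp z ((h i).hasFDerivAt.restrictScalars ℝ)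
  have h2 : (EuclideanSpace.proj i : E3 →L[ℝ] ℝ).comp (reMul a) = Complex.reCLM.comp
      ((ContinuousLinearMap.toSpanSingleton ℂ (a i)).restrictScalars ℝ) := by
    ext w; simp [mul_comm]
  rw [h2]
  exact h1

/-! ### Real matrices acting on complex vectors -/

/-- The complexification of a real matrix. -/
def cm (M : Matrix (Fin 3) (Fin 3) ℝ) : Matrix (Fin 3) (Fin 3) ℂ := M.map Complex.ofRealHom

theorem cm_mul (M N : Matrix (Fin 3) (Fin 3) ℝ) : cm (M * N) = cm M * cm N :=
  Matrix.map_mul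

theorem cm_one : cm 1 = 1 := by simp [cm]

theorem cm_transpose (M : Matrix (Fin 3) (Fin 3) ℝ) : cm Mᵀ = (cm M)ᵀ := rfl

/-- The action of a real matrix on Euclidean three-space. -/
def act (M : Matrix (Fin 3) (Fin 3) ℝ) : E3 →L[ℝ] E3 :=
  (Matrix.toEuclideanLin M).toContinuousLinearMap

theorem act_apply (M : Matrix (Fin 3) (Fin 3) ℝ) (x : E3) (i : Fin 3) :
    act M x i = ∑ j, M i j * x j := rfl

theorem reMul_cm (M : Matrix (Fin 3) (Fin 3) ℝ) (a : Fin 3 → ℂ) (w : ℂ) :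
    reMul (cm M *ᵥ a) w = act M (reMul a w) := by
  ext i
  simp only [reMul_apply, act_apply, cm, mulVec, dotProduct, Matrix.map_apply, Finset.sum_mul,
    Complex.re_sum]
  refine Finset.sum_congr rfl fun j _ => ?_
  simp [mul_assoc]

theorem dot_cm {M : Matrix (Fin 3) (Fin 3) ℝ} (hM : Mᵀ * M = 1) (a b : Fin 3 → ℂ) :
    (cm M *ᵥ a) ⬝ᵥ (cm M *ᵥ b) = a ⬝ᵥ b := by
  rw [dotProduct_mulVec, ← Matrix.mulVec_transpose, ← cm_transpose, Matrix.mulVec_mulVec, ← cm_mul, hM,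
    cm_one, Matrix.one_mulVec]

theorem star_cm (M : Matrix (Fin 3) (Fin 3) ℝ) (a : Fin 3 → ℂ) :
    star (cm M *ᵥ a) = cm M *ᵥ star a := by
  ext i
  simp [cm, mulVec, dotProduct]

theorem cm_mulVec_injective {M : Matrix (Fin 3) (Fin 3) ℝ} (hM : Mᵀ * M = 1) {a b : Fin 3 → ℂ}
    (h : cm M *ᵥ a = cm M *ᵥ b) : a = b := by
  have := congrArg (fun x => cm Mᵀ *ᵥ x) h
  simpa [Matrix.mulVec_mulVec, ← cm_mul, hM, cm_one] using this

theorem inner_eq_dot (x y : E3) : inner ℝ x y = x.ofLp ⬝ᵥ y.ofLp := by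
  rw [EuclideanSpace.inner_eq_star_dotProduct, dotProduct_comm]; rfl

theorem inner_eq_sum (x y : E3) : inner ℝ x y = x 0 * y 0 + x 1 * y 1 + x 2 * y 2 := by
  rw [inner_eq_dot, dotProduct, Fin.sum_univ_three]

theorem inner_act {M : Matrix (Fin 3) (Fin 3) ℝ} (hM : Mᵀ * M = 1) (x y : E3) :
    inner ℝ (act M x) (act M y) = inner ℝ x y := by
  rw [inner_eq_dot, inner_eq_dot]
  change (M *ᵥ x.ofLp) ⬝ᵥ (M *ᵥ y.ofLp) = _
  rw [dotProduct_mulVec, ← Matrix.mulVec_transpose, Matrix.mulVec_mulVec, hM, Matrix.one_mulVec]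

/-- The isometry `x ↦ M x + c`. -/
def affineIso (M : Matrix (Fin 3) (Fin 3) ℝ) (hM : Mᵀ * M = 1) (c : E3) : E3 ≃ᵃⁱ[ℝ] E3 :=
  (LinearIsometry.toLinearIsometryEquiv
    (⟨(act M).toLinearMap, fun x => by
      have := inner_act hM x x
      rw [real_inner_self_eq_norm_sq, real_inner_self_eq_norm_sq] at this
      exact (sq_eq_sq₀ (norm_nonneg _) (norm_nonneg _)).1 this⟩ : E3 →ₗᵢ[ℝ] E3)
    rfl).toAffineIsometryEquiv.trans (AffineIsometryEquiv.constVAdd ℝ E3 c)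

@[simp] theorem affineIso_apply (M : Matrix (Fin 3) (Fin 3) ℝ) (hM : Mᵀ * M = 1) (c x : E3) :
    affineIso M hM c x = act M x + c := by
  rw [add_comm]; rfl

theorem exists_matrix (A : E3 ≃ᵃⁱ[ℝ] E3) :
    ∃ M : Matrix (Fin 3) (Fin 3) ℝ, Mᵀ * M = 1 ∧ ∀ x, A x = act M x + A 0 := by
  let L : E3 →ₗ[ℝ] E3 := A.linearIsometryEquiv.toLinearEquiv.toLinearMap
  have hM : ∀ x, act (Matrix.toEuclideanLin.symm L) x = L x := fun x => by
    simp [act]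
  refine ⟨Matrix.toEuclideanLin.symm L, ?_, fun x => ?_⟩
  · ext i j
    have h : inner ℝ (act (Matrix.toEuclideanLin.symm L) (EuclideanSpace.single i 1))
        (act (Matrix.toEuclideanLin.symm L) (EuclideanSpace.single j 1)) =
        inner ℝ (EuclideanSpace.single i (1 : ℝ) : E3) (EuclideanSpace.single j 1) := by
      rw [hM, hM]
      exact A.linearIsometryEquiv.inner_map_map _ _
    rw [inner_eq_sum, EuclideanSpace.inner_single_left] at h
    simp only [act_apply, PiLp.single_apply] at h
    simp only [mul_ite, mul_one, mul_zero, Finset.sum_ite_eq', Finset.mem_univ, if_true,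
      map_one] at h
    simpa [Matrix.mul_apply, Fin.sum_univ_three, Matrix.one_apply] using h
  · rw [hM]
    have : A x = A.linearIsometryEquiv x + A 0 := by simpa using A.map_vadd 0 x
    exact this

/-! ### Gram matrices -/

/-- If three vectors have an invertible Gram matrix `G` with inverse `H`, then a bilinear product
is computed from the products with these vectors. -/
theorem dot_eq_of_gram {M G H : Matrix (Fin 3) (Fin 3) ℂ} (hG : M * Mᵀ = G) (hH : G * H = 1)
    (n : Fin 3 → ℂ) : n ⬝ᵥ n = (M *ᵥ n) ⬝ᵥ (H *ᵥ (M *ᵥ n)) := by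
  -- `Mᵀ * H` is a right inverse of the square matrix `M`, hence also a left inverse.
  have h1 : M * (Mᵀ * H) = 1 := by rw [← Matrix.mul_assoc, hG, hH]
  have h2 := mul_eq_one_comm.1 h1
  have h3 : (M *ᵥ n) ⬝ᵥ (H *ᵥ (M *ᵥ n)) = n ⬝ᵥ (((Mᵀ * H) * M) *ᵥ n) := by
    rw [dotProduct_comm, dotProduct_mulVec, ← Matrix.mulVec_transpose, dotProduct_comm,
      Matrix.mulVec_mulVec, Matrix.mulVec_mulVec, Matrix.mul_assoc]
  rw [h3, h2, Matrix.one_mulVec]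

theorem eq_zero_of_gram {M G H : Matrix (Fin 3) (Fin 3) ℂ} (hG : M * Mᵀ = G) (hH : G * H = 1)
    {n : Fin 3 → ℂ} (hn : M *ᵥ n = 0) : n = 0 := by
  have h1 : M * (Mᵀ * H) = 1 := by rw [← Matrix.mul_assoc, hG, hH]
  have h2 := mul_eq_one_comm.1 h1
  rw [← Matrix.one_mulVec n, ← h2, ← Matrix.mulVec_mulVec, hn, Matrix.mulVec_zero]

/-! ### Derivatives of bilinear products -/

theorem HasDerivAt.dot {f g : ℂ → Fin 3 → ℂ} {f' g' : Fin 3 → ℂ} {z : ℂ}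
    (hf : HasDerivAt f f' z) (hg : HasDerivAt g g' z) :
    HasDerivAt (fun w => f w ⬝ᵥ g w) (f' ⬝ᵥ g z + f z ⬝ᵥ g') z := by
  simp only [dotProduct, ← Finset.sum_add_distrib]
  exact HasDerivAt.fun_sum fun i _ => (hasDerivAt_pi.1 hf i).mul (hasDerivAt_pi.1 hg i)

/-! ### Surfaces given by a complex derivative -/

/-- On `D`, the differential of `X` is `w ↦ Re (w Φ)`; that is, `X_u - i X_v = Φ`. -/
def HasData (D : Set ℂ) (X : ℂ → E3) (Φ : ℂ → Fin 3 → ℂ) : Prop :=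
  ∀ z ∈ D, HasFDerivAt X (reMul (Φ z)) z

theorem bijective_fderiv_of_hasDerivAt {φ : ℂ → ℂ} {a z : ℂ} (h : HasDerivAt φ a z) (ha : a ≠ 0) :
    Function.Bijective (fderiv ℝ φ z) := by
  have h1 : fderiv ℝ φ z = (ContinuousLinearMap.toSpanSingleton ℂ a).restrictScalars ℝ :=
    (h.hasFDerivAt.restrictScalars ℝ).fderiv
  have h2 : ∀ w, fderiv ℝ φ z w = w * a := fun w => by rw [h1]; simp
  refine ⟨fun v w hvw => ?_, fun w => ⟨w / a, ?_⟩⟩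
  · rw [h2, h2] at hvw
    exact mul_right_cancel₀ ha hvw
  · rw [h2, div_mul_cancel₀ _ ha]

theorem hasDerivAt_of_hasFDerivAt_real {φ : ℂ → ℂ} {T : ℂ →L[ℝ] ℂ} {a z : ℂ}
    (h : HasFDerivAt φ T z) (hT : ∀ v, T v = a * v) : HasDerivAt φ a z := by
  have h1 : (ContinuousLinearMap.toSpanSingleton ℂ a).restrictScalars ℝ = T := by
    ext v; simp [hT, mul_comm]
  exact (hasFDerivAt_of_restrictScalars ℝ h h1).hasDerivAt.congr_deriv (by simp)

theorem contDiffOn_of_hasDerivAt {D : Set ℂ} (hD : IsOpen D) {φ φ' : ℂ → ℂ}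
    (h : ∀ z ∈ D, HasDerivAt φ (φ' z) z) : ContDiffOn ℝ ∞ φ D := by
  have h1 : DifferentiableOn ℂ φ D := fun z hz => (h z hz).differentiableAt.differentiableWithinAt
  exact (h1.contDiffOn (n := ∞) hD).restrict_scalars ℝ

/-- Two surfaces whose complex derivatives correspond to each other under a holomorphic change of
parameters, a rotation and a homothety. -/
theorem exists_eq_of_data {D : Set ℂ} (hD : IsOpen D) (hc : IsPreconnected D) {X Y : ℂ → E3}
    {Φ Ψ : ℂ → Fin 3 → ℂ} (hX : HasData D X Φ) (hY : HasData univ Y Ψ) {φ φ' : ℂ → ℂ}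
    (hφ : ∀ z ∈ D, HasDerivAt φ (φ' z) z) {r : ℝ} (hr : 0 < r)
    {M : Matrix (Fin 3) (Fin 3) ℝ} (hM : Mᵀ * M = 1)
    (h : ∀ z ∈ D, Φ z = (r * φ' z) • cm M *ᵥ Ψ (φ z)) :
    ∃ A : E3 ≃ᵃⁱ[ℝ] E3, ∀ z ∈ D, X z = r • A (Y (φ z)) := by
  -- The difference of the two surfaces has zero differential. On the connected set `D` it is a
  -- constant, which becomes the translation part of the isometry.
  have key : ∀ z ∈ D, HasFDerivAt (fun w => X w - r • act M (Y (φ w))) (0 : ℂ →L[ℝ] E3) z := by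
    intro z hz
    have h1 := ((act M).hasFDerivAt.comp z ((hY (φ z) (mem_univ _)).comp z
      ((hφ z hz).hasFDerivAt.restrictScalars ℝ))).const_smul r
    convert! (hX z hz).sub h1 using 1
    ext w : 1
    simp only [h z hz, _root_.zero_apply, _root_.sub_apply,
      _root_.smul_apply, ContinuousLinearMap.comp_apply]
    rw [← reMul_cm, eq_comm, sub_eq_zero]
    ext i
    simp only [reMul_apply, Pi.smul_apply, PiLp.smul_apply, smul_eq_mul,
      ContinuousLinearMap.coe_restrictScalars', ContinuousLinearMap.toSpanSingleton_apply]
    rw [← Complex.re_ofReal_mul]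
    ring_nf
  obtain ⟨a, ha⟩ := hD.exists_is_const_of_fderiv_eq_zero (𝕜 := ℝ) hc
    (fun z hz => (key z hz).differentiableAt.differentiableWithinAt)
    (fun z hz => (key z hz).fderiv)
  refine ⟨affineIso M hM (r⁻¹ • a), fun z hz => ?_⟩
  rw [affineIso_apply, smul_add, smul_inv_smul₀ hr.ne', ← ha z hz]
  abel

theorem isPieceOf_of_data {D : Set ℂ} (hD : IsOpen D) (hc : IsPreconnected D) {X Y : ℂ → E3}
    {Φ Ψ : ℂ → Fin 3 → ℂ} (hX : HasData D X Φ) (hY : HasData univ Y Ψ) {φ φ' : ℂ → ℂ}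
    (hφ : ∀ z ∈ D, HasDerivAt φ (φ' z) z) (hφ' : ∀ z ∈ D, φ' z ≠ 0) {r : ℝ} (hr : 0 < r)
    {M : Matrix (Fin 3) (Fin 3) ℝ} (hM : Mᵀ * M = 1)
    (h : ∀ z ∈ D, Φ z = (r * φ' z) • cm M *ᵥ Ψ (φ z)) : IsPieceOf D X Y := by
  obtain ⟨A, hA⟩ := exists_eq_of_data hD hc hX hY hφ hr hM h
  exact ⟨r, A, φ, hr, contDiffOn_of_hasDerivAt hD hφ,
    fun z hz => bijective_fderiv_of_hasDerivAt (hφ z hz) (hφ' z hz), hA⟩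

/-- Only the translation part has to be rescaled. This brings compositions of similarities back to
the form `r • A`. -/
theorem exists_map_smul (A : E3 ≃ᵃⁱ[ℝ] E3) {s : ℝ} (hs : s ≠ 0) :
    ∃ B : E3 ≃ᵃⁱ[ℝ] E3, ∀ x, A (s • x) = s • B x := by
  obtain ⟨M, hM, h⟩ := exists_matrix A
  refine ⟨affineIso M hM (s⁻¹ • A 0), fun x => ?_⟩
  rw [h, affineIso_apply, smul_add, smul_inv_smul₀ hs, map_smul]

theorem IsPieceOf.trans {D : Set ℂ} (hD : IsOpen D) {X Y Z : ℂ → E3} (h₁ : IsPieceOf D X Y)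
    (h₂ : IsPieceOf univ Y Z) : IsPieceOf D X Z := by
  obtain ⟨r, A, φ, hr, hφ, hφ', h⟩ := h₁
  obtain ⟨s, B, ψ, hs, hψ, hψ', h'⟩ := h₂
  obtain ⟨A', hA'⟩ := exists_map_smul A hs.ne'
  refine ⟨r * s, B.trans A', ψ ∘ φ, mul_pos hr hs, ?_, fun z hz => ?_, fun z hz => ?_⟩
  · exact (contDiffOn_univ.1 hψ).comp_contDiffOn hφ
  · have h1 : DifferentiableAt ℝ φ z :=
      ((hφ.contDiffAt (hD.mem_nhds hz)).differentiableAt (by simp))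
    have h2 : DifferentiableAt ℝ ψ (φ z) :=
      ((contDiffOn_univ.1 hψ).contDiffAt.differentiableAt (by simp))
    rw [fderiv_comp z h2 h1]
    exact (hψ' (φ z) (mem_univ _)).comp (hφ' z hz)
  · rw [h z hz, h' (φ z) (mem_univ _), hA', mul_smul]
    rfl

/-- Two surfaces that agree up to an affine change of the complex parameter, an isometry and
a homothety. -/
def IsSimilar (X Y : ℂ → E3) : Prop :=
  ∃ (r : ℝ) (A : E3 ≃ᵃⁱ[ℝ] E3) (a b : ℂ), 0 < r ∧ a ≠ 0 ∧ ∀ z, X z = r • A (Y (a * z + b))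

/-- An affine change of parameter is globally invertible, which a mere local diffeomorphism as in
`IsPieceOf` need not be. The symmetry allows passing between `Xtilde θ` and its model in both
directions. -/
theorem IsSimilar.symm {X Y : ℂ → E3} (h : IsSimilar X Y) : IsSimilar Y X := by
  obtain ⟨r, A, a, b, hr, ha, h⟩ := h
  obtain ⟨B, hB⟩ := exists_map_smul A.symm (inv_ne_zero hr.ne')
  refine ⟨r⁻¹, B, a⁻¹, -(a⁻¹ * b), inv_pos.2 hr, inv_ne_zero ha, fun z => ?_⟩
  rw [← hB, h, inv_smul_smul₀ hr.ne', AffineIsometryEquiv.symm_apply_apply]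
  congr 1
  field_simp
  ring

theorem IsSimilar.isPieceOf {X Y : ℂ → E3} (h : IsSimilar X Y) (D : Set ℂ) : IsPieceOf D X Y := by
  obtain ⟨r, A, a, b, hr, ha, h⟩ := h
  have h1 : ∀ z, HasDerivAt (fun z : ℂ => a * z + b) a z := fun z => by
    simpa using ((hasDerivAt_id z).const_mul a).add_const b
  exact ⟨r, A, fun z => a * z + b, hr,
    (contDiffOn_of_hasDerivAt isOpen_univ fun z _ => h1 z).mono (subset_univ D),
    fun z _ => bijective_fderiv_of_hasDerivAt (h1 z) ha, fun z _ => h z⟩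

/-! ### The complex derivatives of the models -/

/-- The complex derivative of the surface with Weierstrass data `(h, η dz)`. -/
def weierstrassData (h η : ℂ → ℂ) (z : ℂ) : Fin 3 → ℂ :=
  ![(1 - h z ^ 2) * η z, Complex.I * (1 + h z ^ 2) * η z, 2 * h z * η z]

theorem exists_primitive_of_entire {f : ℂ → ℂ} (hf : Differentiable ℂ f) :
    ∃ F : ℂ → ℂ, ∀ z, HasDerivAt F (f z) z ∧ ∫ t in (0 : ℝ)..1, f (t * z) * z = F z - F 0 := by
  obtain ⟨F, hF⟩ := convex_univ.exists_forall_hasDerivWithinAt hf.differentiableOn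
  replace hF : ∀ z, HasDerivAt F (f z) z := fun z => (hasDerivWithinAt_univ.1 (hF z (mem_univ z)))
  refine ⟨F, fun z => ⟨hF z, ?_⟩⟩
  have h1 : ∀ t ∈ uIcc (0 : ℝ) 1, HasDerivAt (fun t : ℝ => F (t * z)) (f (t * z) * z) t := by
    intro t _
    have h2 : HasDerivAt (fun t : ℝ => (t : ℂ) * z) z t := by
      simpa using (Complex.ofRealCLM.hasDerivAt (x := t)).mul_const z
    exact (hF (t * z)).comp t h2
  have h3 : Continuous fun t : ℝ => f (t * z) * z := by
    have := hf.continuous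
    fun_prop
  rw [intervalIntegral.integral_eq_sub_of_hasDerivAt h1 (h3.intervalIntegrable 0 1)]
  simp

theorem hasData_weierstrass {h η : ℂ → ℂ} (hh : Differentiable ℂ h) (hη : Differentiable ℂ η) :
    HasData univ (weierstrass h η) (weierstrassData h η) := by
  obtain ⟨F, hF⟩ := exists_primitive_of_entire (f := fun z => (1 - h z ^ 2) * η z) (by fun_prop)
  obtain ⟨G, hG⟩ := exists_primitive_of_entire
    (f := fun z => Complex.I * (1 + h z ^ 2) * η z) (by fun_prop)
  obtain ⟨H, hH⟩ := exists_primitive_of_entire (f := fun z => 2 * h z * η z) (by fun_prop)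
  have h1 : weierstrass h η = fun z => (WithLp.toLp 2 fun i =>
      ((![F z - F 0, G z - G 0, H z - H 0] : Fin 3 → ℂ) i).re : E3) := by
    funext z
    ext i
    fin_cases i
    · simp [weierstrass, (hF z).2]
    · simp [weierstrass, (hG z).2]
    · simp [weierstrass, (hH z).2]
  intro z _
  rw [h1]
  refine hasFDerivAt_re (F := fun z => ![F z - F 0, G z - G 0, H z - H 0]) fun i => ?_
  fin_cases i
  · exact (hF z).1.sub_const _
  · exact (hG z).1.sub_const _
  · exact (hH z).1.sub_const _

theorem weierstrassData_dot_self (h η : ℂ → ℂ) (z : ℂ) :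
    weierstrassData h η z ⬝ᵥ weierstrassData h η z = 0 := by
  simp only [weierstrassData, dotProduct, Fin.sum_univ_three, cons_val_zero, cons_val_one,
    cons_val]
  linear_combination ((1 + h z ^ 2) * η z) ^ 2 * Complex.I_sq

theorem weierstrassData_ne_zero {h η : ℂ → ℂ} {z : ℂ} (hη : η z ≠ 0) :
    weierstrassData h η z ≠ 0 := by
  intro h0
  have h1 := congrFun h0 0
  have h2 := congrFun h0 1
  simp only [weierstrassData, cons_val_zero, cons_val_one, Pi.zero_apply] at h1 h2
  apply hη
  linear_combination (h1 - Complex.I * h2) / 2 + (1 + h z ^ 2) * η z * Complex.I_sq / 2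

/-- The reflection in the plane `x₂ = 0`. -/
def reflection : Matrix (Fin 3) (Fin 3) ℝ := !![1, 0, 0; 0, -1, 0; 0, 0, 1]

theorem reflection_orthogonal : reflectionᵀ * reflection = 1 := by
  ext i j
  fin_cases i <;> fin_cases j <;> simp [reflection, Matrix.mul_apply, Fin.sum_univ_three]

/-- Weierstrass data that commute with conjugation make conjugating the parameter the same as
reflecting the surface. Orientation-reversing changes of parameters can therefore be made
holomorphic. -/
theorem star_weierstrassData {h η : ℂ → ℂ} {z : ℂ} (hh : star (h (star z)) = h z)
    (hη : star (η (star z)) = η z) :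
    star (weierstrassData h η (star z)) = cm reflection *ᵥ weierstrassData h η z := by
  rw [Complex.star_def] at hh hη
  ext i
  fin_cases i <;>
  simp [weierstrassData, cm, reflection, mulVec, dotProduct, Fin.sum_univ_three, hh, hη]

/-! ### Smooth changes of parameters are holomorphic up to a reflection. -/

open scoped ComplexOrder in
theorem dot_star_self_ne_zero {a : Fin 3 → ℂ} (ha : a ≠ 0) : a ⬝ᵥ star a ≠ 0 := by
  rwa [dotProduct_comm, Ne, dotProduct_star_self_eq_zero]

/-- A surface of the form `X = r A ∘ Y ∘ φ` comes locally from a holomorphic change of parameters,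
since the orientation can be reversed by a reflection of `Y`. -/
theorem IsPieceOf.exists_holomorphic {D : Set ℂ} (hD : IsOpen D) {X Y : ℂ → E3}
    {Φ Ψ : ℂ → Fin 3 → ℂ} (hX : HasData D X Φ) (hΦ : ∀ z ∈ D, Φ z ⬝ᵥ Φ z = 0)
    (hΦ0 : ∀ z ∈ D, Φ z ≠ 0) (hY : HasData univ Y Ψ) (hΨ : ∀ z, Ψ z ⬝ᵥ Ψ z = 0)
    (hsym : ∀ z, star (Ψ (star z)) = cm reflection *ᵥ Ψ z) (h : IsPieceOf D X Y)
    {z₀ : ℂ} (hz₀ : z₀ ∈ D) :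
    ∃ ε > 0, Metric.ball z₀ ε ⊆ D ∧ ∃ (r : ℝ) (M : Matrix (Fin 3) (Fin 3) ℝ) (φ φ' : ℂ → ℂ),
      0 < r ∧ Mᵀ * M = 1 ∧ ∀ z ∈ Metric.ball z₀ ε, HasDerivAt φ (φ' z) z ∧ φ' z ≠ 0 ∧
        Φ z = (r * φ' z) • cm M *ᵥ Ψ (φ z) := by
  obtain ⟨r, A, φ, hr, hφ, -, h⟩ := h
  obtain ⟨M, hM, hA⟩ := exists_matrix A
  -- `α` and `β` are the Wirtinger derivatives `∂φ` and `∂̄φ`.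
  set α : ℂ → ℂ := fun z => (fderiv ℝ φ z 1 - Complex.I * fderiv ℝ φ z Complex.I) / 2 with hα
  set β : ℂ → ℂ := fun z => (fderiv ℝ φ z 1 + Complex.I * fderiv ℝ φ z Complex.I) / 2 with hβ
  have hT : ∀ z v, fderiv ℝ φ z v = α z * v + β z * star v := by
    intro z v
    have hv : v = v.re • (1 : ℂ) + v.im • Complex.I := by
      simp [Complex.re_add_im]
    conv_lhs => rw [hv]
    rw [map_add, map_smul, map_smul, Complex.real_smul, Complex.real_smul, hα, hβ]
    have h1 : star v = v.re - v.im * Complex.I := by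
      apply Complex.ext <;> simp
    rw [h1]
    have h2 : v = v.re + v.im * Complex.I := (Complex.re_add_im v).symm
    linear_combination (-(fderiv ℝ φ z 1 - Complex.I * fderiv ℝ φ z Complex.I) / 2) * h2 +
      (v.im : ℂ) * fderiv ℝ φ z Complex.I * Complex.I_sq
  have hfd : ContinuousOn (fderiv ℝ φ) D := hφ.continuousOn_fderiv_of_isOpen hD (by simp)
  have hαc : ContinuousOn α D := by
    have h1 : ContinuousOn (fun z => fderiv ℝ φ z 1) D := hfd.clm_apply continuousOn_const
    have h2 : ContinuousOn (fun z => fderiv ℝ φ z Complex.I) D := hfd.clm_apply continuousOn_const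
    fun_prop
  have hβc : ContinuousOn β D := by
    have h1 : ContinuousOn (fun z => fderiv ℝ φ z 1) D := hfd.clm_apply continuousOn_const
    have h2 : ContinuousOn (fun z => fderiv ℝ φ z Complex.I) D := hfd.clm_apply continuousOn_const
    fun_prop
  have hφd : ∀ z ∈ D, HasFDerivAt φ (fderiv ℝ φ z) z := fun z hz =>
    ((hφ.contDiffAt (hD.mem_nhds hz)).differentiableAt (by simp)).hasFDerivAt
  set b : ℂ → Fin 3 → ℂ := fun z => (r : ℂ) • cm M *ᵥ Ψ (φ z) with hb
  have hbn : ∀ z, b z ⬝ᵥ b z = 0 := fun z => by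
    simp [hb, dot_cm hM, hΨ]
  -- The chain rule in complex form: `Re ((α v + β v̄) b) = Re (v (α b + β̄ b̄))`.
  have hΦb : ∀ z ∈ D, Φ z = α z • b z + star (β z) • star (b z) := by
    intro z hz
    refine reMul_injective fun v => ?_
    have h1 : HasFDerivAt (fun w => r • (act M (Y (φ w)) + A 0))
        (r • ((act M).comp ((reMul (Ψ (φ z))).comp (fderiv ℝ φ z)))) z :=
      (((act M).hasFDerivAt.comp z ((hY (φ z) (mem_univ _)).comp z
        (hφd z hz))).add_const _).const_smul r
    have h2 : X =ᶠ[𝓝 z] fun w => r • (act M (Y (φ w)) + A 0) := by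
      filter_upwards [hD.mem_nhds hz] with w hw
      rw [h w hw, hA]
    rw [(hX z hz).unique (h1.congr_of_eventuallyEq h2)]
    simp only [_root_.smul_apply, ContinuousLinearMap.comp_apply, ← reMul_cm, hT]
    ext i
    simp only [PiLp.smul_apply, reMul_apply, hb, Pi.add_apply, Pi.smul_apply, Pi.star_apply,
      smul_eq_mul, star_mul']
    rw [← Complex.re_ofReal_mul, add_mul, mul_add, mul_add, Complex.add_re, Complex.add_re]
    congr 1
    · ring_nf
    · rw [← Complex.conj_re]
      congr 1
      simp
      ring
  -- Since `b` and its conjugate are null, `Φ ⬝ Φ = 0` reduces to `2 α β̄ (b ⬝ b̄) = 0`, and `b ⬝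
  -- b̄` is not zero.
  have hαβ : ∀ z ∈ D, α z = 0 ∨ β z = 0 := by
    intro z hz
    have h0 := hΦ z hz
    have hb0 : b z ≠ 0 := fun h0 => hΦ0 z hz (by simp [hΦb z hz, h0])
    have hsb : star (b z) ⬝ᵥ star (b z) = 0 := by
      simpa [dotProduct, mul_comm] using congrArg star (hbn z)
    rw [hΦb z hz] at h0
    simp only [add_dotProduct, dotProduct_add, smul_dotProduct, dotProduct_smul, hbn, hsb,
      smul_eq_mul, mul_zero, add_zero, zero_add] at h0
    rw [dotProduct_comm (star (b z))] at h0
    have h1 : 2 * (α z * star (β z) * (b z ⬝ᵥ star (b z))) = 0 := by linear_combination h0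
    simpa [dot_star_self_ne_zero hb0] using h1
  have hball : ∀ f : ℂ → ℂ, ContinuousOn f D → f z₀ ≠ 0 →
      ∃ ε > 0, ∀ z ∈ Metric.ball z₀ ε, z ∈ D ∧ f z ≠ 0 := by
    intro f hf h0
    have h1 : ∀ᶠ z in 𝓝 z₀, z ∈ D ∧ f z ≠ 0 :=
      (hD.eventually_mem hz₀).and ((hf.continuousAt (hD.mem_nhds hz₀)).eventually_ne h0)
    exact Metric.eventually_nhds_iff_ball.1 h1
  -- Whichever of `α`, `β` is nonzero at `z₀` stays so on a ball, where the other one must vanish.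
  -- If it is `β`, then `φ` is antiholomorphic; its conjugate is used instead, and `reflection` is
  -- put into the matrix.
  by_cases h0 : α z₀ = 0
  · have h1 : β z₀ ≠ 0 := fun h1 => hΦ0 z₀ hz₀ (by simp [hΦb z₀ hz₀, h0, h1])
    obtain ⟨ε, hε, hB⟩ := hball β hβc h1
    refine ⟨ε, hε, fun z hz => (hB z hz).1, r, M * reflection, fun z => star (φ z),
      fun z => star (β z), hr, ?_, fun z hz => ?_⟩
    · rw [Matrix.transpose_mul, Matrix.mul_assoc, ← Matrix.mul_assoc Mᵀ, hM, Matrix.one_mul,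
        reflection_orthogonal]
    · obtain ⟨hzD, hβz⟩ := hB z hz
      have hαz : α z = 0 := (hαβ z hzD).resolve_right hβz
      refine ⟨?_, star_ne_zero.2 hβz, ?_⟩
      · have h2 := (Complex.conjCLE.hasFDerivAt (x := φ z)).comp z (hφd z hzD)
        exact hasDerivAt_of_hasFDerivAt_real h2 fun v => by simp [hT, hαz]
      · rw [hΦb z hzD, hαz, cm_mul, ← Matrix.mulVec_mulVec, ← hsym, star_star, ← star_cm]
        simp only [hb, star_smul, smul_smul]
        simp [mul_comm]
  · obtain ⟨ε, hε, hB⟩ := hball α hαc h0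
    refine ⟨ε, hε, fun z hz => (hB z hz).1, r, M, φ, α, hr, hM, fun z hz => ?_⟩
    obtain ⟨hzD, hαz⟩ := hB z hz
    have hβz : β z = 0 := (hαβ z hzD).resolve_left hαz
    refine ⟨?_, hαz, ?_⟩
    · exact hasDerivAt_of_hasFDerivAt_real (hφd z hzD) fun v => by simp [hT, hβz]
    · rw [hΦb z hzD, hβz]
      simp only [hb, star_zero, zero_smul, add_zero, smul_smul]
      congr 1
      ring

/-! ### The models are pairwise different -/

/-- On `U`, the complex derivative `Φ` is that of a reparametrized, rotated and scaled surface with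
complex derivative `Ψ`. -/
structure IsRep (U : Set ℂ) (Φ Ψ : ℂ → Fin 3 → ℂ) (r : ℝ) (M : Matrix (Fin 3) (Fin 3) ℝ)
    (φ φ' : ℂ → ℂ) : Prop where
  pos : 0 < r
  orthogonal : Mᵀ * M = 1
  hasDerivAt : ∀ z ∈ U, HasDerivAt φ (φ' z) z
  ne_zero : ∀ z ∈ U, φ' z ≠ 0
  eq : ∀ z ∈ U, Φ z = (r * φ' z) • cm M *ᵥ Ψ (φ z)

theorem HasDerivAt.cm_mulVec (M : Matrix (Fin 3) (Fin 3) ℝ) {f : ℂ → Fin 3 → ℂ} {f' : Fin 3 → ℂ}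
    {z : ℂ} (hf : HasDerivAt f f' z) :
    HasDerivAt (fun w => cm M *ᵥ f w) (cm M *ᵥ f') z := by
  refine hasDerivAt_pi.2 fun i => ?_
  simpa [mulVec] using HasDerivAt.dot (hasDerivAt_const z fun j => cm M i j) hf

theorem dot_deriv_eq_zero {U : Set ℂ} (hU : IsOpen U) {f f' : ℂ → Fin 3 → ℂ} {c : ℂ}
    (hf : ∀ z ∈ U, HasDerivAt f (f' z) z) (h : ∀ z ∈ U, f z ⬝ᵥ f z = c) :
    ∀ z ∈ U, f z ⬝ᵥ f' z = 0 := by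
  intro z hz
  have h1 := HasDerivAt.dot (hf z hz) (hf z hz)
  have h2 : HasDerivAt (fun w => f w ⬝ᵥ f w) 0 z := by
    refine (hasDerivAt_const z c).congr_of_eventuallyEq ?_
    filter_upwards [hU.mem_nhds hz] with w hw using h w hw
  have h3 := h1.unique h2
  rw [dotProduct_comm] at h3
  linear_combination h3 / 2

theorem differentiableAt_of_hasDerivAt {U : Set ℂ} (hU : IsOpen U) {φ φ' : ℂ → ℂ}
    (h : ∀ z ∈ U, HasDerivAt φ (φ' z) z) : ∀ z ∈ U, DifferentiableAt ℂ φ' z := by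
  intro z hz
  have h1 : DifferentiableOn ℂ φ U := fun z hz => (h z hz).differentiableAt.differentiableWithinAt
  have h2 := (h1.deriv hU).differentiableAt (hU.mem_nhds hz)
  refine h2.congr_of_eventuallyEq ?_
  filter_upwards [hU.mem_nhds hz] with w hw using (h w hw).deriv.symm

/-- In the derivative of `r φ' M Ψ(φ)` the term with `φ''` is a multiple of `Ψ`, which is orthogonal
to `Ψ` and to `Ψ'`. So `Φ' ⬝ Φ'` transforms as a quartic differential. -/
theorem IsRep.deriv_dot_deriv {U : Set ℂ} (hU : IsOpen U) {Φ Ψ Ψ' : ℂ → Fin 3 → ℂ} {r : ℝ}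
    {M : Matrix (Fin 3) (Fin 3) ℝ} {φ φ' : ℂ → ℂ} (h : IsRep U Φ Ψ r M φ φ')
    (hΨ : ∀ z, HasDerivAt Ψ (Ψ' z) z) (h0 : ∀ z, Ψ z ⬝ᵥ Ψ z = 0) :
    ∀ z ∈ U, deriv Φ z ⬝ᵥ deriv Φ z = r ^ 2 * φ' z ^ 4 * (Ψ' (φ z) ⬝ᵥ Ψ' (φ z)) := by
  intro z hz
  have h1 := ((differentiableAt_of_hasDerivAt hU h.hasDerivAt z hz).hasDerivAt.const_mul
    (r : ℂ)).smul (HasDerivAt.cm_mulVec M ((hΨ (φ z)).scomp z (h.hasDerivAt z hz)))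
  have h2 : Φ =ᶠ[𝓝 z] fun w => ((r : ℂ) * φ' w) • cm M *ᵥ (Ψ ∘ φ) w := by
    filter_upwards [hU.mem_nhds hz] with w hw using h.eq w hw
  have h3 := dot_deriv_eq_zero isOpen_univ (fun z _ => hΨ z) (fun z _ => h0 z) (φ z) (mem_univ _)
  have h4 : Ψ' (φ z) ⬝ᵥ Ψ (φ z) = 0 := by rw [dotProduct_comm, h3]
  have h5 : deriv Φ z = _ := (h1.congr_of_eventuallyEq h2).deriv
  rw [h5]
  simp only [add_dotProduct, dotProduct_add, smul_dotProduct, dotProduct_smul, mulVec_smul,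
    dot_cm h.orthogonal, Function.comp_apply, h0, h3, h4, smul_eq_mul]
  ring

/-- With both models normalized to `Ψ' ⬝ Ψ' = 4`, the quartic differentials give `r₁² φ₁'⁴ = r₂²
φ₂'⁴`. The holomorphic function `φ₂' / φ₁'` has a constant fourth power, so it is constant. -/
theorem IsRep.deriv_proportional {U : Set ℂ} (hU : IsOpen U) (hc : IsPreconnected U)
    {Φ Ψ₁ Ψ₂ Ψ₁' Ψ₂' : ℂ → Fin 3 → ℂ} {r₁ r₂ : ℝ}
    {M₁ M₂ : Matrix (Fin 3) (Fin 3) ℝ} {φ₁ φ₂ φ₁' φ₂' : ℂ → ℂ}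
    (h₁ : IsRep U Φ Ψ₁ r₁ M₁ φ₁ φ₁') (h₂ : IsRep U Φ Ψ₂ r₂ M₂ φ₂ φ₂')
    (hΨ₁ : ∀ z, HasDerivAt Ψ₁ (Ψ₁' z) z) (hn₁ : ∀ z, Ψ₁ z ⬝ᵥ Ψ₁ z = 0)
    (hΨ₂ : ∀ z, HasDerivAt Ψ₂ (Ψ₂' z) z) (hn₂ : ∀ z, Ψ₂ z ⬝ᵥ Ψ₂ z = 0)
    (hq₁ : ∀ z, Ψ₁' z ⬝ᵥ Ψ₁' z = 4) (hq₂ : ∀ z, Ψ₂' z ⬝ᵥ Ψ₂' z = 4) (hne : U.Nonempty) :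
    ∃ c : ℂ, c ≠ 0 ∧ ∀ z ∈ U, φ₂' z = c * φ₁' z := by
  have e : ∀ z ∈ U, (r₁ : ℂ) ^ 2 * φ₁' z ^ 4 = r₂ ^ 2 * φ₂' z ^ 4 := by
    intro z hz
    have h := (h₁.deriv_dot_deriv hU hΨ₁ hn₁ z hz).symm.trans (h₂.deriv_dot_deriv hU hΨ₂ hn₂ z hz)
    rw [hq₁, hq₂] at h
    linear_combination h / 4
  have hr₁ : (r₁ : ℂ) ≠ 0 := by exact_mod_cast h₁.pos.ne'
  have hr₂ : (r₂ : ℂ) ≠ 0 := by exact_mod_cast h₂.pos.ne'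
  set g : ℂ → ℂ := fun z => φ₂' z / φ₁' z with hg
  have hgd : ∀ z ∈ U, DifferentiableAt ℂ g z := fun z hz =>
    (differentiableAt_of_hasDerivAt hU h₂.hasDerivAt z hz).div
      (differentiableAt_of_hasDerivAt hU h₁.hasDerivAt z hz) (h₁.ne_zero z hz)
  have hg0 : ∀ z ∈ U, g z ≠ 0 := fun z hz => div_ne_zero (h₂.ne_zero z hz) (h₁.ne_zero z hz)
  have hg4 : ∀ z ∈ U, g z ^ 4 = (r₁ : ℂ) ^ 2 / r₂ ^ 2 := by
    intro z hz
    have := h₁.ne_zero z hz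
    rw [hg, div_pow, div_eq_div_iff (pow_ne_zero 4 this) (pow_ne_zero 2 hr₂)]
    linear_combination -e z hz
  have hg' : ∀ z ∈ U, deriv g z = 0 := by
    intro z hz
    have h1 := (hgd z hz).hasDerivAt.pow 4
    have h2 : HasDerivAt (g ^ 4) 0 z := by
      refine (hasDerivAt_const z ((r₁ : ℂ) ^ 2 / r₂ ^ 2)).congr_of_eventuallyEq ?_
      filter_upwards [hU.mem_nhds hz] with w hw using hg4 w hw
    have h3 := h1.unique h2
    simpa [hg0 z hz] using h3
  obtain ⟨c, hcg⟩ := hU.exists_is_const_of_deriv_eq_zero hc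
    (fun z hz => (hgd z hz).differentiableWithinAt) hg'
  obtain ⟨z₁, hz₁⟩ := hne
  refine ⟨c, hcg z₁ hz₁ ▸ hg0 z₁ hz₁, fun z hz => ?_⟩
  rw [← hcg z hz, hg, div_mul_cancel₀ _ (h₁.ne_zero z hz)]

/-- The chain rule brings out `φ₁'` on the left and `c φ₁'` on the right, and `φ₁'` cancels. Each
differentiation of an identity between two models costs one factor `c`. -/
theorem IsRep.deriv_eq {U : Set ℂ} (hU : IsOpen U) {Φ Ψ₁ Ψ₂ F₁ F₂ F₁' F₂' : ℂ → Fin 3 → ℂ}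
    {r₁ r₂ : ℝ} {M₁ M₂ : Matrix (Fin 3) (Fin 3) ℝ} {φ₁ φ₂ φ₁' φ₂' : ℂ → ℂ}
    (h₁ : IsRep U Φ Ψ₁ r₁ M₁ φ₁ φ₁') (h₂ : IsRep U Φ Ψ₂ r₂ M₂ φ₂ φ₂') {a b c : ℂ}
    (hc : ∀ z ∈ U, φ₂' z = c * φ₁' z)
    (h : ∀ z ∈ U, a • cm M₁ *ᵥ F₁ (φ₁ z) = b • cm M₂ *ᵥ F₂ (φ₂ z))
    (hF₁ : ∀ z, HasDerivAt F₁ (F₁' z) z) (hF₂ : ∀ z, HasDerivAt F₂ (F₂' z) z) :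
    ∀ z ∈ U, a • cm M₁ *ᵥ F₁' (φ₁ z) = (b * c) • cm M₂ *ᵥ F₂' (φ₂ z) := by
  intro z hz
  have h3 := (HasDerivAt.cm_mulVec M₁ ((hF₁ (φ₁ z)).scomp z (h₁.hasDerivAt z hz))).const_smul a
  have h4 := (HasDerivAt.cm_mulVec M₂ ((hF₂ (φ₂ z)).scomp z (h₂.hasDerivAt z hz))).const_smul b
  have h5 : (fun w => a • cm M₁ *ᵥ (F₁ ∘ φ₁) w) =ᶠ[𝓝 z] fun w => b • cm M₂ *ᵥ (F₂ ∘ φ₂) w := by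
    filter_upwards [hU.mem_nhds hz] with w hw using h w hw
  have h6 := h3.unique (h4.congr_of_eventuallyEq h5)
  rw [hc z hz, mulVec_smul, mulVec_smul, smul_comm a, smul_comm b, mul_comm c, mul_smul] at h6
  have h7 := smul_right_injective (Fin 3 → ℂ) (h₁.ne_zero z hz) h6
  rw [h7, smul_smul, mul_comm]

/-! The Bonnet family has the complex derivative `B₀ + e ^ z B₁ + e ^ (-z) B₂`. -/

def bonnetConst (t : ℝ) : Fin 3 → ℂ := ![-(2 * t), 2 * t * Complex.I, 2]

def bonnetExp : Fin 3 → ℂ := ![-1, Complex.I, 0]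

def bonnetExpNeg (t : ℝ) : Fin 3 → ℂ := ![1 - t ^ 2, Complex.I * (1 + t ^ 2), 2 * t]

def bonnetData (t : ℝ) (z : ℂ) : Fin 3 → ℂ :=
  bonnetConst t + Complex.exp z • bonnetExp + Complex.exp (-z) • bonnetExpNeg t

theorem weierstrassData_exp (t : ℝ) :
    weierstrassData (fun z => Complex.exp z + t) (fun z => Complex.exp (-z)) = bonnetData t := by
  funext z
  have h : Complex.exp (-z) = (Complex.exp z)⁻¹ := Complex.exp_neg z
  have h0 := Complex.exp_ne_zero z
  ext i
  fin_cases i <;>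
  simp [weierstrassData, bonnetData, bonnetConst, bonnetExp, bonnetExpNeg, h] <;>
  field_simp <;> ring

theorem bonnetConst_dot_self (t : ℝ) : bonnetConst t ⬝ᵥ bonnetConst t = 4 := by
  simp only [bonnetConst, dotProduct, Fin.sum_univ_three, cons_val_zero, cons_val_one, cons_val]
  linear_combination 4 * (t : ℂ) ^ 2 * Complex.I_sq

/-- The Hermitian square of the constant coefficient depends on `t` while its bilinear square does
not; this is the invariant that tells the members of the Bonnet family apart. -/
theorem bonnetConst_dot_star (t : ℝ) :
    bonnetConst t ⬝ᵥ star (bonnetConst t) = ((8 * t ^ 2 + 4 : ℝ) : ℂ) := by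
  simp only [bonnetConst, dotProduct, Fin.sum_univ_three, cons_val_zero, cons_val_one, cons_val,
    Pi.star_apply]
  simp
  linear_combination -4 * (t : ℂ) ^ 2 * Complex.I_sq

theorem bonnetExp_dot_self : bonnetExp ⬝ᵥ bonnetExp = 0 := by
  simp [bonnetExp, dotProduct, Fin.sum_univ_three]

theorem bonnetExpNeg_dot_self (t : ℝ) : bonnetExpNeg t ⬝ᵥ bonnetExpNeg t = 0 := by
  simp only [bonnetExpNeg, dotProduct, Fin.sum_univ_three, cons_val_zero, cons_val_one, cons_val]
  linear_combination (1 + (t : ℂ) ^ 2) ^ 2 * Complex.I_sq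

theorem bonnetExp_dot_bonnetExpNeg (t : ℝ) : bonnetExp ⬝ᵥ bonnetExpNeg t = -2 := by
  simp only [bonnetExp, bonnetExpNeg, dotProduct, Fin.sum_univ_three, cons_val_zero, cons_val_one,
    cons_val]
  linear_combination (1 + (t : ℂ) ^ 2) * Complex.I_sq

theorem hasDerivAt_exp_add (C₀ C₁ C₂ : Fin 3 → ℂ) (z : ℂ) :
    HasDerivAt (fun z => C₀ + Complex.exp z • C₁ + Complex.exp (-z) • C₂)
      (0 + Complex.exp z • C₁ + Complex.exp (-z) • -C₂) z := by
  have h1 := (Complex.hasDerivAt_exp z).smul_const C₁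
  have h2 := ((Complex.hasDerivAt_exp (-z)).comp z (hasDerivAt_neg z)).smul_const C₂
  convert! ((hasDerivAt_const z C₀).add h1).add h2 using 1
  simp

/-- The complex derivative of Enneper's surface. -/
def enneperData (z : ℂ) : Fin 3 → ℂ := ![1 - z ^ 2, Complex.I * (1 + z ^ 2), 2 * z]

theorem weierstrassData_id : weierstrassData (fun z => z) (fun _ => 1) = enneperData := by
  funext z
  simp [weierstrassData, enneperData]

/-- The derivative of `enneperData`. -/
def enneperData' (z : ℂ) : Fin 3 → ℂ := ![-(2 * z), Complex.I * (2 * z), 2]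

theorem hasDerivAt_enneperData (z : ℂ) : HasDerivAt enneperData (enneperData' z) z := by
  have h := (hasDerivAt_pow 2 z)
  refine hasDerivAt_pi.2 fun i => ?_
  fin_cases i
  · simpa [enneperData, enneperData'] using h.const_sub 1
  · simpa [enneperData, enneperData'] using (h.const_add 1).const_mul Complex.I
  · simpa [enneperData, enneperData'] using (hasDerivAt_id z).const_mul 2

theorem hasDerivAt_enneperData' (z : ℂ) :
    HasDerivAt enneperData' ((2 : ℂ) • bonnetExp) z := by
  have h := (hasDerivAt_id z).const_mul 2
  refine hasDerivAt_pi.2 fun i => ?_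
  fin_cases i
  · simpa [enneperData', bonnetExp] using h.fun_neg
  · simpa [enneperData', bonnetExp, mul_comm] using h.const_mul Complex.I
  · simpa [enneperData', bonnetExp] using hasDerivAt_const z (2 : ℂ)

theorem enneperData'_dot_self (z : ℂ) : enneperData' z ⬝ᵥ enneperData' z = 4 := by
  simp only [enneperData', dotProduct, Fin.sum_univ_three, cons_val_zero, cons_val_one, cons_val]
  linear_combination 4 * z ^ 2 * Complex.I_sq

/-- The derivative of `bonnetData t`. -/
def bonnetData' (t : ℝ) (z : ℂ) : Fin 3 → ℂ :=
  0 + Complex.exp z • bonnetExp + Complex.exp (-z) • -bonnetExpNeg t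

theorem hasDerivAt_bonnetData (t : ℝ) (z : ℂ) :
    HasDerivAt (bonnetData t) (bonnetData' t z) z :=
  hasDerivAt_exp_add _ _ _ z

/-- The second derivative of `bonnetData t`. -/
def bonnetData'' (t : ℝ) (z : ℂ) : Fin 3 → ℂ := bonnetData t z - bonnetConst t

theorem hasDerivAt_bonnetData' (t : ℝ) (z : ℂ) :
    HasDerivAt (bonnetData' t) (bonnetData'' t z) z := by
  convert! hasDerivAt_exp_add 0 bonnetExp (-bonnetExpNeg t) z using 1
  simp [bonnetData'', bonnetData, add_assoc]

theorem hasDerivAt_bonnetData'' (t : ℝ) (z : ℂ) :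
    HasDerivAt (bonnetData'' t) (bonnetData' t z) z :=
  (hasDerivAt_bonnetData t z).sub_const _

theorem bonnetData'_dot_self (t : ℝ) (z : ℂ) : bonnetData' t z ⬝ᵥ bonnetData' t z = 4 := by
  have h : Complex.exp z * Complex.exp (-z) = 1 := by rw [← Complex.exp_add]; simp
  simp only [bonnetData', zero_add, add_dotProduct, dotProduct_add, smul_dotProduct,
    dotProduct_smul, neg_dotProduct, dotProduct_neg, bonnetExp_dot_self, bonnetExpNeg_dot_self,
    bonnetExp_dot_bonnetExpNeg, dotProduct_comm (bonnetExpNeg t) bonnetExp, smul_eq_mul]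
  linear_combination 4 * h

theorem bonnetData_dot_self (t : ℝ) (z : ℂ) : bonnetData t z ⬝ᵥ bonnetData t z = 0 := by
  rw [← weierstrassData_exp, weierstrassData_dot_self]

theorem enneperData_dot_self (z : ℂ) : enneperData z ⬝ᵥ enneperData z = 0 := by
  rw [← weierstrassData_id, weierstrassData_dot_self]

/-- `Φ' ⬝ Φ'` would be zero for the constant null curve and `4 r₂² φ₂'⁴ ≠ 0` for the other model. -/
theorem not_isRep_plane {U : Set ℂ} (hU : IsOpen U) (hne : U.Nonempty)
    {Φ Ψ Ψ' : ℂ → Fin 3 → ℂ} {C : Fin 3 → ℂ} {r₁ r₂ : ℝ} {M₁ M₂ : Matrix (Fin 3) (Fin 3) ℝ}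
    {φ₁ φ₂ φ₁' φ₂' : ℂ → ℂ} (hC : C ⬝ᵥ C = 0)
    (h₁ : IsRep U Φ (fun _ => C) r₁ M₁ φ₁ φ₁') (h₂ : IsRep U Φ Ψ r₂ M₂ φ₂ φ₂')
    (hΨ : ∀ z, HasDerivAt Ψ (Ψ' z) z) (hn : ∀ z, Ψ z ⬝ᵥ Ψ z = 0)
    (hq : ∀ z, Ψ' z ⬝ᵥ Ψ' z = 4) : False := by
  obtain ⟨z, hz⟩ := hne
  have e₁ := h₁.deriv_dot_deriv hU (fun z => hasDerivAt_const z C) (fun _ => hC) z hz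
  have e₂ := h₂.deriv_dot_deriv hU hΨ hn z hz
  have hr : (r₂ : ℂ) ≠ 0 := by exact_mod_cast h₂.pos.ne'
  rw [e₁, hq] at e₂
  have h0 := h₂.ne_zero z hz
  have h1 : (r₂ : ℂ) ^ 2 * φ₂' z ^ 4 * 4 ≠ 0 :=
    mul_ne_zero (mul_ne_zero (pow_ne_zero 2 hr) (pow_ne_zero 4 h0)) (by norm_num)
  exact h1 (by simpa using e₂.symm)

theorem IsRep.eq_of_proportional {U : Set ℂ} {Φ Ψ₁ Ψ₂ : ℂ → Fin 3 → ℂ}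
    {r₁ r₂ : ℝ} {M₁ M₂ : Matrix (Fin 3) (Fin 3) ℝ} {φ₁ φ₂ φ₁' φ₂' : ℂ → ℂ}
    (h₁ : IsRep U Φ Ψ₁ r₁ M₁ φ₁ φ₁') (h₂ : IsRep U Φ Ψ₂ r₂ M₂ φ₂ φ₂') {c : ℂ}
    (hc : ∀ z ∈ U, φ₂' z = c * φ₁' z) :
    ∀ z ∈ U, (r₁ : ℂ) • cm M₁ *ᵥ Ψ₁ (φ₁ z) = (r₂ * c) • cm M₂ *ᵥ Ψ₂ (φ₂ z) := by
  intro z hz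
  have h := (h₁.eq z hz).symm.trans (h₂.eq z hz)
  rw [hc z hz, mul_comm (r₁ : ℂ), ← mul_assoc, mul_comm _ (φ₁' z), mul_smul, mul_smul] at h
  exact smul_right_injective (Fin 3 → ℂ) (h₁.ne_zero z hz) h

/-- The third derivative vanishes for Enneper's quadratic curve, whereas for `bonnetData` it equals
the first derivative, whose square is `4`. -/
theorem not_isRep_enneper_bonnet {U : Set ℂ} (hU : IsOpen U) (hconn : IsPreconnected U)
    (hne : U.Nonempty) {Φ : ℂ → Fin 3 → ℂ} {t r₁ r₂ : ℝ} {M₁ M₂ : Matrix (Fin 3) (Fin 3) ℝ}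
    {φ₁ φ₂ φ₁' φ₂' : ℂ → ℂ} (h₁ : IsRep U Φ enneperData r₁ M₁ φ₁ φ₁')
    (h₂ : IsRep U Φ (bonnetData t) r₂ M₂ φ₂ φ₂') : False := by
  obtain ⟨c, hc0, hc⟩ := h₁.deriv_proportional hU hconn h₂ hasDerivAt_enneperData
    enneperData_dot_self (hasDerivAt_bonnetData t) (bonnetData_dot_self t)
    enneperData'_dot_self (bonnetData'_dot_self t) hne
  have e₁ := h₁.deriv_eq hU h₂ hc (h₁.eq_of_proportional h₂ hc) hasDerivAt_enneperData
    (hasDerivAt_bonnetData t)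
  have e₂ := h₁.deriv_eq hU h₂ hc e₁ hasDerivAt_enneperData' (hasDerivAt_bonnetData' t)
  have e₃ := h₁.deriv_eq (F₁ := fun _ => (2 : ℂ) • bonnetExp) (F₁' := fun _ => 0) hU h₂ hc e₂
    (fun z => hasDerivAt_const z _) (hasDerivAt_bonnetData'' t)
  obtain ⟨z, hz⟩ := hne
  have h := congrArg (fun v => v ⬝ᵥ v) (e₃ z hz)
  have hr : (r₂ : ℂ) ≠ 0 := by exact_mod_cast h₂.pos.ne'
  simp [dot_cm h₂.orthogonal, bonnetData'_dot_self, hr, hc0] at h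

theorem IsRep.bonnet_unique {U : Set ℂ} (hU : IsOpen U) (hconn : IsPreconnected U)
    (hne : U.Nonempty) {Φ : ℂ → Fin 3 → ℂ} {s t r₁ r₂ : ℝ} (hs : 0 ≤ s) (ht : 0 ≤ t)
    {M₁ M₂ : Matrix (Fin 3) (Fin 3) ℝ}
    {φ₁ φ₂ φ₁' φ₂' : ℂ → ℂ} (h₁ : IsRep U Φ (bonnetData s) r₁ M₁ φ₁ φ₁')
    (h₂ : IsRep U Φ (bonnetData t) r₂ M₂ φ₂ φ₂') : s = t := by
  obtain ⟨c, hc0, hc⟩ := h₁.deriv_proportional hU hconn h₂ (hasDerivAt_bonnetData s)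
    (bonnetData_dot_self s) (hasDerivAt_bonnetData t) (bonnetData_dot_self t)
    (bonnetData'_dot_self s) (bonnetData'_dot_self t) hne
  have e₀ := h₁.eq_of_proportional h₂ hc
  have e₁ := h₁.deriv_eq hU h₂ hc e₀ (hasDerivAt_bonnetData s) (hasDerivAt_bonnetData t)
  have e₂ := h₁.deriv_eq hU h₂ hc e₁ (hasDerivAt_bonnetData' s) (hasDerivAt_bonnetData' t)
  have e₃ := h₁.deriv_eq hU h₂ hc e₂ (hasDerivAt_bonnetData'' s) (hasDerivAt_bonnetData'' t)
  obtain ⟨z, hz⟩ := hne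
  have hr₁ : (r₁ : ℂ) ≠ 0 := by exact_mod_cast h₁.pos.ne'
  have hr₂ : (r₂ : ℂ) ≠ 0 := by exact_mod_cast h₂.pos.ne'
  -- The first and third derivatives of `bonnetData` coincide, so `e₁` and `e₃` differ only by the
  -- factor `c ^ 2` on the right.
  have hc2 : c ^ 2 = 1 := by
    have h := (e₁ z hz).symm.trans (e₃ z hz)
    have h' := congrArg (fun v => (cm M₂ *ᵥ bonnetData' t (φ₂ z)) ⬝ᵥ v) h
    simp only [dotProduct_smul, dot_cm h₂.orthogonal, bonnetData'_dot_self, smul_eq_mul] at h'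
    have h3 : (r₂ * c * c * 4 : ℂ) * (c ^ 2 - 1) = 0 := by linear_combination -h'
    rcases mul_eq_zero.1 h3 with h4 | h4
    · exact absurd h4 (mul_ne_zero (mul_ne_zero (mul_ne_zero hr₂ hc0) hc0) (by norm_num))
    · linear_combination h4
  -- Subtracting the second derivative leaves the constant coefficient. Its bilinear square then
  -- gives `r₁² = r₂²`, and its Hermitian square gives `s² = t²`.
  have e : (r₁ : ℂ) • cm M₁ *ᵥ bonnetConst s = (r₂ * c) • cm M₂ *ᵥ bonnetConst t := by
    have h3 : (r₂ * c * c * c : ℂ) = r₂ * c := by linear_combination (r₂ * c : ℂ) * hc2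
    have h0 := e₀ z hz
    have h2 := e₂ z hz
    simp only [bonnetData''] at h2
    rw [h3, mulVec_sub, mulVec_sub, smul_sub, smul_sub, h0] at h2
    exact sub_right_injective h2
  have hr : r₁ ^ 2 = r₂ ^ 2 := by
    have h := congrArg (fun v => v ⬝ᵥ v) e
    simp only [dotProduct_smul, smul_dotProduct, dot_cm h₁.orthogonal, dot_cm h₂.orthogonal,
      bonnetConst_dot_self, smul_eq_mul] at h
    have h' : (r₁ : ℂ) ^ 2 = r₂ ^ 2 := by linear_combination h / 4 + (r₂ : ℂ) ^ 2 * hc2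
    exact_mod_cast h'
  have hcc : c * star c = 1 := by
    have h : ‖c‖ ^ 2 = 1 := by rw [← norm_pow, hc2, norm_one]
    rw [Complex.star_def, Complex.mul_conj, Complex.normSq_eq_norm_sq, h, Complex.ofReal_one]
  have hst : r₁ ^ 2 * (8 * s ^ 2 + 4) = r₂ ^ 2 * (8 * t ^ 2 + 4) := by
    have h := congrArg (fun v => v ⬝ᵥ star v) e
    simp only [star_smul, star_cm, dotProduct_smul, smul_dotProduct, dot_cm h₁.orthogonal,
      dot_cm h₂.orthogonal, bonnetConst_dot_star, smul_eq_mul, star_mul'] at h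
    simp only [Complex.star_def, Complex.conj_ofReal] at h hcc
    have h' : ((r₁ ^ 2 * (8 * s ^ 2 + 4) : ℝ) : ℂ) = ((r₂ ^ 2 * (8 * t ^ 2 + 4) : ℝ) : ℂ) := by
      push_cast at h ⊢
      linear_combination h + (r₂ : ℂ) ^ 2 * (8 * t ^ 2 + 4) * hcc
    exact_mod_cast h'
  have hr2 : r₂ ^ 2 ≠ 0 := pow_ne_zero 2 h₂.pos.ne'
  rw [hr] at hst
  have := mul_left_cancel₀ hr2 hst
  exact (pow_left_inj₀ hs ht two_ne_zero).1 (by linarith)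

/-! ### Uniqueness of the type. -/

/-- The complex derivatives of the surfaces of each type. -/
def SurfaceType.IsData : SurfaceType → (ℂ → Fin 3 → ℂ) → Prop
  | .plane, Ψ => Ψ = fun _ => ![1, Complex.I, 0]
  | .catenoid, Ψ => Ψ = bonnetData 0
  | .enneper, Ψ => Ψ = enneperData
  | .bonnet, Ψ => ∃ t : ℝ, 0 < t ∧ Ψ = bonnetData t

theorem exists_data_of_mem_models {τ : SurfaceType} {Y : ℂ → E3} (hY : Y ∈ τ.models) :
    ∃ h η : ℂ → ℂ, HasData univ Y (weierstrassData h η) ∧ (∀ z, η z ≠ 0) ∧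
      (∀ z, star (h (star z)) = h z) ∧ (∀ z, star (η (star z)) = η z) ∧
      τ.IsData (weierstrassData h η) := by
  have he : ∀ z, star (Complex.exp (star z)) = Complex.exp z := fun z => by
    simp [← Complex.exp_conj]
  have he' : ∀ z, star (Complex.exp (-star z)) = Complex.exp (-z) := fun z => by
    simp [← Complex.exp_conj]
  cases τ with
  | plane =>
    rw [SurfaceType.models, mem_singleton_iff] at hY
    subst hY
    refine ⟨_, _, hasData_weierstrass (by fun_prop) (by fun_prop), by simp, by simp, by simp, ?_⟩
    funext z
    simp [weierstrassData]
  | catenoid =>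
    rw [SurfaceType.models, mem_singleton_iff] at hY
    subst hY
    refine ⟨_, _, hasData_weierstrass (by fun_prop) (by fun_prop),
      fun z => Complex.exp_ne_zero _, he, he', ?_⟩
    simp [SurfaceType.IsData, ← weierstrassData_exp]
  | enneper =>
    rw [SurfaceType.models, mem_singleton_iff] at hY
    subst hY
    exact ⟨_, _, hasData_weierstrass (by fun_prop) (by fun_prop), by simp, by simp, by simp,
      weierstrassData_id⟩
  | bonnet =>
    obtain ⟨t, ht, rfl⟩ := hY
    refine ⟨_, _, hasData_weierstrass (by fun_prop) (by fun_prop),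
      fun z => Complex.exp_ne_zero _, fun z => ?_, he', t, ht, weierstrassData_exp t⟩
    rw [star_add, he]
    simp

theorem IsRep.mono {U V : Set ℂ} {Φ Ψ : ℂ → Fin 3 → ℂ} {r : ℝ} {M : Matrix (Fin 3) (Fin 3) ℝ}
    {φ φ' : ℂ → ℂ} (h : IsRep U Φ Ψ r M φ φ') (hV : V ⊆ U) : IsRep V Φ Ψ r M φ φ' :=
  ⟨h.pos, h.orthogonal, fun z hz => h.hasDerivAt z (hV hz), fun z hz => h.ne_zero z (hV hz),
    fun z hz => h.eq z (hV hz)⟩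

/-- A surface is a piece of surfaces of at most one type. -/
theorem IsPieceOfType.unique {D : Set ℂ} (hD : IsOpen D) (hne : D.Nonempty) {X : ℂ → E3}
    {Φ : ℂ → Fin 3 → ℂ} (hX : HasData D X Φ) (hΦ : ∀ z ∈ D, Φ z ⬝ᵥ Φ z = 0)
    (hΦ0 : ∀ z ∈ D, Φ z ≠ 0) {τ₁ τ₂ : SurfaceType} (h₁ : IsPieceOfType D X τ₁)
    (h₂ : IsPieceOfType D X τ₂) : τ₁ = τ₂ := by
  obtain ⟨z₀, hz₀⟩ := hne
  have main : ∀ τ, IsPieceOfType D X τ → ∃ Ψ : ℂ → Fin 3 → ℂ, (∃ ε > 0,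
      ∃ (r : ℝ) (M : Matrix (Fin 3) (Fin 3) ℝ) (φ φ' : ℂ → ℂ),
      IsRep (Metric.ball z₀ ε) Φ Ψ r M φ φ') ∧ τ.IsData Ψ := by
    rintro τ ⟨Y, hY, hXY⟩
    obtain ⟨h, η, hd, hη0, hh, hη, hτ⟩ := exists_data_of_mem_models hY
    obtain ⟨ε, hε, -, r, M, φ, φ', hr, hM, H⟩ := hXY.exists_holomorphic hD hX hΦ hΦ0 hd
      (weierstrassData_dot_self h η) (fun z => star_weierstrassData (hh z) (hη z)) hz₀
    exact ⟨_, ⟨ε, hε, r, M, φ, φ', hr, hM, fun z hz => (H z hz).1, fun z hz => (H z hz).2.1,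
      fun z hz => (H z hz).2.2⟩, hτ⟩
  obtain ⟨Ψ₁, ⟨ε₁, hε₁, r₁, M₁, φ₁, φ₁', R₁⟩, hτ₁⟩ := main τ₁ h₁
  obtain ⟨Ψ₂, ⟨ε₂, hε₂, r₂, M₂, φ₂, φ₂', R₂⟩, hτ₂⟩ := main τ₂ h₂
  replace R₁ := R₁.mono (Metric.ball_subset_ball (min_le_left ε₁ ε₂))
  replace R₂ := R₂.mono (Metric.ball_subset_ball (min_le_right ε₁ ε₂))
  set U := Metric.ball z₀ (min ε₁ ε₂)
  have hU : IsOpen U := Metric.isOpen_ball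
  have hc : IsPreconnected U := (convex_ball _ _).isPreconnected
  have hn : U.Nonempty := ⟨z₀, Metric.mem_ball_self (lt_min hε₁ hε₂)⟩
  have hP : (![1, Complex.I, 0] : Fin 3 → ℂ) ⬝ᵥ ![1, Complex.I, 0] = 0 := by
    simp [dotProduct, Fin.sum_univ_three]
  have plane_bonnet : ∀ {t r r' M M' φ φ' ψ ψ'}, IsRep U Φ (fun _ => ![1, Complex.I, 0]) r M φ φ' →
      IsRep U Φ (bonnetData t) r' M' ψ ψ' → False := fun h h' => not_isRep_plane hU hn hP h h'
    (hasDerivAt_bonnetData _) (bonnetData_dot_self _) (bonnetData'_dot_self _)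
  have plane_enneper : ∀ {r r' M M' φ φ' ψ ψ'}, IsRep U Φ (fun _ => ![1, Complex.I, 0]) r M φ φ' →
      IsRep U Φ enneperData r' M' ψ ψ' → False := fun h h' => not_isRep_plane hU hn hP h h'
    hasDerivAt_enneperData enneperData_dot_self enneperData'_dot_self
  -- The catenoid is the case `t = 0` of the Bonnet family, so the lemmas on `bonnetData` apply to
  -- it as well, and `IsRep.bonnet_unique` separates it from the surfaces with `t > 0`.
  cases τ₁ <;> cases τ₂ <;> first
    | rfl
    | (exfalso
       simp only [SurfaceType.IsData] at hτ₁ hτ₂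
       first
         | (subst hτ₁; subst hτ₂
            first
            | exact plane_bonnet R₁ R₂
            | exact plane_bonnet R₂ R₁
            | exact plane_enneper R₁ R₂
            | exact plane_enneper R₂ R₁
            | exact not_isRep_enneper_bonnet hU hc hn R₁ R₂
            | exact not_isRep_enneper_bonnet hU hc hn R₂ R₁)
         | (obtain ⟨t, ht, rfl⟩ := hτ₁
            subst hτ₂
            first
            | exact plane_bonnet R₂ R₁
            | exact not_isRep_enneper_bonnet hU hc hn R₂ R₁
            | exact ht.ne' (R₁.bonnet_unique hU hc hn ht.le le_rfl R₂))
         | (obtain ⟨t, ht, rfl⟩ := hτ₂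
            subst hτ₁
            first
            | exact plane_bonnet R₁ R₂
            | exact not_isRep_enneper_bonnet hU hc hn R₁ R₂
            | exact ht.ne (R₁.bonnet_unique hU hc hn le_rfl ht.le R₂)))

/-! ### Normal forms of null curves -/

theorem orthogonal_mul {M N : Matrix (Fin 3) (Fin 3) ℝ} (hM : Mᵀ * M = 1) (hN : Nᵀ * N = 1) :
    (M * N)ᵀ * (M * N) = 1 := by
  rw [Matrix.transpose_mul, Matrix.mul_assoc, ← Matrix.mul_assoc Mᵀ, hM, Matrix.one_mul, hN]

theorem exists_cm_mulVec_eq {M : Matrix (Fin 3) (Fin 3) ℝ} (hM : Mᵀ * M = 1) (a : Fin 3 → ℂ) :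
    ∃ v, cm M *ᵥ v = a :=
  ⟨cm Mᵀ *ᵥ a, by rw [Matrix.mulVec_mulVec, ← cm_mul, mul_eq_one_comm.1 hM, cm_one,
    Matrix.one_mulVec]⟩

/-- A null vector is a positive multiple of `(-1, i, 0)`, up to a rotation. -/
theorem exists_rotation_of_null {a : Fin 3 → ℂ} (ha : a ≠ 0) (h : a ⬝ᵥ a = 0) :
    ∃ (M : Matrix (Fin 3) (Fin 3) ℝ) (s : ℝ), Mᵀ * M = 1 ∧ 0 < s ∧
      a = (s : ℂ) • cm M *ᵥ bonnetExp := by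
  have hre := congrArg Complex.re h
  have him := congrArg Complex.im h
  -- The real and imaginary parts of `a ⬝ a = 0` say that `Re a` and `Im a` have the same length and
  -- are orthogonal.
  simp only [dotProduct, Fin.sum_univ_three, Complex.add_re, Complex.add_im, Complex.mul_re,
    Complex.mul_im, Complex.zero_re, Complex.zero_im] at hre him
  set S : ℝ := (a 0).re ^ 2 + (a 1).re ^ 2 + (a 2).re ^ 2 with hS
  have hS0 : 0 < S := by
    by_contra hneg
    have e0 : (a 0).re = 0 := by nlinarith [sq_nonneg (a 0).re, sq_nonneg (a 1).re, sq_nonneg (a 2).re]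
    have e1 : (a 1).re = 0 := by nlinarith [sq_nonneg (a 0).re, sq_nonneg (a 1).re, sq_nonneg (a 2).re]
    have e2 : (a 2).re = 0 := by nlinarith [sq_nonneg (a 0).re, sq_nonneg (a 1).re, sq_nonneg (a 2).re]
    rw [e0, e1, e2] at hre
    have f0 : (a 0).im = 0 := by nlinarith [sq_nonneg (a 0).im, sq_nonneg (a 1).im, sq_nonneg (a 2).im]
    have f1 : (a 1).im = 0 := by nlinarith [sq_nonneg (a 0).im, sq_nonneg (a 1).im, sq_nonneg (a 2).im]
    have f2 : (a 2).im = 0 := by nlinarith [sq_nonneg (a 0).im, sq_nonneg (a 1).im, sq_nonneg (a 2).im]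
    apply ha
    ext i
    fin_cases i
    · exact Complex.ext e0 f0
    · exact Complex.ext e1 f1
    · exact Complex.ext e2 f2
  set s := √S with hs
  have hs0 : 0 < s := Real.sqrt_pos.2 hS0
  have hss : s * s = S := Real.mul_self_sqrt hS0.le
  set p : Fin 3 → ℝ := fun i => (a i).re / s with hp
  set q : Fin 3 → ℝ := fun i => (a i).im / s with hq
  have hpp : p 0 * p 0 + p 1 * p 1 + p 2 * p 2 = 1 := by
    simp only [hp]
    field_simp
    linarith
  have hqq : q 0 * q 0 + q 1 * q 1 + q 2 * q 2 = 1 := by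
    simp only [hq]
    field_simp
    linarith
  have hpq : p 0 * q 0 + p 1 * q 1 + p 2 * q 2 = 0 := by
    simp only [hp, hq]
    field_simp
    linarith
  have hc : (p 1 * q 2 - p 2 * q 1) * (p 1 * q 2 - p 2 * q 1) +
      (p 2 * q 0 - p 0 * q 2) * (p 2 * q 0 - p 0 * q 2) +
      (p 0 * q 1 - p 1 * q 0) * (p 0 * q 1 - p 1 * q 0) = 1 := by
    linear_combination (q 0 * q 0 + q 1 * q 1 + q 2 * q 2) * hpp + hqq -
      (p 0 * q 0 + p 1 * q 1 + p 2 * q 2) * hpq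
  -- The columns are `-p`, `q` and `p × q`, so that `(-1, i, 0)` is sent to `p + i q`.
  refine ⟨!![-p 0, q 0, p 1 * q 2 - p 2 * q 1; -p 1, q 1, p 2 * q 0 - p 0 * q 2;
    -p 2, q 2, p 0 * q 1 - p 1 * q 0], s, ?_, hs0, ?_⟩
  · ext i j
    fin_cases i <;> fin_cases j <;>
    simp [Matrix.mul_apply, Fin.sum_univ_three] <;>
    first
      | linear_combination hpp
      | linear_combination hqq
      | linear_combination hc
      | linear_combination -hpq
      | ring
  · have key : ∀ i, a i = s * (p i + q i * Complex.I) := by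
      intro i
      have : (s : ℂ) ≠ 0 := by exact_mod_cast hs0.ne'
      simp only [hp, hq]
      push_cast
      field_simp
      exact (Complex.re_add_im (a i)).symm
    ext i
    fin_cases i <;>
    simp [cm, mulVec, bonnetExp, dotProduct, Fin.sum_univ_three, key, mul_comm]

theorem exists_sign {y : ℂ} {ρ : ℝ} (h : y ^ 2 = 4 * (ρ : ℂ) ^ 2) :
    ∃ σ : ℝ, σ * σ = 1 ∧ y = 2 * ρ * σ := by
  have h' : (y - 2 * ρ) * (y + 2 * ρ) = 0 := by linear_combination h
  rcases mul_eq_zero.1 h' with h0 | h0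
  · exact ⟨1, by norm_num, by push_cast; linear_combination h0⟩
  · exact ⟨-1, by norm_num, by push_cast; linear_combination h0⟩

/-- The rotation about the third axis by `τ`, followed by a reflection if `σ = -1`. -/
def axisRotation (τ σ : ℝ) : Matrix (Fin 3) (Fin 3) ℝ :=
  !![Real.cos τ, -Real.sin τ, 0; Real.sin τ, Real.cos τ, 0; 0, 0, σ]

theorem axisRotation_orthogonal (τ : ℝ) {σ : ℝ} (hσ : σ * σ = 1) :
    (axisRotation τ σ)ᵀ * axisRotation τ σ = 1 := by
  have h := Real.sin_sq_add_cos_sq τ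
  ext i j
  fin_cases i <;> fin_cases j <;>
  simp [axisRotation, Matrix.mul_apply, Fin.sum_univ_three, hσ] <;>
  first
    | linear_combination h
    | ring

theorem axisRotation_mulVec (τ σ : ℝ) (x y : ℂ) :
    cm (axisRotation τ σ) *ᵥ ![-x, Complex.I * x, y] =
      ![-(Complex.exp (τ * Complex.I) * x), Complex.I * (Complex.exp (τ * Complex.I) * x),
        σ * y] := by
  rw [Complex.exp_mul_I]
  ext i
  fin_cases i <;>
  simp [axisRotation, cm, mulVec, dotProduct, Fin.sum_univ_three] <;>
  first
    | ring1
    | linear_combination -(Complex.sin τ * x) * Complex.I_sq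

/-- A null curve `C₀ + e ^ w C₁ + e ^ (-w) C₂` for which `C₀ ⬝ C₀` is positive is that of a surface
in the Bonnet family. -/
theorem exists_bonnet_normal_form {C₀ C₁ C₂ : Fin 3 → ℂ} {ρ : ℝ} (hρ : 0 < ρ)
    (h00 : C₀ ⬝ᵥ C₀ = 4 * (ρ : ℂ) ^ 2) (h01 : C₀ ⬝ᵥ C₁ = 0) (h02 : C₀ ⬝ᵥ C₂ = 0)
    (h11 : C₁ ⬝ᵥ C₁ = 0) (h12 : C₁ ⬝ᵥ C₂ = -2 * (ρ : ℂ) ^ 2) (h22 : C₂ ⬝ᵥ C₂ = 0) :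
    ∃ (M : Matrix (Fin 3) (Fin 3) ℝ) (t : ℝ) (c : ℂ), Mᵀ * M = 1 ∧ 0 ≤ t ∧
      C₀ ⬝ᵥ star C₀ = ((ρ ^ 2 * (8 * t ^ 2 + 4) : ℝ) : ℂ) ∧
      ∀ w, C₀ + Complex.exp w • C₁ + Complex.exp (-w) • C₂ =
        (ρ : ℂ) • cm M *ᵥ bonnetData t (w + c) := by
  have hρ0 : (ρ : ℂ) ≠ 0 := by exact_mod_cast hρ.ne'
  have hC₁ : C₁ ≠ 0 := by
    rintro rfl
    simp [hρ0] at h12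
  obtain ⟨M₀, s, hM₀, hs, e₁⟩ := exists_rotation_of_null hC₁ h11
  have hs0 : (s : ℂ) ≠ 0 := by exact_mod_cast hs.ne'
  obtain ⟨v, rfl⟩ := exists_cm_mulVec_eq hM₀ C₀
  rw [dot_cm hM₀] at h00
  rw [e₁, dotProduct_smul, dot_cm hM₀] at h01
  simp only [dotProduct, bonnetExp, Fin.sum_univ_three, cons_val_zero, cons_val_one, cons_val,
    smul_eq_mul, mul_eq_zero, hs0, false_or] at h00 h01
  -- Orthogonality to `(-1, i, 0)` gives the rotated `C₀` the form `(-x, i x, y)`, and then `C₀ ⬝ C₀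
  -- = y²` forces `y = ± 2 ρ`.
  have hv1 : v 1 = Complex.I * -v 0 := by linear_combination -Complex.I * h01 + v 1 * Complex.I_sq
  have hv2 : v 2 ^ 2 = 4 * (ρ : ℂ) ^ 2 := by
    rw [hv1] at h00
    linear_combination h00 - v 0 ^ 2 * Complex.I_sq
  obtain ⟨σ, hσ, hvσ⟩ := exists_sign hv2
  -- A rotation about the third axis multiplies `x` by a phase. The argument of `x` can thus be
  -- removed, its modulus is `2 ρ t`, and `σ` corrects the sign of `y`.
  set x : ℂ := -v 0 with hx
  set τ : ℝ := x.arg with hτ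
  set t : ℝ := ‖x‖ / (2 * ρ) with ht
  have hxt : x = 2 * ρ * t * Complex.exp (τ * Complex.I) := by
    have h1 : (2 * ρ * t : ℝ) = ‖x‖ := by rw [ht]; field_simp
    have h2 : (2 * ρ * t : ℂ) = (‖x‖ : ℝ) := by rw [← h1]; push_cast; ring
    rw [h2, hτ, Complex.norm_mul_exp_arg_mul_I]
  set R := axisRotation τ σ with hR
  have hRo : Rᵀ * R = 1 := axisRotation_orthogonal τ hσ
  set M := M₀ * R with hMdef
  have hM : Mᵀ * M = 1 := orthogonal_mul hM₀ hRo
  have e₀ : cm M₀ *ᵥ v = (ρ : ℂ) • cm M *ᵥ bonnetConst t := by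
    rw [hMdef, cm_mul, ← Matrix.mulVec_mulVec, ← mulVec_smul]
    congr 1
    have h1 : bonnetConst t = ![-(2 * t : ℂ), Complex.I * (2 * t), 2] := by
      simp [bonnetConst, mul_comm]
    rw [h1, hR, axisRotation_mulVec]
    ext i
    fin_cases i
    · simp only [Fin.zero_eta, Pi.smul_apply, cons_val_zero, smul_eq_mul]
      linear_combination -hxt - hx
    · simp only [Fin.mk_one, Pi.smul_apply, cons_val_one, smul_eq_mul, hv1, cons_val_zero]
      linear_combination Complex.I * hxt
    · simp [hvσ]
      ring
  -- The complex factor left over in front of `bonnetExp`; writing it as `e ^ c` turns it into a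
  -- translation of the parameter.
  set k : ℂ := s / ρ * Complex.exp (-(τ * Complex.I)) with hk
  have hk0 : k ≠ 0 := mul_ne_zero (div_ne_zero hs0 hρ0) (Complex.exp_ne_zero _)
  have e₁' : C₁ = (ρ * k) • cm M *ᵥ bonnetExp := by
    have h1 : bonnetExp = ![-(1 : ℂ), Complex.I * 1, 0] := by simp [bonnetExp]
    have h2 : cm R *ᵥ bonnetExp = Complex.exp (τ * Complex.I) • bonnetExp := by
      rw [h1, hR, axisRotation_mulVec]
      ext i
      fin_cases i <;> simp [mul_comm]
    rw [e₁, hMdef, cm_mul, ← Matrix.mulVec_mulVec, h2, mulVec_smul, smul_smul]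
    congr 1
    rw [hk, Complex.exp_neg]
    have := Complex.exp_ne_zero (τ * Complex.I)
    field_simp
  obtain ⟨w, rfl⟩ := exists_cm_mulVec_eq hM C₂
  rw [e₁', smul_dotProduct, dot_cm hM] at h12
  rw [e₀, smul_dotProduct, dot_cm hM] at h02
  rw [dot_cm hM] at h22
  simp only [dotProduct, bonnetExp, bonnetConst, Fin.sum_univ_three, cons_val_zero, cons_val_one,
    cons_val, smul_eq_mul, mul_eq_zero, hρ0, false_or] at h12 h02 h22
  set m : ℂ := ρ / k with hm
  have hm0 : m ≠ 0 := div_ne_zero hρ0 hk0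
  -- The products of `C₂` with `C₁`, with `C₀` and with itself determine, in this order, its
  -- coordinates `-w₀ + i w₁`, `w₂` and `-w₀ - i w₁`.
  have g₁ : -w 0 + Complex.I * w 1 = -2 * m := by
    rw [hm]
    field_simp
    have : (ρ : ℂ) * (k * (-w 0 + Complex.I * w 1) + 2 * ρ) = 0 := by linear_combination h12
    rcases mul_eq_zero.1 this with h | h
    · exact absurd h hρ0
    · linear_combination h
  have g₂ : w 2 = 2 * t * m := by linear_combination h02 / 2 - t * g₁
  have g₃ : -w 0 - Complex.I * w 1 = 2 * t ^ 2 * m := by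
    have h1 : (-2 * m) * (-w 0 - Complex.I * w 1 - 2 * t ^ 2 * m) = 0 := by
      rw [g₂] at h22
      linear_combination h22 - (-w 0 - Complex.I * w 1) * g₁ - w 1 ^ 2 * Complex.I_sq
    rcases mul_eq_zero.1 h1 with h | h
    · exact absurd h (by simp [hm0])
    · linear_combination h
  have e₂ : w = m • bonnetExpNeg t := by
    ext i
    fin_cases i
    · simp only [Fin.zero_eta, bonnetExpNeg, Pi.smul_apply, cons_val_zero, smul_eq_mul]
      linear_combination -(g₁ + g₃) / 2
    · simp only [Fin.mk_one, bonnetExpNeg, Pi.smul_apply, cons_val_one, smul_eq_mul, cons_val_zero]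
      linear_combination -Complex.I * (g₁ - g₃) / 2 + w 1 * Complex.I_sq
    · simp [bonnetExpNeg, g₂]
      ring
  refine ⟨M, t, Complex.log k, hM, by positivity, ?_, fun u => ?_⟩
  · rw [e₀, star_smul, star_cm, smul_dotProduct, dotProduct_smul, dot_cm hM, bonnetConst_dot_star]
    simp only [smul_eq_mul, Complex.star_def, Complex.conj_ofReal]
    push_cast
    ring
  · rw [e₀, e₁', e₂, bonnetData, mulVec_add, mulVec_add, neg_add, Complex.exp_add, Complex.exp_add,
      Complex.exp_neg (Complex.log k), Complex.exp_log hk0]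
    simp only [mulVec_smul, smul_add, smul_smul]
    congr 2
    · congr 1
      ring
    · rw [hm]
      field_simp

/-- A quadratic null curve is that of Enneper's surface. -/
theorem exists_enneper_normal_form {C₀ C₁ C₂ : Fin 3 → ℂ}
    (h00 : C₀ ⬝ᵥ C₀ = 0) (h01 : C₀ ⬝ᵥ C₁ = 0) (h02 : C₀ ⬝ᵥ C₂ = -2)
    (h11 : C₁ ⬝ᵥ C₁ = 4) (h12 : C₁ ⬝ᵥ C₂ = 0) (h22 : C₂ ⬝ᵥ C₂ = 0) :
    ∃ (M : Matrix (Fin 3) (Fin 3) ℝ) (s : ℝ) (d : ℂ), Mᵀ * M = 1 ∧ 0 < s ∧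
      ∀ w, C₀ + w • C₁ + w ^ 2 • C₂ = (s : ℂ)⁻¹ • cm M *ᵥ enneperData (s * (w + d)) := by
  have hC₂ : C₂ ≠ 0 := by
    rintro rfl
    simp at h02
  obtain ⟨M₀, s, hM₀, hs, e₂⟩ := exists_rotation_of_null hC₂ h22
  have hs0 : (s : ℂ) ≠ 0 := by exact_mod_cast hs.ne'
  obtain ⟨v, rfl⟩ := exists_cm_mulVec_eq hM₀ C₁
  rw [dot_cm hM₀] at h11
  rw [e₂, dotProduct_smul, dot_cm hM₀] at h12
  simp only [dotProduct, bonnetExp, Fin.sum_univ_three, cons_val_zero, cons_val_one, cons_val,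
    smul_eq_mul, mul_eq_zero, hs0, false_or] at h11 h12
  have hv1 : v 1 = Complex.I * -v 0 := by linear_combination -Complex.I * h12 + v 1 * Complex.I_sq
  have hv2 : v 2 ^ 2 = 4 * ((1 : ℝ) : ℂ) ^ 2 := by
    rw [hv1] at h11
    push_cast
    linear_combination h11 - v 0 ^ 2 * Complex.I_sq
  obtain ⟨σ, hσ, hvσ⟩ := exists_sign hv2
  -- In the expansion of `s⁻¹ • enneperData (s * (w + d))` the coefficient of `w` is `(-2 d s, 2 i d
  -- s, 2)`, which dictates `d`.
  set d : ℂ := -v 0 / (2 * s) with hd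
  have hds : -v 0 = 2 * d * s := by rw [hd]; field_simp
  set R := axisRotation 0 σ with hR
  have hRo : Rᵀ * R = 1 := axisRotation_orthogonal 0 hσ
  set M := M₀ * R with hMdef
  have hM : Mᵀ * M = 1 := orthogonal_mul hM₀ hRo
  have e₁ : cm M₀ *ᵥ v = cm M *ᵥ ![-(2 * d * s), Complex.I * (2 * d * s), 2] := by
    rw [hMdef, cm_mul, ← Matrix.mulVec_mulVec, hR, axisRotation_mulVec]
    congr 1
    ext i
    fin_cases i
    · simp [← hds]
    · simp [hv1, hds]
    · simp [hvσ, mul_comm]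
  have e₂' : C₂ = (s : ℂ) • cm M *ᵥ bonnetExp := by
    have h1 : bonnetExp = ![-(1 : ℂ), Complex.I * 1, 0] := by simp [bonnetExp]
    have h2 : cm R *ᵥ bonnetExp = bonnetExp := by
      rw [h1, hR, axisRotation_mulVec]
      simp
    rw [e₂, hMdef, cm_mul, ← Matrix.mulVec_mulVec, h2]
  obtain ⟨u, rfl⟩ := exists_cm_mulVec_eq hM C₀
  rw [e₂', dotProduct_smul, dot_cm hM] at h02
  rw [e₁, dot_cm hM] at h01
  rw [dot_cm hM] at h00
  simp only [dotProduct, bonnetExp, Fin.sum_univ_three, cons_val_zero, cons_val_one,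
    cons_val, smul_eq_mul] at h00 h01 h02
  have g₁ : s * (-u 0 + Complex.I * u 1) = -2 := by linear_combination h02
  have g₂ : u 2 = 2 * d := by linear_combination h01 / 2 - d * g₁
  have g₃ : -u 0 - Complex.I * u 1 = 2 * d ^ 2 * s := by
    rw [g₂] at h00
    linear_combination -(s / 2) * h00 + ((-u 0 - Complex.I * u 1) / 2) * g₁ +
      s * u 1 ^ 2 / 2 * Complex.I_sq
  have g₁' : -u 0 + Complex.I * u 1 = -2 * (s : ℂ)⁻¹ := by
    field_simp
    linear_combination g₁
  refine ⟨M, s, d, hM, hs, fun w => ?_⟩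
  have e₀ : u = ![(s : ℂ)⁻¹ - d ^ 2 * s, Complex.I * ((s : ℂ)⁻¹ + d ^ 2 * s), 2 * d] := by
    ext i
    fin_cases i
    · simp only [Fin.zero_eta, cons_val_zero]
      linear_combination -(g₁' + g₃) / 2
    · simp only [Fin.mk_one, cons_val_one, cons_val_zero]
      linear_combination -Complex.I * (g₁' - g₃) / 2 + u 1 * Complex.I_sq
    · simp [g₂]
  rw [e₁, e₂', e₀, ← mulVec_smul, ← mulVec_smul, ← mulVec_smul, ← mulVec_smul, ← mulVec_add,
    ← mulVec_add]
  congr 1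
  ext i
  fin_cases i
  · simp [enneperData, bonnetExp]
    field_simp
    ring
  · simp [enneperData, bonnetExp]
    field_simp
    ring
  · simp [enneperData, bonnetExp]
    field_simp
    ring

/-! ### Minimal surfaces and holomorphic null curves -/

theorem cross_zero (a b : E3) : cross a b 0 = a 1 * b 2 - a 2 * b 1 := by
  simp [cross, cross_apply]

theorem cross_one (a b : E3) : cross a b 1 = a 2 * b 0 - a 0 * b 2 := by
  simp [cross, cross_apply]

theorem cross_two (a b : E3) : cross a b 2 = a 0 * b 1 - a 1 * b 0 := by
  simp [cross, cross_apply]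

theorem inner_cross_left (a b : E3) : inner ℝ (cross a b) a = 0 := by
  simp only [inner_eq_sum, cross_zero, cross_one, cross_two]
  ring

theorem inner_cross_right (a b : E3) : inner ℝ (cross a b) b = 0 := by
  simp only [inner_eq_sum, cross_zero, cross_one, cross_two]
  ring

theorem cross_ne_zero {a b : E3} (h : ‖a‖ = ‖b‖) (hab : inner ℝ a b = 0) (ha : a ≠ 0) :
    cross a b ≠ 0 := by
  intro h0
  have h1 : inner ℝ (cross a b) (cross a b) = inner ℝ a a * inner ℝ b b - inner ℝ a b ^ 2 := by
    simp only [inner_eq_sum, cross_zero, cross_one, cross_two]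
    ring
  rw [h0, hab, inner_zero_left, real_inner_self_eq_norm_sq, real_inner_self_eq_norm_sq, ← h] at h1
  have : ‖a‖ ≠ 0 := norm_ne_zero_iff.2 ha
  have h2 : ‖a‖ ^ 2 * ‖a‖ ^ 2 = 0 := by linear_combination -h1
  simp [this] at h2

theorem eq_zero_of_inner_cross {a b V : E3} (hc : cross a b ≠ 0) (hVa : inner ℝ V a = 0)
    (hVb : inner ℝ V b = 0) (hVc : inner ℝ V (cross a b) = 0) : V = 0 := by
  -- The Gram determinant of `a, b, V` is the square of their triple product, expanded along `V`.
  have h1 : inner ℝ V V * inner ℝ (cross a b) (cross a b) = inner ℝ V (cross a b) ^ 2 +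
      inner ℝ a a * inner ℝ V b ^ 2 + inner ℝ b b * inner ℝ V a ^ 2 -
      2 * inner ℝ a b * inner ℝ V a * inner ℝ V b := by
    simp only [inner_eq_sum, cross_zero, cross_one, cross_two]
    ring
  rw [hVa, hVb, hVc] at h1
  have h2 : inner ℝ V V * inner ℝ (cross a b) (cross a b) = 0 := by linear_combination h1
  rcases mul_eq_zero.1 h2 with h | h
  · exact inner_self_eq_zero.1 h
  · exact absurd (inner_self_eq_zero.1 h) hc

/-- A real vector as a complex one. -/
def ofReal (x : E3) : Fin 3 → ℂ := fun i => (x i : ℂ)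

theorem ofReal_dot_ofReal (x y : E3) : ofReal x ⬝ᵥ ofReal y = (inner ℝ x y : ℝ) := by
  simp [ofReal, dotProduct, inner_eq_sum, Fin.sum_univ_three]

theorem inner_reMul (x : E3) (a : Fin 3 → ℂ) (w : ℂ) :
    inner ℝ x (reMul a w) = ((ofReal x ⬝ᵥ a) * w).re := by
  simp only [inner_eq_sum, reMul_apply, ofReal, dotProduct, Fin.sum_univ_three, add_mul,
    Complex.add_re, mul_assoc, Complex.re_ofReal_mul]

/-- A complex vector orthogonal to the null vector `a - i b` is determined up to sign by its
normal component. -/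
theorem dot_self_eq_normal_sq {a b : E3} (h : ‖a‖ = ‖b‖) (hab : inner ℝ a b = 0) (ha : a ≠ 0)
    {V : Fin 3 → ℂ} (hV : V ⬝ᵥ (ofReal a - Complex.I • ofReal b) = 0) :
    V ⬝ᵥ V = (ofReal (‖cross a b‖⁻¹ • cross a b) ⬝ᵥ V) ^ 2 := by
  have hc : ‖cross a b‖ ≠ 0 := norm_ne_zero_iff.2 (cross_ne_zero h hab ha)
  have hc2 : ((‖cross a b‖ : ℝ) : ℂ) ^ 2 = ofReal (cross a b) ⬝ᵥ ofReal (cross a b) := by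
    rw [ofReal_dot_ofReal, real_inner_self_eq_norm_sq]
    push_cast
    rfl
  have h1 : ofReal (‖cross a b‖⁻¹ • cross a b) ⬝ᵥ V =
      ((‖cross a b‖ : ℝ) : ℂ)⁻¹ * (ofReal (cross a b) ⬝ᵥ V) := by
    simp [ofReal, dotProduct, Fin.sum_univ_three]
    ring
  have h2 : (V ⬝ᵥ V) * (ofReal (cross a b) ⬝ᵥ ofReal (cross a b)) =
      (ofReal (cross a b) ⬝ᵥ V) ^ 2 + (ofReal a ⬝ᵥ ofReal a) * (V ⬝ᵥ ofReal b) ^ 2 +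
      (ofReal b ⬝ᵥ ofReal b) * (V ⬝ᵥ ofReal a) ^ 2 -
      2 * (ofReal a ⬝ᵥ ofReal b) * (V ⬝ᵥ ofReal a) * (V ⬝ᵥ ofReal b) := by
    simp only [dotProduct, ofReal, Fin.sum_univ_three, cross_zero, cross_one, cross_two]
    push_cast
    ring
  -- Now `V ⬝ a = i (V ⬝ b)`. As `a` and `b` are orthogonal and of equal length, the tangential
  -- terms in `h2` cancel.
  rw [dotProduct_sub, dotProduct_smul, sub_eq_zero, smul_eq_mul] at hV
  rw [h1, mul_pow, inv_pow, hc2, eq_comm, inv_mul_eq_iff_eq_mul₀, mul_comm, h2, hV,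
    ofReal_dot_ofReal a b, hab, ofReal_dot_ofReal, ofReal_dot_ofReal, real_inner_self_eq_norm_sq,
    real_inner_self_eq_norm_sq, h, Complex.ofReal_zero]
  · linear_combination -(((‖b‖ ^ 2 : ℝ) : ℂ) * (V ⬝ᵥ ofReal b) ^ 2) * Complex.I_sq
  · rw [← hc2]
    exact pow_ne_zero 2 (by exact_mod_cast hc)

/-- `X` is the real part of the integral of a holomorphic null curve without zeros. -/
structure IsNullData (D : Set ℂ) (X : ℂ → E3) (Φ : ℂ → Fin 3 → ℂ) : Prop where
  isOpen : IsOpen D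
  hasData : HasData D X Φ
  hasDerivAt : ∀ z ∈ D, HasDerivAt Φ (deriv Φ z) z
  null : ∀ z ∈ D, Φ z ⬝ᵥ Φ z = 0
  ne_zero : ∀ z ∈ D, Φ z ≠ 0

/-- The complex derivative `X_u - i X_v`. -/
def complexDeriv (X : ℂ → E3) (z : ℂ) : Fin 3 → ℂ :=
  ofReal (du X z) - Complex.I • ofReal (dv X z)

theorem complexDeriv_dot_self (X : ℂ → E3) (z : ℂ) : complexDeriv X z ⬝ᵥ complexDeriv X z =
    (‖du X z‖ ^ 2 - ‖dv X z‖ ^ 2 : ℝ) - 2 * Complex.I * (inner ℝ (du X z) (dv X z) : ℝ) := by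
  rw [complexDeriv]
  simp only [sub_dotProduct, dotProduct_sub, smul_dotProduct, dotProduct_smul, ofReal_dot_ofReal,
    smul_eq_mul, real_inner_comm (du X z) (dv X z), real_inner_self_eq_norm_sq]
  push_cast
  linear_combination (‖dv X z‖ : ℂ) ^ 2 * Complex.I_sq

theorem reMul_complexDeriv (X : ℂ → E3) (z w : ℂ) :
    reMul (complexDeriv X z) w = fderiv ℝ X z w := by
  have hw : w = w.re • (1 : ℂ) + w.im • Complex.I := by simp [Complex.re_add_im]
  have h1 : fderiv ℝ X z w = w.re • du X z + w.im • dv X z := by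
    conv_lhs => rw [hw]
    rw [map_add, map_smul, map_smul]
    rfl
  rw [h1]
  ext i
  simp [complexDeriv, ofReal, mul_comm]

theorem complexDeriv_of_hasFDerivAt {X : ℂ → E3} {a : Fin 3 → ℂ} {z : ℂ}
    (h : HasFDerivAt X (reMul a) z) : complexDeriv X z = a :=
  reMul_injective fun w => by rw [reMul_complexDeriv, h.fderiv]

/-- The coordinates of a conformal minimal immersion are harmonic, so that its complex derivative is
holomorphic. -/
theorem IsMinimalSurface.isNullData {D : Set ℂ} {X : ℂ → E3} (h : IsMinimalSurface D X) :
    IsNullData D X (complexDeriv X) := by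
  have hC := h.conformal
  have hcd : ∀ z ∈ D, ContDiffAt ℝ ∞ X z := fun z hz =>
    hC.smooth.contDiffAt (h.isOpen.mem_nhds hz)
  refine ⟨h.isOpen, fun z hz => ?_, fun z hz => ?_, fun z hz => ?_, fun z hz h0 => ?_⟩
  · have h1 : reMul (complexDeriv X z) = fderiv ℝ X z := by
      ext w : 1
      exact reMul_complexDeriv X z w
    rw [h1]
    exact ((hcd z hz).differentiableAt (by simp)).hasFDerivAt
  · set S := fderiv ℝ (fderiv ℝ X) z with hS
    have hSd : HasFDerivAt (fderiv ℝ X) S z :=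
      (((hcd z hz).fderiv_right (m := 1) (by norm_cast)).differentiableAt (by simp)).hasFDerivAt
    have h2 : (1 + 1 : WithTop ℕ∞) ≤ ∞ := by norm_cast
    have hsymm : ∀ v w, S v w = S w v :=
      fun v w => (hcd z hz).isSymmSndFDerivAt (by simpa [← one_add_one_eq_two] using h2) v w
    have hdu : HasFDerivAt (du X) (S.flip 1) z := by
      have h1 : HasFDerivAt (fun y => fderiv ℝ X y 1) (S.flip 1) z := by
        simpa using hSd.clm_apply (hasFDerivAt_const (1 : ℂ) z)
      exact h1
    have hdv : HasFDerivAt (dv X) (S.flip Complex.I) z := by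
      have h1 : HasFDerivAt (fun y => fderiv ℝ X y Complex.I) (S.flip Complex.I) z := by
        simpa using hSd.clm_apply (hasFDerivAt_const Complex.I z)
      exact h1
    have hn : ∀ v, inner ℝ (S v 1) (du X z) = inner ℝ (S v Complex.I) (dv X z) := by
      intro v
      have h1 : HasFDerivAt (fun w => inner ℝ (du X w) (du X w) - inner ℝ (dv X w) (dv X w))
          (0 : ℂ →L[ℝ] ℝ) z := by
        refine (hasFDerivAt_const (0 : ℝ) z).congr_of_eventuallyEq ?_
        filter_upwards [h.isOpen.mem_nhds hz] with w hw
        rw [real_inner_self_eq_norm_sq, real_inner_self_eq_norm_sq, hC.norm_eq w hw, sub_self]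
      have h2 := congrArg (fun T => T v) (((hdu.inner ℝ hdu).sub (hdv.inner ℝ hdv)).unique h1)
      simp [fderivInnerCLM_apply, real_inner_comm (S v 1), real_inner_comm (S v Complex.I)] at h2
      linarith
    have ho : ∀ v, inner ℝ (S v 1) (dv X z) + inner ℝ (S v Complex.I) (du X z) = 0 := by
      intro v
      have h1 : HasFDerivAt (fun w => inner ℝ (du X w) (dv X w)) (0 : ℂ →L[ℝ] ℝ) z := by
        refine (hasFDerivAt_const (0 : ℝ) z).congr_of_eventuallyEq ?_
        filter_upwards [h.isOpen.mem_nhds hz] with w hw using hC.orthogonal w hw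
      have h2 := congrArg (fun T => T v) ((hdu.inner ℝ hdv).unique h1)
      simp [fderivInnerCLM_apply] at h2
      rw [real_inner_comm (du X z)]
      linarith
    have hcr := cross_ne_zero (hC.norm_eq z hz) (hC.orthogonal z hz) (hC.immersion z hz)
    -- The differentiated conformality relations `hn` and `ho` kill the tangential components of
    -- `X_uu + X_vv`, and zero mean curvature kills the normal one.
    have hΔ : S 1 1 + S Complex.I Complex.I = 0 := by
      refine eq_zero_of_inner_cross hcr ?_ ?_ ?_
      · rw [inner_add_left, hn 1, hsymm 1, ho Complex.I]
      · rw [inner_add_left, ← hn Complex.I, hsymm Complex.I, ho 1]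
      · have h1 := h.minimal z hz
        have h2 : du (du X) z = S 1 1 := by rw [du, hdu.fderiv]; rfl
        have h3 : dv (dv X) z = S Complex.I Complex.I := by rw [dv, hdv.fderiv]; rfl
        rw [meanCurvature, h2, h3, unitNormal, inner_smul_right] at h1
        simpa [hC.immersion z hz, hcr] using h1
    have hΔ' : S Complex.I Complex.I = -S 1 1 := by
      rw [eq_neg_iff_add_eq_zero, add_comm, hΔ]
    -- The Cauchy–Riemann equations for `X_u - i X_v`: one is harmonicity, the other is the symmetry
    -- of second derivatives.
    have key : ∀ i, HasDerivAt (fun w => complexDeriv X w i)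
        ((S 1 1 i : ℂ) - Complex.I * (S 1 Complex.I i : ℂ)) z := by
      intro i
      have h1 : ∀ {Y : ℂ → E3} {T : ℂ →L[ℝ] E3}, HasFDerivAt Y T z → HasFDerivAt
          (fun w => ((Y w i : ℝ) : ℂ))
          (Complex.ofRealCLM.comp ((EuclideanSpace.proj i : E3 →L[ℝ] ℝ).comp T)) z :=
        fun hY => Complex.ofRealCLM.hasFDerivAt.comp z
          ((EuclideanSpace.proj i : E3 →L[ℝ] ℝ).hasFDerivAt.comp z hY)
      have h2 := (h1 hdu).sub ((h1 hdv).const_mul Complex.I)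
      refine hasDerivAt_of_hasFDerivAt_real h2 fun v => ?_
      have hv : v = v.re • (1 : ℂ) + v.im • Complex.I := by simp [Complex.re_add_im]
      have h3 : ∀ w, S v w = v.re • S 1 w + v.im • S Complex.I w := by
        intro w
        conv_lhs => rw [hv]
        rw [map_add, map_smul, map_smul]
        rfl
      have h4 : v = v.re + v.im * Complex.I := (Complex.re_add_im v).symm
      simp only [_root_.sub_apply, ContinuousLinearMap.comp_apply,
        ContinuousLinearMap.flip_apply, h3, hΔ', hsymm Complex.I 1, _root_.smul_apply]
      simp
      linear_combination (-(S 1 1 i : ℂ) + Complex.I * (S 1 Complex.I i : ℂ)) * h4 +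
        (v.im : ℂ) * (S 1 Complex.I i : ℂ) * Complex.I_sq
    have h5 : HasDerivAt (complexDeriv X) _ z := hasDerivAt_pi.2 key
    exact h5.differentiableAt.hasDerivAt
  · rw [complexDeriv_dot_self, hC.norm_eq z hz, hC.orthogonal z hz]
    simp
  · apply hC.immersion z hz
    ext i
    have h1 := congrArg Complex.re (congrFun h0 i)
    simpa [complexDeriv, ofReal] using h1

section Normal

variable {D : Set ℂ} {X : ℂ → E3} {Φ : ℂ → Fin 3 → ℂ}

theorem IsNullData.complexDeriv_eq (h : IsNullData D X Φ) {z : ℂ} (hz : z ∈ D) :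
    complexDeriv X z = Φ z := complexDeriv_of_hasFDerivAt (h.hasData z hz)

theorem IsNullData.conformal (h : IsNullData D X Φ) {z : ℂ} (hz : z ∈ D) :
    ‖du X z‖ = ‖dv X z‖ ∧ inner ℝ (du X z) (dv X z) = 0 ∧ du X z ≠ 0 := by
  have h1 := complexDeriv_dot_self X z
  rw [h.complexDeriv_eq hz, h.null z hz] at h1
  have hre := congrArg Complex.re h1
  have him := congrArg Complex.im h1
  simp only [Complex.zero_re, Complex.zero_im, Complex.sub_re, Complex.sub_im, Complex.mul_re,
    Complex.mul_im, Complex.ofReal_re, Complex.ofReal_im, Complex.I_re, Complex.I_im,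
    Complex.re_ofNat, Complex.im_ofNat] at hre him
  have hn : ‖du X z‖ = ‖dv X z‖ :=
    (sq_eq_sq₀ (norm_nonneg _) (norm_nonneg _)).1 (by linarith)
  refine ⟨hn, by linarith, fun h0 => h.ne_zero z hz ?_⟩
  have h2 : dv X z = 0 := by rwa [h0, norm_zero, eq_comm, norm_eq_zero] at hn
  rw [← h.complexDeriv_eq hz, complexDeriv, h0, h2]
  ext i
  simp [ofReal]

theorem IsNullData.cross_ne_zero (h : IsNullData D X Φ) {z : ℂ} (hz : z ∈ D) :
    cross (du X z) (dv X z) ≠ 0 :=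
  PlanarCurvature.cross_ne_zero (h.conformal hz).1 (h.conformal hz).2.1 (h.conformal hz).2.2

theorem IsNullData.norm_unitNormal (h : IsNullData D X Φ) {z : ℂ} (hz : z ∈ D) :
    ‖unitNormal X z‖ = 1 := by
  rw [unitNormal, norm_smul, norm_inv, norm_norm,
    inv_mul_cancel₀ (norm_ne_zero_iff.2 (h.cross_ne_zero hz))]

theorem IsNullData.fderiv_eq (h : IsNullData D X Φ) {z : ℂ} (hz : z ∈ D) (w : ℂ) :
    fderiv ℝ X z w = reMul (Φ z) w := by
  rw [(h.hasData z hz).fderiv]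

theorem IsNullData.inner_unitNormal (h : IsNullData D X Φ) {z : ℂ} (hz : z ∈ D) (w : ℂ) :
    inner ℝ (unitNormal X z) (reMul (Φ z) w) = 0 := by
  have hw : w = w.re • (1 : ℂ) + w.im • Complex.I := by simp [Complex.re_add_im]
  rw [hw, map_add, map_smul, map_smul, ← h.fderiv_eq hz, ← h.fderiv_eq hz]
  change inner ℝ (unitNormal X z) (w.re • du X z + w.im • dv X z) = 0
  rw [unitNormal, inner_add_right, inner_smul_right, inner_smul_right, inner_smul_left,
    inner_smul_left, inner_cross_left, inner_cross_right]
  simp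

theorem IsNullData.eq_zero_of_inner (h : IsNullData D X Φ) {z : ℂ} (hz : z ∈ D) {V : E3}
    (hN : inner ℝ V (unitNormal X z) = 0) (ht : ∀ w, inner ℝ V (reMul (Φ z) w) = 0) : V = 0 := by
  refine eq_zero_of_inner_cross (h.cross_ne_zero hz) ?_ ?_ ?_
  · have := ht 1
    rwa [← h.fderiv_eq hz] at this
  · have := ht Complex.I
    rwa [← h.fderiv_eq hz] at this
  · rw [unitNormal, inner_smul_right] at hN
    simpa [h.cross_ne_zero hz] using hN

theorem IsNullData.differentiableAt_unitNormal (h : IsNullData D X Φ) {z : ℂ} (hz : z ∈ D) :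
    DifferentiableAt ℝ (unitNormal X) z := by
  have hΦ : ∀ i, DifferentiableAt ℝ (fun w => Φ w i) z := fun i =>
    (((hasDerivAt_pi.1 (h.hasDerivAt z hz)) i).differentiableAt).restrictScalars ℝ
  have hdu : ∀ i, DifferentiableAt ℝ (fun w => du X w i) z := by
    intro i
    refine (Complex.reCLM.differentiableAt.comp z (hΦ i)).congr_of_eventuallyEq ?_
    filter_upwards [h.isOpen.mem_nhds hz] with w hw
    rw [du, h.fderiv_eq hw]
    simp
  have hdv : ∀ i, DifferentiableAt ℝ (fun w => dv X w i) z := by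
    intro i
    refine ((Complex.imCLM.differentiableAt.comp z (hΦ i)).neg).congr_of_eventuallyEq ?_
    filter_upwards [h.isOpen.mem_nhds hz] with w hw
    rw [dv, h.fderiv_eq hw]
    simp
  have hcr : DifferentiableAt ℝ (fun w => cross (du X w) (dv X w)) z := by
    rw [differentiableAt_euclidean]
    intro i
    have h0 := hdu 0
    have h1 := hdu 1
    have h2 := hdu 2
    have k0 := hdv 0
    have k1 := hdv 1
    have k2 := hdv 2
    fin_cases i
    · simp only [Fin.zero_eta, cross_zero]
      fun_prop
    · simp only [Fin.mk_one, cross_one]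
      fun_prop
    · simp only [Fin.reduceFinMk, cross_two]
      fun_prop
  exact ((hcr.norm ℝ (h.cross_ne_zero hz)).inv (norm_ne_zero_iff.2 (h.cross_ne_zero hz))).smul hcr

/-- The normal component of the derivative of `Φ`; it is a square root of the Hopf differential. -/
def normalDeriv (X : ℂ → E3) (Φ : ℂ → Fin 3 → ℂ) (z : ℂ) : ℂ :=
  ofReal (unitNormal X z) ⬝ᵥ deriv Φ z

theorem IsNullData.dot_deriv (h : IsNullData D X Φ) {z : ℂ} (hz : z ∈ D) :
    Φ z ⬝ᵥ deriv Φ z = 0 :=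
  dot_deriv_eq_zero h.isOpen h.hasDerivAt h.null z hz

/-- Since `Φ ⬝ Φ' = 0`, the tangential part of `Φ'` is a multiple of the null vector `Φ` and
contributes nothing to the square. -/
theorem IsNullData.normalDeriv_sq (h : IsNullData D X Φ) {z : ℂ} (hz : z ∈ D) :
    normalDeriv X Φ z ^ 2 = deriv Φ z ⬝ᵥ deriv Φ z := by
  have hc := h.conformal hz
  refine (dot_self_eq_normal_sq hc.1 hc.2.1 hc.2.2 ?_).symm
  have h1 := h.dot_deriv hz
  rw [← h.complexDeriv_eq hz, dotProduct_comm] at h1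
  exact h1

/-- The second fundamental form is `Re (ν v w)`, as one sees by differentiating `⟨N, Re (Φ w)⟩ = 0`.
-/
theorem IsNullData.inner_fderiv_unitNormal (h : IsNullData D X Φ) {z : ℂ} (hz : z ∈ D) (v w : ℂ) :
    inner ℝ (fderiv ℝ (unitNormal X) z v) (reMul (Φ z) w) =
      -(normalDeriv X Φ z * v * w).re := by
  have h1 : HasFDerivAt (fun y => inner ℝ (unitNormal X y) (reMul (Φ y) w)) (0 : ℂ →L[ℝ] ℝ) z := by
    refine (hasFDerivAt_const (0 : ℝ) z).congr_of_eventuallyEq ?_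
    filter_upwards [h.isOpen.mem_nhds hz] with y hy using h.inner_unitNormal hy w
  have h2 : HasFDerivAt (fun y => reMul (Φ y) w) (reMul (w • deriv Φ z)) z := by
    have h3 := hasFDerivAt_re (F := fun y i => Φ y i * w) (a := w • deriv Φ z) (z := z) fun i => by
      simpa [mul_comm] using ((hasDerivAt_pi.1 (h.hasDerivAt z hz)) i).mul_const w
    exact h3
  have h4 := congrArg (fun T => T v)
    (((h.differentiableAt_unitNormal hz).hasFDerivAt.inner ℝ h2).unique h1)
  simp [fderivInnerCLM_apply, inner_reMul, -reMul_apply] at h4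
  rw [inner_reMul, normalDeriv]
  simp only [Complex.mul_re, Complex.mul_im] at h4 ⊢
  linarith

theorem IsNullData.inner_fderiv_unitNormal_self (h : IsNullData D X Φ) {z : ℂ} (hz : z ∈ D)
    (v : ℂ) : inner ℝ (fderiv ℝ (unitNormal X) z v) (unitNormal X z) = 0 := by
  have h1 : HasFDerivAt (fun y => inner ℝ (unitNormal X y) (unitNormal X y))
      (0 : ℂ →L[ℝ] ℝ) z := by
    refine (hasFDerivAt_const (1 : ℝ) z).congr_of_eventuallyEq ?_
    filter_upwards [h.isOpen.mem_nhds hz] with y hy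
    rw [real_inner_self_eq_norm_sq, h.norm_unitNormal hy, one_pow]
  have hN := (h.differentiableAt_unitNormal hz).hasFDerivAt
  have h4 := congrArg (fun T => T v) ((hN.inner ℝ hN).unique h1)
  simp [fderivInnerCLM_apply] at h4
  rw [real_inner_comm] at h4 ⊢
  linarith [real_inner_comm (unitNormal X z) (fderiv ℝ (unitNormal X) z v)]

/-- The images of `v` and `i v` are orthogonal and of equal length, and the component of `dN(v)`
along the second one is proportional to `Im (ν v²)`. -/
theorem IsNullData.isPrincipal (h : IsNullData D X Φ) {z : ℂ} (hz : z ∈ D) {v : ℂ} (hv : v ≠ 0)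
    (hν : (normalDeriv X Φ z * v ^ 2).im = 0) : IsPrincipal X z v := by
  refine ⟨hv, ?_⟩
  set W := reMul (Φ z) v with hW
  have hc := h.conformal hz
  have e : ∀ y, reMul (Φ z) y = y.re • du X z + y.im • dv X z := fun y => by
    have hy : y = y.re • (1 : ℂ) + y.im • Complex.I := by simp [Complex.re_add_im]
    rw [← h.fderiv_eq hz]
    conv_lhs => rw [hy]
    rw [map_add, map_smul, map_smul]
    rfl
  have hW0 : ‖W‖ ^ 2 ≠ 0 := by
    have h1 : ‖W‖ ^ 2 = Complex.normSq v * ‖du X z‖ ^ 2 := by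
      rw [← real_inner_self_eq_norm_sq, hW, e]
      simp only [inner_add_left, inner_add_right, inner_smul_left, inner_smul_right,
        real_inner_comm (du X z) (dv X z), hc.2.1, real_inner_self_eq_norm_sq, ← hc.1,
        Complex.normSq_apply]
      simp
      ring
    rw [h1]
    exact mul_ne_zero (by simpa using hv) (pow_ne_zero 2 (norm_ne_zero_iff.2 hc.2.2))
  have hWW : ∀ w, inner ℝ W (reMul (Φ z) w) = (w / v).re * ‖W‖ ^ 2 := by
    have hWi : inner ℝ W (reMul (Φ z) (Complex.I * v)) = 0 := by
      rw [hW, e, e]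
      simp only [inner_add_left, inner_add_right, inner_smul_left, inner_smul_right,
        real_inner_comm (du X z) (dv X z), hc.2.1, real_inner_self_eq_norm_sq, hc.1]
      simp
      ring
    intro w
    have hw : w = (w / v).re • v + (w / v).im • (Complex.I * v) := by
      have h1 := Complex.re_add_im (w / v)
      rw [Complex.real_smul, Complex.real_smul, ← mul_assoc, ← add_mul, h1, div_mul_cancel₀ _ hv]
    conv_lhs => rw [hw]
    rw [map_add, map_smul, map_smul, inner_add_right, inner_smul_right, inner_smul_right, hWi,
      ← hW, real_inner_self_eq_norm_sq]
    ring
  set κ : ℝ := (normalDeriv X Φ z * v ^ 2).re / ‖W‖ ^ 2 with hκ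
  refine ⟨κ, ?_⟩
  rw [h.fderiv_eq hz, ← sub_eq_zero]
  refine h.eq_zero_of_inner hz ?_ fun w => ?_
  · rw [inner_sub_left, h.inner_fderiv_unitNormal_self hz, inner_smul_left, real_inner_comm,
      h.inner_unitNormal hz]
    simp
  · rw [inner_sub_left, h.inner_fderiv_unitNormal hz, inner_smul_left, hWW]
    have hw : normalDeriv X Φ z * v * w = normalDeriv X Φ z * v ^ 2 * (w / v) := by
      field_simp
    have h1 : κ * ‖W‖ ^ 2 = (normalDeriv X Φ z * v ^ 2).re := div_mul_cancel₀ _ hW0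
    rw [hw, Complex.mul_re, hν, ← h1]
    simp only [conj_trivial]
    ring

end Normal

/-! ### The trajectories of a holomorphic vector field -/

/-- A local primitive `W` of `p` straightens the vector field `1 / p`: its trajectory is `t ↦ W⁻¹ (W
z₀ + t)`, and the holomorphic inverse function theorem gives its smoothness. -/
theorem exists_trajectory {U : Set ℂ} (hU : IsOpen U) {p : ℂ → ℂ} (hp : DifferentiableOn ℂ p U)
    (hp0 : ∀ z ∈ U, p z ≠ 0) {z₀ : ℂ} (hz₀ : z₀ ∈ U) :
    ∃ (ε : ℝ) (γ : ℝ → ℂ), 0 < ε ∧ γ 0 = z₀ ∧ ContDiffOn ℝ ∞ γ (Ioo (-ε) ε) ∧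
      ∀ t ∈ Ioo (-ε) ε, γ t ∈ U ∧ HasDerivAt γ (p (γ t))⁻¹ t := by
  obtain ⟨δ, hδ, hball⟩ := Metric.isOpen_iff.1 hU z₀ hz₀
  obtain ⟨W, hW⟩ := (hp.mono hball).isExactOn_ball
  have hW' : DifferentiableOn ℂ W (Metric.ball z₀ δ) := fun z hz =>
    (hW z hz).differentiableAt.differentiableWithinAt
  have hz₀' : z₀ ∈ Metric.ball z₀ δ := Metric.mem_ball_self hδ
  have hstrict : HasStrictDerivAt W (p z₀) z₀ := by
    have h1 := (hW'.analyticAt (Metric.isOpen_ball.mem_nhds hz₀')).hasStrictDerivAt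
    rwa [(hW z₀ hz₀').deriv] at h1
  set f := (hstrict.hasStrictFDerivAt_equiv (hp0 z₀ hz₀)).toOpenPartialHomeomorph W with hf
  have hfW : ∀ z, f z = W z := fun z => rfl
  have hsrc : z₀ ∈ f.source :=
    (hstrict.hasStrictFDerivAt_equiv (hp0 z₀ hz₀)).mem_toOpenPartialHomeomorph_source
  set V := f.target ∩ f.symm ⁻¹' Metric.ball z₀ δ with hV
  have hVo : IsOpen V := f.isOpen_inter_preimage_symm Metric.isOpen_ball
  have hg : ∀ w ∈ V, HasDerivAt f.symm (p (f.symm w))⁻¹ w := fun w hw =>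
    f.hasDerivAt_symm hw.1 (hp0 _ (hball hw.2)) (hW _ hw.2)
  have hV0 : W z₀ ∈ V := by
    refine ⟨f.map_source hsrc, ?_⟩
    have : f.symm (W z₀) = z₀ := f.left_inv hsrc
    simpa [this] using hδ
  obtain ⟨ε, hε, hεV⟩ := Metric.isOpen_iff.1 hVo _ hV0
  have hmem : ∀ t ∈ Ioo (-ε) ε, W z₀ + (t : ℂ) ∈ V := by
    intro t ht
    apply hεV
    simpa [abs_lt] using ht
  refine ⟨ε, fun t => f.symm (W z₀ + t), hε, ?_, ?_, fun t ht => ⟨hball (hmem t ht).2, ?_⟩⟩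
  · simp only [Complex.ofReal_zero, add_zero]
    exact f.left_inv hsrc
  · refine (contDiffOn_of_hasDerivAt hVo hg).comp ?_ hmem
    exact (contDiff_const.add Complex.ofRealCLM.contDiff).contDiffOn
  · have h1 : HasDerivAt (fun t : ℝ => W z₀ + (t : ℂ)) 1 t :=
      (Complex.ofRealCLM.hasDerivAt).const_add _
    have h2 := (hg _ (hmem t ht)).scomp t h1
    rw [one_smul] at h2
    exact h2

/-! ### Frames adapted to the Hopf differential -/

/-- `p⁴` is a quarter of the Hopf differential `Φ' ⬝ Φ'` of the holomorphic null curve `Φ`. -/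
structure IsHopfRoot (U : Set ℂ) (Φ : ℂ → Fin 3 → ℂ) (p : ℂ → ℂ) : Prop where
  isOpen : IsOpen U
  differentiableOn : DifferentiableOn ℂ Φ U
  null : ∀ z ∈ U, Φ z ⬝ᵥ Φ z = 0
  root : DifferentiableOn ℂ p U
  root_ne_zero : ∀ z ∈ U, p z ≠ 0
  root_pow : ∀ z ∈ U, 4 * p z ^ 4 = deriv Φ z ⬝ᵥ deriv Φ z

/-- The iterated derivatives of `Φ / p` with respect to a primitive of `p`. -/
def frame (p : ℂ → ℂ) (Φ : ℂ → Fin 3 → ℂ) : ℕ → ℂ → Fin 3 → ℂ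
  | 0 => fun z => (p z)⁻¹ • Φ z
  | k + 1 => fun z => (p z)⁻¹ • deriv (frame p Φ k) z

namespace IsHopfRoot

variable {U : Set ℂ} {Φ : ℂ → Fin 3 → ℂ} {p : ℂ → ℂ}

theorem differentiableOn_frame (h : IsHopfRoot U Φ p) (k : ℕ) :
    DifferentiableOn ℂ (frame p Φ k) U := by
  induction k with
  | zero => exact (h.root.inv h.root_ne_zero).smul h.differentiableOn
  | succ k ih => exact (h.root.inv h.root_ne_zero).smul (ih.deriv h.isOpen)

theorem hasDerivAt_frame (h : IsHopfRoot U Φ p) (k : ℕ) {z : ℂ} (hz : z ∈ U) :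
    HasDerivAt (frame p Φ k) (p z • frame p Φ (k + 1) z) z := by
  have h1 := ((h.differentiableOn_frame k).differentiableAt (h.isOpen.mem_nhds hz)).hasDerivAt
  simpa [frame, smul_smul, h.root_ne_zero z hz] using h1

theorem eq_smul_frame (h : IsHopfRoot U Φ p) {z : ℂ} (hz : z ∈ U) : Φ z = p z • frame p Φ 0 z := by
  simp [frame, smul_smul, h.root_ne_zero z hz]

theorem hasDerivAt_frame_dot (h : IsHopfRoot U Φ p) (j k : ℕ) {z : ℂ} (hz : z ∈ U) :
    HasDerivAt (fun w => frame p Φ j w ⬝ᵥ frame p Φ k w)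
      (p z * (frame p Φ (j + 1) z ⬝ᵥ frame p Φ k z + frame p Φ j z ⬝ᵥ frame p Φ (k + 1) z)) z := by
  have h1 := HasDerivAt.dot (h.hasDerivAt_frame j hz) (h.hasDerivAt_frame k hz)
  simpa [smul_dotProduct, dotProduct_smul, mul_add] using h1

/-- Differentiating a constant product yields the next ones; the Gram matrix of the frame is found
by iterating this. -/
theorem frame_dot_add (h : IsHopfRoot U Φ p) {j k : ℕ} {c : ℂ}
    (hc : ∀ z ∈ U, frame p Φ j z ⬝ᵥ frame p Φ k z = c) {z : ℂ} (hz : z ∈ U) :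
    frame p Φ (j + 1) z ⬝ᵥ frame p Φ k z + frame p Φ j z ⬝ᵥ frame p Φ (k + 1) z = 0 := by
  have h2 : HasDerivAt (fun w => frame p Φ j w ⬝ᵥ frame p Φ k w) 0 z := by
    refine (hasDerivAt_const z c).congr_of_eventuallyEq ?_
    filter_upwards [h.isOpen.mem_nhds hz] with w hw using hc w hw
  exact (mul_eq_zero.1 ((h.hasDerivAt_frame_dot j k hz).unique h2)).resolve_left
    (h.root_ne_zero z hz)

theorem frame_zero_zero (h : IsHopfRoot U Φ p) : ∀ z ∈ U, frame p Φ 0 z ⬝ᵥ frame p Φ 0 z = 0 := by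
  intro z hz
  simp [frame, smul_dotProduct, dotProduct_smul, h.null z hz]

theorem frame_zero_one (h : IsHopfRoot U Φ p) : ∀ z ∈ U, frame p Φ 0 z ⬝ᵥ frame p Φ 1 z = 0 := by
  intro z hz
  have h1 := h.frame_dot_add h.frame_zero_zero hz
  rw [dotProduct_comm] at h1
  simp only [zero_add] at h1
  linear_combination h1 / 2

/-- From `Φ = p f₀` one gets `Φ' = p' f₀ + p² f₁`, whose square is `p⁴ (f₁ ⬝ f₁)`; the normalization
of `p` does the rest. -/
theorem frame_one_one (h : IsHopfRoot U Φ p) : ∀ z ∈ U, frame p Φ 1 z ⬝ᵥ frame p Φ 1 z = 4 := by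
  intro z hz
  have hp : HasDerivAt p (deriv p z) z :=
    (h.root.differentiableAt (h.isOpen.mem_nhds hz)).hasDerivAt
  have h0 := h.root_ne_zero z hz
  have h1 : deriv Φ z = deriv p z • frame p Φ 0 z + p z ^ 2 • frame p Φ 1 z := by
    have h2 : HasDerivAt Φ _ z := (hp.smul (h.hasDerivAt_frame 0 hz)).congr_of_eventuallyEq (by
      filter_upwards [h.isOpen.mem_nhds hz] with w hw using h.eq_smul_frame hw)
    rw [h2.deriv, smul_smul, add_comm, pow_two]
  have h3 := h.root_pow z hz
  rw [h1] at h3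
  simp only [add_dotProduct, dotProduct_add, smul_dotProduct, dotProduct_smul, smul_eq_mul,
    h.frame_zero_zero z hz, h.frame_zero_one z hz,
    dotProduct_comm (frame p Φ 1 z) (frame p Φ 0 z)] at h3
  have h4 : p z ^ 4 * (frame p Φ 1 z ⬝ᵥ frame p Φ 1 z - 4) = 0 := by linear_combination -h3
  have h5 := (mul_eq_zero.1 h4).resolve_left (pow_ne_zero 4 h0)
  linear_combination h5

theorem frame_zero_two (h : IsHopfRoot U Φ p) : ∀ z ∈ U, frame p Φ 0 z ⬝ᵥ frame p Φ 2 z = -4 := by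
  intro z hz
  have h1 := h.frame_dot_add h.frame_zero_one hz
  simp only [zero_add, h.frame_one_one z hz] at h1
  linear_combination h1

theorem frame_one_two (h : IsHopfRoot U Φ p) : ∀ z ∈ U, frame p Φ 1 z ⬝ᵥ frame p Φ 2 z = 0 := by
  intro z hz
  have h1 := h.frame_dot_add h.frame_one_one hz
  rw [dotProduct_comm] at h1
  simp only [Nat.reduceAdd] at h1
  linear_combination h1 / 2

theorem frame_zero_three (h : IsHopfRoot U Φ p) :
    ∀ z ∈ U, frame p Φ 0 z ⬝ᵥ frame p Φ 3 z = 0 := by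
  intro z hz
  have h1 := h.frame_dot_add h.frame_zero_two hz
  simp only [zero_add, Nat.reduceAdd, h.frame_one_two z hz] at h1
  exact h1

theorem frame_one_three (h : IsHopfRoot U Φ p) {z : ℂ} (hz : z ∈ U) :
    frame p Φ 1 z ⬝ᵥ frame p Φ 3 z = -(frame p Φ 2 z ⬝ᵥ frame p Φ 2 z) := by
  have h1 := h.frame_dot_add h.frame_one_two hz
  simp only [Nat.reduceAdd] at h1
  linear_combination h1

end IsHopfRoot

/-- The invariant of the surface that is constant if its curvature lines are planar. -/
def frameInvariant (p : ℂ → ℂ) (Φ : ℂ → Fin 3 → ℂ) (z : ℂ) : ℂ :=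
  -(frame p Φ 2 z ⬝ᵥ frame p Φ 2 z) / 16

def frameMatrix (p : ℂ → ℂ) (Φ : ℂ → Fin 3 → ℂ) (z : ℂ) : Matrix (Fin 3) (Fin 3) ℂ :=
  Matrix.of ![frame p Φ 0 z, frame p Φ 1 z, frame p Φ 2 z]

theorem frameMatrix_mulVec (p : ℂ → ℂ) (Φ : ℂ → Fin 3 → ℂ) (z : ℂ) (n : Fin 3 → ℂ) :
    frameMatrix p Φ z *ᵥ n = ![frame p Φ 0 z ⬝ᵥ n, frame p Φ 1 z ⬝ᵥ n, frame p Φ 2 z ⬝ᵥ n] := by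
  ext i
  fin_cases i <;> rfl

namespace IsHopfRoot

variable {U : Set ℂ} {Φ : ℂ → Fin 3 → ℂ} {p : ℂ → ℂ}

theorem frame_two_two (p : ℂ → ℂ) (Φ : ℂ → Fin 3 → ℂ) (z : ℂ) :
    frame p Φ 2 z ⬝ᵥ frame p Φ 2 z = -16 * frameInvariant p Φ z := by
  rw [frameInvariant]
  ring

theorem gram (h : IsHopfRoot U Φ p) {z : ℂ} (hz : z ∈ U) :
    frameMatrix p Φ z * (frameMatrix p Φ z)ᵀ =
      !![0, 0, -4; 0, 4, 0; -4, 0, -16 * frameInvariant p Φ z] := by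
  ext i j
  have e : (frameMatrix p Φ z * (frameMatrix p Φ z)ᵀ) i j =
      frameMatrix p Φ z i ⬝ᵥ frameMatrix p Φ z j := rfl
  have r0 : frameMatrix p Φ z 0 = frame p Φ 0 z := rfl
  have r1 : frameMatrix p Φ z 1 = frame p Φ 1 z := rfl
  have r2 : frameMatrix p Φ z 2 = frame p Φ 2 z := rfl
  rw [e]
  fin_cases i <;> fin_cases j <;>
    simp [r0, r1, r2, h.frame_zero_zero z hz, h.frame_zero_one z hz, h.frame_zero_two z hz,
      h.frame_one_one z hz, h.frame_one_two z hz, frame_two_two,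
      dotProduct_comm (frame p Φ 1 z) (frame p Φ 0 z),
      dotProduct_comm (frame p Φ 2 z) (frame p Φ 0 z),
      dotProduct_comm (frame p Φ 2 z) (frame p Φ 1 z)]

theorem gram_mul (q : ℂ) : !![0, 0, -4; 0, 4, 0; -4, 0, -16 * q] *
    !![q, 0, -1 / 4; 0, 1 / 4, 0; -1 / 4, 0, 0] = (1 : Matrix (Fin 3) (Fin 3) ℂ) := by
  ext i j
  fin_cases i <;> fin_cases j <;> simp [Matrix.mul_apply, Fin.sum_univ_three] <;> ring

theorem dot_eq (h : IsHopfRoot U Φ p) {z : ℂ} (hz : z ∈ U) (n : Fin 3 → ℂ) : n ⬝ᵥ n =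
    frameInvariant p Φ z * (frame p Φ 0 z ⬝ᵥ n) ^ 2 -
      (frame p Φ 0 z ⬝ᵥ n) * (frame p Φ 2 z ⬝ᵥ n) / 2 + (frame p Φ 1 z ⬝ᵥ n) ^ 2 / 4 := by
  rw [dot_eq_of_gram (h.gram hz) (gram_mul _) n, frameMatrix_mulVec]
  simp [mulVec, dotProduct, Fin.sum_univ_three]
  ring

theorem eq_zero_of_frame (h : IsHopfRoot U Φ p) {z : ℂ} (hz : z ∈ U) {n : Fin 3 → ℂ}
    (h0 : frame p Φ 0 z ⬝ᵥ n = 0) (h1 : frame p Φ 1 z ⬝ᵥ n = 0) (h2 : frame p Φ 2 z ⬝ᵥ n = 0) :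
    n = 0 := by
  refine eq_zero_of_gram (h.gram hz) (gram_mul _) ?_
  rw [frameMatrix_mulVec, h0, h1, h2]
  ext i
  fin_cases i <;> rfl

/-- The trajectories of `1 / p` are curvature lines, and the invariant is real if these are planar.
-/
theorem im_frameInvariant (h : IsHopfRoot U Φ p) {D : Set ℂ} {X : ℂ → E3} (hX : IsNullData D X Φ)
    (hUD : U ⊆ D) (hpl : HasPlanarCurvatureLines D X) {z₀ : ℂ} (hz₀ : z₀ ∈ U) :
    (frameInvariant p Φ z₀).im = 0 := by
  obtain ⟨ε, γ, hε, hγ0, hγs, hγ⟩ := exists_trajectory h.isOpen h.root h.root_ne_zero hz₀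
  have hcl : IsCurvatureLine D X (-ε) ε γ := by
    refine ⟨hγs, fun t ht => ⟨hUD (hγ t ht).1, ?_⟩⟩
    have hz := (hγ t ht).1
    have hp := h.root_ne_zero _ hz
    rw [(hγ t ht).2.deriv]
    refine hX.isPrincipal (hUD hz) (inv_ne_zero hp) ?_
    have h1 := hX.normalDeriv_sq (hUD hz)
    rw [← h.root_pow _ hz] at h1
    -- Here `ν² = 4 p⁴`, so `ν` takes the real value `2` or `-2` on the pair `(1/p, 1/p)`.
    have h2 : (normalDeriv X Φ (γ t) * (p (γ t))⁻¹ ^ 2 - 2) *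
        (normalDeriv X Φ (γ t) * (p (γ t))⁻¹ ^ 2 + 2) = 0 := by
      field_simp
      linear_combination h1
    rcases mul_eq_zero.1 h2 with h3 | h3
    · rw [sub_eq_zero.1 h3]; simp
    · rw [eq_neg_of_add_eq_zero_left h3]; simp
  obtain ⟨n, hn, c, hc⟩ := hpl _ _ _ hcl
  -- Because `γ' = 1 / p`, differentiation along `γ` raises the index of the frame by one.
  have step : ∀ (k : ℕ) (t : ℝ), t ∈ Ioo (-ε) ε →
      HasDerivAt (fun s => (frame p Φ k (γ s) ⬝ᵥ ofReal n).re)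
        (frame p Φ (k + 1) (γ t) ⬝ᵥ ofReal n).re t := by
    intro k t ht
    have hp := h.root_ne_zero _ (hγ t ht).1
    have h1 := HasDerivAt.dot (h.hasDerivAt_frame k (hγ t ht).1)
      (hasDerivAt_const (γ t) (ofReal n))
    have h2 := h1.scomp t (hγ t ht).2
    have h3 := (Complex.reCLM.hasFDerivAt).comp_hasDerivAt t h2
    refine h3.congr_deriv ?_
    simp [smul_dotProduct, hp]
  have h0 : ∀ t ∈ Ioo (-ε) ε, (frame p Φ 0 (γ t) ⬝ᵥ ofReal n).re = 0 := by
    intro t ht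
    have hp := h.root_ne_zero _ (hγ t ht).1
    have h1 : HasDerivAt (fun s => inner ℝ n (X (γ s)))
        (inner ℝ n (reMul (Φ (γ t)) (p (γ t))⁻¹)) t := by
      have h2 := (hX.hasData _ (hUD (hγ t ht).1)).comp_hasDerivAt t (hγ t ht).2
      simpa using (hasDerivAt_const t n).inner ℝ h2
    have h3 : HasDerivAt (fun s => inner ℝ n (X (γ s))) 0 t :=
      (hasDerivAt_const t c).congr_of_eventuallyEq (by
        filter_upwards [isOpen_Ioo.mem_nhds ht] with s hs using hc s hs)
    have h4 := h1.unique h3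
    rw [inner_reMul, h.eq_smul_frame (hγ t ht).1, dotProduct_smul, smul_eq_mul, mul_comm,
      inv_mul_cancel_left₀ hp, dotProduct_comm] at h4
    exact h4
  have next : ∀ k, (∀ t ∈ Ioo (-ε) ε, (frame p Φ k (γ t) ⬝ᵥ ofReal n).re = 0) →
      ∀ t ∈ Ioo (-ε) ε, (frame p Φ (k + 1) (γ t) ⬝ᵥ ofReal n).re = 0 := by
    intro k hk t ht
    refine (step k t ht).unique ((hasDerivAt_const t (0 : ℝ)).congr_of_eventuallyEq ?_)
    filter_upwards [isOpen_Ioo.mem_nhds ht] with s hs using hk s hs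
  have hmem : (0 : ℝ) ∈ Ioo (-ε) ε := ⟨by linarith, hε⟩
  have r0 := h0 0 hmem
  have r1 := next 0 h0 0 hmem
  have r2 := next 1 (next 0 h0) 0 hmem
  rw [hγ0] at r0 r1 r2
  have hdot := h.dot_eq hz₀ (ofReal n)
  rw [ofReal_dot_ofReal, real_inner_self_eq_norm_sq] at hdot
  have hn2 : 0 < ‖n‖ ^ 2 := by positivity
  generalize frame p Φ 0 z₀ ⬝ᵥ ofReal n = a at *
  generalize frame p Φ (0 + 1) z₀ ⬝ᵥ ofReal n = b at *
  generalize frame p Φ (1 + 1) z₀ ⬝ᵥ ofReal n = c' at *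
  have ea : a = a.im * Complex.I := by apply Complex.ext <;> simp [r0]
  have eb : b = b.im * Complex.I := by apply Complex.ext <;> simp [r1]
  have ec : c' = c'.im * Complex.I := by apply Complex.ext <;> simp [r2]
  -- The products `a`, `b`, `c'` of `n` with the frame are imaginary, so in the Gram formula for
  -- `|n|²` only the invariant can fail to be real.
  have e2 : ((‖n‖ ^ 2 : ℝ) : ℂ) = frameInvariant p Φ z₀ * ((-a.im ^ 2 : ℝ) : ℂ) +
      ((a.im * c'.im / 2 - b.im ^ 2 / 4 : ℝ) : ℂ) := by
    rw [hdot, ea, eb, ec]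
    push_cast
    simp
    linear_combination (frameInvariant p Φ z₀ * a.im ^ 2 - a.im * c'.im / 2 + b.im ^ 2 / 4) *
      Complex.I_sq
  have him := congrArg Complex.im e2
  have hre := congrArg Complex.re e2
  rw [Complex.add_im, Complex.im_mul_ofReal, Complex.ofReal_im, Complex.ofReal_im] at him
  rw [Complex.add_re, Complex.re_mul_ofReal, Complex.ofReal_re, Complex.ofReal_re] at hre
  -- Otherwise `|n|² = -(Im b)² / 4`, which is not positive.
  have ha : a.im ≠ 0 := by
    intro h0
    rw [h0] at hre
    nlinarith [sq_nonneg b.im]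
  have h7 : (frameInvariant p Φ z₀).im * a.im ^ 2 = 0 := by linarith
  exact (mul_eq_zero.1 h7).resolve_right (pow_ne_zero 2 ha)

theorem hasDerivAt_frameInvariant (h : IsHopfRoot U Φ p) {z : ℂ} (hz : z ∈ U) :
    HasDerivAt (frameInvariant p Φ) (-(p z * (frame p Φ 2 z ⬝ᵥ frame p Φ 3 z)) / 8) z := by
  have h1 := ((h.hasDerivAt_frame_dot 2 2 hz).neg).div_const 16
  rw [dotProduct_comm (frame p Φ (2 + 1) z)] at h1
  refine h1.congr_deriv ?_
  simp only [Nat.reduceAdd]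
  ring

/-- If the invariant is real, then it is constant. -/
theorem frame_two_three (h : IsHopfRoot U Φ p) (hq : ∀ z ∈ U, (frameInvariant p Φ z).im = 0)
    {z : ℂ} (hz : z ∈ U) : frame p Φ 2 z ⬝ᵥ frame p Φ 3 z = 0 := by
  set d := -(p z * (frame p Φ 2 z ⬝ᵥ frame p Φ 3 z)) / 8 with hd
  have h1 := (Complex.imCLM.hasFDerivAt).comp z
    ((h.hasDerivAt_frameInvariant hz).hasFDerivAt.restrictScalars ℝ)
  have h2 : HasFDerivAt (Complex.imCLM ∘ frameInvariant p Φ) (0 : ℂ →L[ℝ] ℝ) z :=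
    (hasFDerivAt_const (0 : ℝ) z).congr_of_eventuallyEq (by
      filter_upwards [h.isOpen.mem_nhds hz] with w hw using hq w hw)
  have h3 : ∀ v : ℂ, (v * d).im = 0 := fun v => by
    simpa [hd] using congrArg (fun T => T v) (h1.unique h2)
  have h4 : d = 0 := by
    have a1 := h3 1
    have a2 := h3 Complex.I
    rw [one_mul] at a1
    rw [Complex.I_mul_im] at a2
    exact Complex.ext a2 a1
  rw [hd] at h4
  have h5 : p z * (frame p Φ 2 z ⬝ᵥ frame p Φ 3 z) = 0 := by linear_combination -8 * h4
  exact (mul_eq_zero.1 h5).resolve_left (h.root_ne_zero z hz)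

/-- Both sides have the same products with the basis `f₀, f₁, f₂`. -/
theorem frame_three (h : IsHopfRoot U Φ p) (hq : ∀ z ∈ U, (frameInvariant p Φ z).im = 0)
    {z : ℂ} (hz : z ∈ U) : frame p Φ 3 z = (4 * frameInvariant p Φ z) • frame p Φ 1 z := by
  rw [← sub_eq_zero]
  refine h.eq_zero_of_frame hz ?_ ?_ ?_
  · rw [dotProduct_sub, dotProduct_smul, h.frame_zero_one z hz, h.frame_zero_three z hz]
    simp
  · rw [dotProduct_sub, dotProduct_smul, h.frame_one_one z hz, h.frame_one_three hz,
      frame_two_two, smul_eq_mul]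
    ring
  · rw [dotProduct_sub, dotProduct_smul, h.frame_two_three hq hz,
      dotProduct_comm, h.frame_one_two z hz]
    simp

theorem exists_frameInvariant_eq (h : IsHopfRoot U Φ p) (hc : IsPreconnected U)
    (hq : ∀ z ∈ U, (frameInvariant p Φ z).im = 0) :
    ∃ q : ℝ, ∀ z ∈ U, frameInvariant p Φ z = q := by
  obtain ⟨a, ha⟩ := h.isOpen.exists_is_const_of_deriv_eq_zero hc
    (fun z hz => (h.hasDerivAt_frameInvariant hz).differentiableAt.differentiableWithinAt)
    (fun z hz => by rw [(h.hasDerivAt_frameInvariant hz).deriv, h.frame_two_three hq hz]; simp)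
  refine ⟨a.re, fun z hz => ?_⟩
  have h1 := hq z hz
  rw [ha z hz] at h1 ⊢
  apply Complex.ext <;> simp [h1]

end IsHopfRoot

/-! ### Logarithms and linear differential equations -/

/-- Simple connectedness gives a continuous logarithm. Near each point it differs by a constant from
the principal logarithm of `g w / g z`, hence it is holomorphic. -/
theorem exists_hasDerivAt_log {D : Set ℂ} (hD : IsOpen D) (hsc : IsSimplyConnected D) {g : ℂ → ℂ}
    (hg : DifferentiableOn ℂ g D) (hg0 : ∀ z ∈ D, g z ≠ 0) :
    ∃ ζ : ℂ → ℂ, ∀ z ∈ D, Complex.exp (ζ z) = g z ∧ HasDerivAt ζ (deriv g z / g z) z := by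
  obtain ⟨ζ, hζc, hζ⟩ := Complex.exists_continuousOn_eqOn_exp_comp hsc hD hg.continuousOn
    (by rintro ⟨z, hz, h0⟩; exact hg0 z hz h0)
  refine ⟨ζ, fun z hz => ⟨hζ hz, ?_⟩⟩
  have hgz : HasDerivAt g (deriv g z) z := (hg.differentiableAt (hD.mem_nhds hz)).hasDerivAt
  have h1 : HasDerivAt (fun w => ζ z + Complex.log (g w / g z)) (deriv g z / g z) z := by
    have h2 : g z / g z ∈ Complex.slitPlane := by
      rw [div_self (hg0 z hz)]
      exact Complex.one_mem_slitPlane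
    have h3 := ((hgz.div_const (g z)).clog h2).const_add (ζ z)
    rwa [div_self (hg0 z hz), div_one] at h3
  refine h1.congr_of_eventuallyEq ?_
  have hcont : ContinuousAt (fun w => (ζ w - ζ z).im) z :=
    Complex.continuous_im.continuousAt.comp
      ((hζc.continuousAt (hD.mem_nhds hz)).sub continuousAt_const)
  have h4 : ∀ᶠ w in 𝓝 z, (ζ w - ζ z).im ∈ Ioo (-Real.pi) Real.pi :=
    hcont.eventually_mem (isOpen_Ioo.mem_nhds (by simp [Real.pi_pos]))
  filter_upwards [h4, hD.mem_nhds hz] with w hw hwD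
  have e1 : Complex.exp (ζ w) = g w := hζ hwD
  have e2 : Complex.exp (ζ z) = g z := hζ hz
  rw [← e1, ← e2, ← Complex.exp_sub, Complex.log_exp hw.1 hw.2.le]
  ring

/-- A solution of a linear differential equation vanishes nowhere or everywhere. -/
theorem ne_zero_of_deriv_eq_mul {D : Set ℂ} (hD : IsOpen D) (hc : IsPreconnected D) {f a : ℂ → ℂ}
    (ha : DifferentiableOn ℂ a D) (hf : ∀ z ∈ D, HasDerivAt f (a z * f z) z) {z₁ : ℂ}
    (hz₁ : z₁ ∈ D) (h1 : f z₁ ≠ 0) : ∀ z ∈ D, f z ≠ 0 := by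
  intro z hz h0
  apply h1
  have hfa : AnalyticOnNhd ℂ f D :=
    DifferentiableOn.analyticOnNhd (fun z hz => (hf z hz).differentiableAt.differentiableWithinAt) hD
  refine hfa.eqOn_zero_of_preconnected_of_eventuallyEq_zero hc hz ?_ hz₁
  obtain ⟨δ, hδ, hball⟩ := Metric.isOpen_iff.1 hD z hz
  obtain ⟨W, hW⟩ := (ha.mono hball).isExactOn_ball
  have hd : ∀ w ∈ Metric.ball z δ, HasDerivAt (fun w => f w * Complex.exp (-W w)) 0 w := by
    intro w hw
    refine ((hf w (hball hw)).mul ((hW w hw).neg.cexp)).congr_deriv ?_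
    ring
  filter_upwards [Metric.ball_mem_nhds z hδ] with w hw
  have h2 := Metric.isOpen_ball.is_const_of_deriv_eq_zero (convex_ball z δ).isPreconnected
    (fun w hw => (hd w hw).differentiableAt.differentiableWithinAt)
    (fun w hw => (hd w hw).deriv) hw (Metric.mem_ball_self hδ)
  simpa [h0, Complex.exp_ne_zero] using h2

theorem exists_eq_const {D : Set ℂ} (hD : IsOpen D) (hc : IsPreconnected D) {f : ℂ → Fin 3 → ℂ}
    (hf : ∀ z ∈ D, HasDerivAt f 0 z) : ∃ C, ∀ z ∈ D, f z = C :=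
  hD.exists_is_const_of_deriv_eq_zero hc
    (fun z hz => (hf z hz).differentiableAt.differentiableWithinAt) fun z hz => (hf z hz).deriv

/-! ### Solving the frame equations -/

namespace IsHopfRoot

variable {D : Set ℂ} {Φ : ℂ → Fin 3 → ℂ} {p : ℂ → ℂ}

/-- Now `f₃ = 0`, so `f₀` is a quadratic polynomial in a primitive `w` of `p`. -/
theorem exists_isRep_enneper (h : IsHopfRoot D Φ p) (hc : IsPreconnected D) (hne : D.Nonempty)
    (hq : ∀ z ∈ D, frameInvariant p Φ z = 0) :
    ∃ r M φ φ', IsRep D Φ enneperData r M φ φ' := by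
  obtain ⟨z₀, hz₀⟩ := hne
  have h3 : ∀ z ∈ D, frame p Φ 3 z = 0 := fun z hz => by
    rw [h.frame_three (fun z hz => by simp [hq z hz]) hz, hq z hz]
    simp
  obtain ⟨C, hC⟩ := exists_eq_const (f := frame p Φ 2) h.isOpen hc fun z hz => by
    simpa [h3 z hz] using h.hasDerivAt_frame 2 hz
  have hC0 : C ≠ 0 := by
    rintro rfl
    have := h.frame_zero_two z₀ hz₀
    simp [hC z₀ hz₀] at this
  obtain ⟨i, hi⟩ := Function.ne_iff.1 hC0
  have hCi : C i ≠ 0 := hi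
  -- Since `f₁' = p C`, a nonzero coordinate of `C` supplies a global primitive of `p`.
  set w : ℂ → ℂ := fun z => frame p Φ 1 z i / C i with hw
  have hwd : ∀ z ∈ D, HasDerivAt w (p z) z := fun z hz => by
    have h1 := (hasDerivAt_pi.1 (h.hasDerivAt_frame 1 hz) i).div_const (C i)
    simpa [hC z hz, hCi] using h1
  have hCd : ∀ z, HasDerivAt (fun _ : ℂ => C) 0 z := fun z => hasDerivAt_const z C
  obtain ⟨C₁, hC₁⟩ := exists_eq_const (f := fun z => frame p Φ 1 z - w z • C) h.isOpen hc
    fun z hz => by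
      refine ((h.hasDerivAt_frame 1 hz).sub ((hwd z hz).smul (hCd z))).congr_deriv ?_
      simp [hC z hz]
  obtain ⟨C₀, hC₀⟩ := exists_eq_const
    (f := fun z => frame p Φ 0 z - w z • frame p Φ 1 z + (w z ^ 2 / 2) • C) h.isOpen hc
    fun z hz => by
      refine (((h.hasDerivAt_frame 0 hz).sub ((hwd z hz).smul (h.hasDerivAt_frame 1 hz))).add
        ((((hwd z hz).pow 2).div_const 2).smul (hCd z))).congr_deriv ?_
      ext j
      simp [hC z hz]
      ring
  have g00 := h.frame_zero_zero z₀ hz₀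
  have g01 := h.frame_zero_one z₀ hz₀
  have g02 := h.frame_zero_two z₀ hz₀
  have g11 := h.frame_one_one z₀ hz₀
  have g12 := h.frame_one_two z₀ hz₀
  have g22 := frame_two_two p Φ z₀
  rw [hC z₀ hz₀] at g02 g12 g22
  rw [hq z₀ hz₀, mul_zero] at g22
  have g10 := (dotProduct_comm _ _).trans g01
  have g20 := (dotProduct_comm _ _).trans g02
  have g21 := (dotProduct_comm _ _).trans g12
  obtain ⟨M, s, d, hM, hs, hform⟩ := exists_enneper_normal_form
    (C₀ := C₀) (C₁ := C₁) (C₂ := (1 / 2 : ℂ) • C)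
    (by rw [← hC₀ z₀ hz₀]
        simp only [add_dotProduct, dotProduct_add, sub_dotProduct, dotProduct_sub, smul_dotProduct,
          dotProduct_smul, smul_eq_mul, g00, g01, g02, g11, g12, g22, g10, g20, g21]
        ring)
    (by rw [← hC₀ z₀ hz₀, ← hC₁ z₀ hz₀]
        simp only [add_dotProduct, dotProduct_sub, sub_dotProduct, smul_dotProduct,
          dotProduct_smul, smul_eq_mul, g01, g02, g11, g12, g22, g21]
        ring)
    (by rw [← hC₀ z₀ hz₀]
        simp only [add_dotProduct, sub_dotProduct, smul_dotProduct,
          dotProduct_smul, smul_eq_mul, g02, g12, g22]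
        ring)
    (by rw [← hC₁ z₀ hz₀]
        simp only [sub_dotProduct, dotProduct_sub, smul_dotProduct,
          dotProduct_smul, smul_eq_mul, g11, g12, g22, g21]
        ring)
    (by rw [← hC₁ z₀ hz₀]
        simp only [sub_dotProduct, smul_dotProduct, dotProduct_smul, smul_eq_mul, g12, g22]
        ring)
    (by simp only [smul_dotProduct, dotProduct_smul, smul_eq_mul, g22]
        ring)
  have hs0 : (s : ℂ) ≠ 0 := by exact_mod_cast hs.ne'
  -- The factor `s⁻¹` of the normal form is split as `(s ^ 2)⁻¹ * s`, the second `s` belonging to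
  -- the derivative of the parameter.
  refine ⟨(s ^ 2)⁻¹, M, fun z => s * (w z + d), fun z => s * p z, by positivity, hM,
    fun z hz => ((hwd z hz).add_const d).const_mul (s : ℂ),
    fun z hz => mul_ne_zero hs0 (h.root_ne_zero z hz), fun z hz => ?_⟩
  have h5 : frame p Φ 0 z = C₀ + w z • C₁ + w z ^ 2 • (1 / 2 : ℂ) • C := by
    rw [← hC₀ z hz, ← hC₁ z hz]
    ext j
    simp
    ring
  rw [h.eq_smul_frame hz, h5, hform, smul_smul]
  congr 1
  push_cast
  field_simp

/-- With `m² = 4 q`, the equation `f₃ = m² f₁` splits: `f₂ ± m f₁` grow like `e ^ (± ζ)` with `ζ' =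
m p`, and `f₀ - m⁻² f₂` is constant. -/
theorem exists_isRep_bonnet (h : IsHopfRoot D Φ p) (hD : IsSimplyConnected D) {q : ℝ} (hq0 : q ≠ 0)
    (hq : ∀ z ∈ D, frameInvariant p Φ z = q) :
    ∃ t : ℝ, 0 ≤ t ∧ ∃ r M φ φ', IsRep D Φ (bonnetData t) r M φ φ' := by
  have hc : IsPreconnected D := hD.isPathConnected.isConnected.isPreconnected
  obtain ⟨z₀, hz₀⟩ := hD.nonempty
  obtain ⟨m, hm⟩ := IsAlgClosed.exists_pow_nat_eq (4 * (q : ℂ)) two_pos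
  have hm0 : m ≠ 0 := by
    rintro rfl
    simp [hq0] at hm
  have h3 : ∀ z ∈ D, frame p Φ 3 z = m ^ 2 • frame p Φ 1 z := fun z hz => by
    rw [h.frame_three (fun z hz => by simp [hq z hz]) hz, hq z hz, hm]
  set E : ℂ → Fin 3 → ℂ := fun z => frame p Φ 2 z + m • frame p Φ 1 z with hE
  set F : ℂ → Fin 3 → ℂ := fun z => frame p Φ 2 z - m • frame p Φ 1 z with hF
  have hEd : ∀ z ∈ D, HasDerivAt E ((m * p z) • E z) z := fun z hz => by
    refine ((h.hasDerivAt_frame 2 hz).add ((h.hasDerivAt_frame 1 hz).const_smul m)).congr_deriv ?_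
    ext j
    simp [hE, h3 z hz]
    ring
  have hFd : ∀ z ∈ D, HasDerivAt F (-(m * p z) • F z) z := fun z hz => by
    refine ((h.hasDerivAt_frame 2 hz).sub ((h.hasDerivAt_frame 1 hz).const_smul m)).congr_deriv ?_
    ext j
    simp [hF, h3 z hz]
    ring
  have hE0 : E z₀ ≠ 0 := by
    intro h0
    have h1 : frame p Φ 0 z₀ ⬝ᵥ E z₀ = -4 := by
      rw [hE, dotProduct_add, dotProduct_smul, h.frame_zero_two z₀ hz₀, h.frame_zero_one z₀ hz₀]
      simp
    simp [h0] at h1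
  obtain ⟨i, hi⟩ := Function.ne_iff.1 hE0
  have hEi : ∀ z ∈ D, HasDerivAt (fun z => E z i) (m * p z * E z i) z := fun z hz => by
    simpa using hasDerivAt_pi.1 (hEd z hz) i
  -- A coordinate of `E` that is nonzero at one point has no zeros, so its logarithm is a primitive
  -- of `m p` on all of `D`.
  have hEi0 : ∀ z ∈ D, E z i ≠ 0 :=
    ne_zero_of_deriv_eq_mul h.isOpen hc (h.root.const_mul m) hEi hz₀ hi
  obtain ⟨ζ, hζ⟩ := exists_hasDerivAt_log h.isOpen hD
    (fun z hz => (hEi z hz).differentiableAt.differentiableWithinAt) hEi0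
  have hζd : ∀ z ∈ D, HasDerivAt ζ (m * p z) z := fun z hz => by
    have h1 := (hζ z hz).2
    rwa [(hEi z hz).deriv, mul_div_cancel_right₀ _ (hEi0 z hz)] at h1
  obtain ⟨C₁, hC₁⟩ := exists_eq_const (f := fun z => Complex.exp (-ζ z) • E z) h.isOpen hc
    fun z hz => by
      refine (((hζd z hz).neg.cexp).smul (hEd z hz)).congr_deriv ?_
      ext j
      simp
      ring
  obtain ⟨C₂, hC₂⟩ := exists_eq_const (f := fun z => Complex.exp (ζ z) • F z) h.isOpen hc
    fun z hz => by
      refine (((hζd z hz).cexp).smul (hFd z hz)).congr_deriv ?_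
      ext j
      simp
      ring
  obtain ⟨C₀, hC₀⟩ := exists_eq_const
    (f := fun z => frame p Φ 0 z - (m ^ 2)⁻¹ • frame p Φ 2 z) h.isOpen hc
    fun z hz => by
      refine ((h.hasDerivAt_frame 0 hz).sub
        ((h.hasDerivAt_frame 2 hz).const_smul (m ^ 2)⁻¹)).congr_deriv ?_
      ext j
      simp [h3 z hz]
      field_simp
      ring
  have g00 := h.frame_zero_zero z₀ hz₀
  have g01 := h.frame_zero_one z₀ hz₀
  have g02 := h.frame_zero_two z₀ hz₀
  have g11 := h.frame_one_one z₀ hz₀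
  have g12 := h.frame_one_two z₀ hz₀
  have g22 : frame p Φ 2 z₀ ⬝ᵥ frame p Φ 2 z₀ = -4 * m ^ 2 := by
    rw [frame_two_two p Φ z₀, hq z₀ hz₀, hm]
    ring
  have g10 := (dotProduct_comm _ _).trans g01
  have g20 := (dotProduct_comm _ _).trans g02
  have g21 := (dotProduct_comm _ _).trans g12
  -- The normal form requires `C₀ ⬝ C₀ = 4 m⁻⁴` to be `4 ρ²` with `ρ > 0`. This is where the reality
  -- of `q` is needed: `m⁴ = 16 q²`.
  have hρ : 0 < (4 * |q|)⁻¹ := by positivity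
  have hρ2 : (((4 * |q|)⁻¹ : ℝ) : ℂ) ^ 2 = (m ^ 4)⁻¹ := by
    have : m ^ 4 = (((4 * |q|) ^ 2 : ℝ) : ℂ) := by
      rw [mul_pow, sq_abs]
      push_cast
      rw [← mul_pow, ← hm]
      ring
    rw [this]
    push_cast
    rw [inv_pow]
  have hexp : Complex.exp (-ζ z₀) * Complex.exp (ζ z₀) = 1 := by
    rw [← Complex.exp_add]
    simp
  -- The new parameter has derivative `m p`, so the curve to be normalized is `m⁻¹ f₀`.
  obtain ⟨M, t, c, hM, ht, -, hform⟩ := exists_bonnet_normal_form hρ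
    (C₀ := m⁻¹ • C₀) (C₁ := (2 * m ^ 3)⁻¹ • C₁) (C₂ := (2 * m ^ 3)⁻¹ • C₂)
    (by rw [← hC₀ z₀ hz₀, hρ2]
        simp only [sub_dotProduct, dotProduct_sub, smul_dotProduct,
          dotProduct_smul, smul_eq_mul, g00, g02, g22, g20]
        field_simp
        ring)
    (by rw [← hC₀ z₀ hz₀, ← hC₁ z₀ hz₀, hE]
        simp only [dotProduct_add, sub_dotProduct, smul_dotProduct,
          dotProduct_smul, smul_eq_mul, g01, g02, g22, g21]
        field_simp
        ring)
    (by rw [← hC₀ z₀ hz₀, ← hC₂ z₀ hz₀, hF]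
        simp only [dotProduct_sub, sub_dotProduct, smul_dotProduct,
          dotProduct_smul, smul_eq_mul, g01, g02, g22, g21]
        field_simp
        ring)
    (by rw [← hC₁ z₀ hz₀, hE]
        simp only [add_dotProduct, dotProduct_add, smul_dotProduct,
          dotProduct_smul, smul_eq_mul, g11, g12, g22, g21]
        ring)
    (by rw [← hC₁ z₀ hz₀, ← hC₂ z₀ hz₀, hE, hF, hρ2]
        simp only [add_dotProduct, dotProduct_sub, smul_dotProduct,
          dotProduct_smul, smul_eq_mul, g11, g12, g22, g21]
        field_simp
        linear_combination (-8 * m) * hexp)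
    (by rw [← hC₂ z₀ hz₀, hF]
        simp only [sub_dotProduct, dotProduct_sub, smul_dotProduct,
          dotProduct_smul, smul_eq_mul, g11, g12, g22, g21]
        ring)
  refine ⟨t, ht, (4 * |q|)⁻¹, M, fun z => ζ z + c, fun z => m * p z, hρ, hM,
    fun z hz => (hζd z hz).add_const c,
    fun z hz => mul_ne_zero hm0 (h.root_ne_zero z hz), fun z hz => ?_⟩
  have hexp' : Complex.exp (-ζ z) * Complex.exp (ζ z) = 1 := by
    rw [← Complex.exp_add]
    simp
  have h5 : frame p Φ 0 z = m • (m⁻¹ • C₀ + Complex.exp (ζ z) • (2 * m ^ 3)⁻¹ • C₁ +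
      Complex.exp (-ζ z) • (2 * m ^ 3)⁻¹ • C₂) := by
    rw [← hC₀ z hz, ← hC₁ z hz, ← hC₂ z hz]
    ext j
    simp only [hE, hF, Pi.add_apply, Pi.sub_apply, Pi.smul_apply, smul_eq_mul]
    field_simp
    linear_combination (-2 * frame p Φ 2 z j) * hexp'
  rw [h.eq_smul_frame hz, h5, hform, smul_smul, smul_smul]
  congr 1
  ring

end IsHopfRoot

/-- The shapes of the complex derivative of a surface with planar curvature lines. -/
theorem IsNullData.exists_isRep {D : Set ℂ} {X : ℂ → E3} {Φ : ℂ → Fin 3 → ℂ}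
    (h : IsNullData D X Φ) (hpl : HasPlanarCurvatureLines D X) {U : Set ℂ} (hU : IsOpen U)
    (hUD : U ⊆ D) (hsc : IsSimplyConnected U) (hQ : ∀ z ∈ U, deriv Φ z ⬝ᵥ deriv Φ z ≠ 0) :
    (∃ t : ℝ, 0 ≤ t ∧ ∃ r M φ φ', IsRep U Φ (bonnetData t) r M φ φ') ∨
      ∃ r M φ φ', IsRep U Φ enneperData r M φ φ' := by
  have hΦ : DifferentiableOn ℂ Φ U := fun z hz =>
    (h.hasDerivAt z (hUD hz)).differentiableAt.differentiableWithinAt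
  have hQd : DifferentiableOn ℂ (fun z => (deriv Φ z ⬝ᵥ deriv Φ z) / 4) U := fun z hz => by
    have h1 := ((hΦ.deriv hU).differentiableAt (hU.mem_nhds hz)).hasDerivAt
    exact ((HasDerivAt.dot h1 h1).div_const 4).differentiableAt.differentiableWithinAt
  obtain ⟨ζ, hζ⟩ := exists_hasDerivAt_log hU hsc hQd
    fun z hz => div_ne_zero (hQ z hz) (by norm_num)
  -- A logarithm of `(Φ' ⬝ Φ') / 4` provides its fourth root.
  have hp : IsHopfRoot U Φ (fun z => Complex.exp (ζ z / 4)) :=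
    ⟨hU, hΦ, fun z hz => h.null z (hUD hz),
      fun z hz => ((hζ z hz).2.div_const 4).cexp.differentiableAt.differentiableWithinAt,
      fun z _ => Complex.exp_ne_zero _, fun z hz => by
        have h4 : (4 : ℂ) ≠ 0 := by norm_num
        rw [← Complex.exp_nat_mul, Nat.cast_ofNat, mul_div_cancel₀ _ h4, (hζ z hz).1,
          mul_div_cancel₀ _ h4]⟩
  obtain ⟨q, hq⟩ := hp.exists_frameInvariant_eq hsc.isPathConnected.isConnected.isPreconnected
    fun z hz => hp.im_frameInvariant h hUD hpl hz
  rcases eq_or_ne q 0 with rfl | hq0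
  · exact Or.inr (hp.exists_isRep_enneper hsc.isPathConnected.isConnected.isPreconnected
      hsc.nonempty (by simpa using hq))
  · exact Or.inl (hp.exists_isRep_bonnet hsc hq0 hq)

/-! ### Umbilics -/

/-- A bound for the derivative of a reparametrized surface through its Hopf differential. -/
theorem IsRep.exists_norm_pow_le {c : ℂ} {δ : ℝ} {Φ Ψ Ψ' : ℂ → Fin 3 → ℂ} {r : ℝ}
    {M : Matrix (Fin 3) (Fin 3) ℝ} {φ φ' : ℂ → ℂ} (h : IsRep (Metric.ball c δ) Φ Ψ r M φ φ')
    (hδ : 0 < δ) (hΨ : ∀ z, HasDerivAt Ψ (Ψ' z) z) (h0 : ∀ z, Ψ z ⬝ᵥ Ψ z = 0)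
    (h4 : ∀ z, Ψ' z ⬝ᵥ Ψ' z = 4) {B : ℝ}
    (hB : ∀ z ∈ Metric.ball c δ, ‖deriv Φ z ⬝ᵥ deriv Φ z‖ ≤ B) :
    ∃ K : ℝ, ∀ z ∈ Metric.ball c δ, ‖Φ z‖ ^ 4 ≤ K * ‖deriv Φ z ⬝ᵥ deriv Φ z‖ := by
  have hr := h.pos
  have hφ' : ∀ z ∈ Metric.ball c δ, ‖deriv Φ z ⬝ᵥ deriv Φ z‖ = 4 * r ^ 2 * ‖φ' z‖ ^ 4 := by
    intro z hz
    rw [h.deriv_dot_deriv Metric.isOpen_ball hΨ h0 z hz, h4]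
    simp [abs_of_pos hr]
    ring
  -- `x⁴ ≤ y` implies `x ≤ 1 + y`. With `φ'` bounded, the image of `φ` stays in a compact disc, on
  -- which `Ψ` is bounded.
  set L : ℝ := 1 + B / (4 * r ^ 2) with hL
  have hbound : ∀ z ∈ Metric.ball c δ, ‖φ' z‖ ≤ L := by
    intro z hz
    have h1 : ‖φ' z‖ ^ 4 ≤ B / (4 * r ^ 2) := by
      rw [le_div_iff₀ (by positivity)]
      linarith [hB z hz, hφ' z hz]
    nlinarith [sq_nonneg (‖φ' z‖ ^ 2 - 1), sq_nonneg (‖φ' z‖ - 1), norm_nonneg (φ' z)]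
  have hc : c ∈ Metric.ball c δ := Metric.mem_ball_self hδ
  have hL0 : 0 ≤ L := (norm_nonneg _).trans (hbound c hc)
  have himg : ∀ z ∈ Metric.ball c δ, φ z ∈ Metric.closedBall (φ c) (L * δ) := by
    intro z hz
    have h1 := Convex.norm_image_sub_le_of_norm_hasDerivWithin_le
      (fun z hz => (h.hasDerivAt z hz).hasDerivWithinAt) hbound (convex_ball c δ) hc hz
    rw [mem_closedBall_iff_norm]
    refine h1.trans (mul_le_mul_of_nonneg_left ?_ hL0)
    exact (mem_ball_iff_norm.1 hz).le
  obtain ⟨B', hB'⟩ := (isCompact_closedBall (φ c) (L * δ)).exists_bound_of_continuousOn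
    (f := fun w => cm M *ᵥ Ψ w)
    (fun w _ => (HasDerivAt.cm_mulVec M (hΨ w)).continuousAt.continuousWithinAt)
  refine ⟨r ^ 2 * B' ^ 4 / 4, fun z hz => ?_⟩
  rw [h.eq z hz, hφ' z hz, norm_smul, norm_mul, Complex.norm_real, Real.norm_of_nonneg hr.le,
    mul_pow, mul_pow]
  calc r ^ 4 * ‖φ' z‖ ^ 4 * ‖cm M *ᵥ Ψ (φ z)‖ ^ 4 ≤ r ^ 4 * ‖φ' z‖ ^ 4 * B' ^ 4 := by
        gcongr
        exact hB' _ (himg z hz)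
    _ = r ^ 2 * B' ^ 4 / 4 * (4 * r ^ 2 * ‖φ' z‖ ^ 4) := by ring

theorem isSimplyConnected_ball (c : ℂ) {δ : ℝ} (hδ : 0 < δ) :
    IsSimplyConnected (Metric.ball c δ) := by
  have := (convex_ball c δ).contractibleSpace ⟨c, Metric.mem_ball_self hδ⟩
  exact (inferInstance : SimplyConnectedSpace (Metric.ball c δ))

/-- A surface with planar curvature lines is free of umbilics or totally umbilic. -/
theorem IsNullData.hopf_eq_zero_or_ne_zero {D : Set ℂ} {X : ℂ → E3} {Φ : ℂ → Fin 3 → ℂ}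
    (h : IsNullData D X Φ) (hpl : HasPlanarCurvatureLines D X) (hc : IsPreconnected D) :
    (∀ z ∈ D, deriv Φ z ⬝ᵥ deriv Φ z = 0) ∨ ∀ z ∈ D, deriv Φ z ⬝ᵥ deriv Φ z ≠ 0 := by
  rw [or_iff_not_imp_right]
  intro hz
  push Not at hz
  obtain ⟨z₀, hz₀, hQ₀⟩ := hz
  have hΦ : DifferentiableOn ℂ Φ D := fun z hz =>
    (h.hasDerivAt z hz).differentiableAt.differentiableWithinAt
  have hQd : DifferentiableOn ℂ (fun z => deriv Φ z ⬝ᵥ deriv Φ z) D := fun z hz => by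
    have h1 := ((hΦ.deriv h.isOpen).differentiableAt (h.isOpen.mem_nhds hz)).hasDerivAt
    exact (HasDerivAt.dot h1 h1).differentiableAt.differentiableWithinAt
  have hQa := hQd.analyticOnNhd h.isOpen
  rcases (hQa z₀ hz₀).eventually_eq_zero_or_eventually_ne_zero with h1 | h1
  · exact fun z hz => hQa.eqOn_zero_of_preconnected_of_eventuallyEq_zero hc hz₀ h1 hz
  exfalso
  rw [eventually_nhdsWithin_iff] at h1
  obtain ⟨ε, hε, hball⟩ := Metric.eventually_nhds_iff_ball.1 (h1.and (h.isOpen.mem_nhds hz₀))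
  -- The zero `z₀` is isolated. The disc of radius `δ` about `z₀ + δ` has `z₀` on its boundary,
  -- contains no umbilic, and its closure lies within `2 δ < ε` of `z₀`.
  set δ := ε / 3 with hδ
  have hδ0 : 0 < δ := by positivity
  set c : ℂ := z₀ + δ with hcdef
  have hcz : dist c z₀ = δ := by simp [hcdef, abs_of_pos hδ0]
  have hcl : Metric.closedBall c δ ⊆ Metric.ball z₀ ε := by
    refine Metric.closedBall_subset_ball' ?_
    rw [hcz]
    linarith
  have hsub : Metric.closedBall c δ ⊆ D := fun z hz => (hball z (hcl hz)).2
  have hsub' : Metric.ball c δ ⊆ D := Metric.ball_subset_closedBall.trans hsub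
  have hne : ∀ z ∈ Metric.ball c δ, deriv Φ z ⬝ᵥ deriv Φ z ≠ 0 := by
    intro z hz
    refine (hball z (hcl (Metric.ball_subset_closedBall hz))).1 ?_
    rintro rfl
    rw [Metric.mem_ball, dist_comm, hcz] at hz
    exact lt_irrefl _ hz
  obtain ⟨B, hB⟩ := (isCompact_closedBall c δ).exists_bound_of_continuousOn
    (hQd.continuousOn.mono hsub)
  have hB' : ∀ z ∈ Metric.ball c δ, ‖deriv Φ z ⬝ᵥ deriv Φ z‖ ≤ B :=
    fun z hz => hB z (Metric.ball_subset_closedBall hz)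
  have hK : ∃ K : ℝ, ∀ z ∈ Metric.ball c δ, ‖Φ z‖ ^ 4 ≤ K * ‖deriv Φ z ⬝ᵥ deriv Φ z‖ := by
    rcases h.exists_isRep hpl Metric.isOpen_ball hsub' (isSimplyConnected_ball c hδ0) hne with
      ⟨t, -, r, M, φ, φ', hrep⟩ | ⟨r, M, φ, φ', hrep⟩
    · exact hrep.exists_norm_pow_le hδ0 (hasDerivAt_bonnetData t) (bonnetData_dot_self t)
        (bonnetData'_dot_self t) hB'
    · exact hrep.exists_norm_pow_le hδ0 hasDerivAt_enneperData enneperData_dot_self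
        enneperData'_dot_self hB'
  obtain ⟨K, hK⟩ := hK
  have hclosure : closure (Metric.ball c δ) = Metric.closedBall c δ := closure_ball c hδ0.ne'
  have hz₀cl : z₀ ∈ closure (Metric.ball c δ) := by
    rw [hclosure, Metric.mem_closedBall, dist_comm, hcz]
  -- The estimate extends by continuity to the boundary point `z₀`, where its right side is zero
  -- although `Φ z₀ ≠ 0`.
  have h2 := le_on_closure hK
    (by rw [hclosure]; exact ((hΦ.continuousOn.mono hsub).norm.pow 4))
    (by rw [hclosure]; exact (continuousOn_const.mul (hQd.continuousOn.mono hsub).norm)) hz₀cl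
  rw [hQ₀, norm_zero, mul_zero] at h2
  have h3 : 0 < ‖Φ z₀‖ ^ 4 := pow_pos (norm_pos_iff.2 (h.ne_zero z₀ hz₀)) 4
  linarith

/-! ### Planes -/

theorem plane_apply (z : ℂ) : plane z = !₂[z.re, -z.im, 0] := by
  simp [plane, weierstrass]

/-- A totally umbilic minimal surface has a constant normal vector. -/
theorem IsNullData.exists_normal {D : Set ℂ} {X : ℂ → E3} {Φ : ℂ → Fin 3 → ℂ}
    (h : IsNullData D X Φ) (hc : IsPreconnected D) (hne : D.Nonempty)
    (hQ : ∀ z ∈ D, deriv Φ z ⬝ᵥ deriv Φ z = 0) :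
    ∃ n : E3, inner ℝ n n = (1 : ℝ) ∧ ∀ z ∈ D, ofReal n ⬝ᵥ Φ z = 0 := by
  obtain ⟨z₀, hz₀⟩ := hne
  have hν : ∀ z ∈ D, normalDeriv X Φ z = 0 := fun z hz => by
    have h1 := h.normalDeriv_sq hz
    rw [hQ z hz] at h1
    exact pow_eq_zero_iff two_ne_zero |>.1 h1
  have hdN : ∀ z ∈ D, fderiv ℝ (unitNormal X) z = 0 := fun z hz => by
    ext1 v
    refine h.eq_zero_of_inner hz (h.inner_fderiv_unitNormal_self hz v) fun w => ?_
    rw [h.inner_fderiv_unitNormal hz, hν z hz]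
    simp
  obtain ⟨n, hn⟩ := h.isOpen.exists_is_const_of_fderiv_eq_zero hc
    (fun z hz => (h.differentiableAt_unitNormal hz).differentiableWithinAt)
    (fun z hz => hdN z hz)
  refine ⟨n, ?_, fun z hz => ?_⟩
  · rw [← hn z₀ hz₀, real_inner_self_eq_norm_sq, h.norm_unitNormal hz₀, one_pow]
  · have h1 := fun w => h.inner_unitNormal hz w
    simp only [hn z hz, inner_reMul] at h1
    have e1 := h1 1
    have e2 := h1 Complex.I
    rw [mul_one] at e1
    rw [Complex.mul_I_re, neg_eq_zero] at e2
    exact Complex.ext e1 e2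

theorem IsNullData.isPieceOf_plane {D : Set ℂ} {X : ℂ → E3} {Φ : ℂ → Fin 3 → ℂ}
    (h : IsNullData D X Φ) (hsm : ContDiffOn ℝ ∞ X D) (hc : IsPreconnected D) (hne : D.Nonempty)
    (hQ : ∀ z ∈ D, deriv Φ z ⬝ᵥ deriv Φ z = 0) : IsPieceOf D X plane := by
  obtain ⟨n, hn, hnΦ⟩ := h.exists_normal hc hne hQ
  obtain ⟨z₀, hz₀⟩ := hne
  obtain ⟨M, s, hM, hs, hΦ₀⟩ := exists_rotation_of_null (h.ne_zero z₀ hz₀) (h.null z₀ hz₀)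
  have hs0 : (s : ℂ) ≠ 0 := by exact_mod_cast hs.ne'
  have hM' : Mᵀᵀ * Mᵀ = 1 := by rw [transpose_transpose]; exact mul_eq_one_comm.1 hM
  set b : ℂ → Fin 3 → ℂ := fun z => cm Mᵀ *ᵥ Φ z with hb
  set u : E3 := act Mᵀ n with hu
  have hub : ∀ z ∈ D, ofReal u ⬝ᵥ b z = 0 := fun z hz => by
    have h1 : ofReal u = cm Mᵀ *ᵥ ofReal n := by
      ext i
      simp [ofReal, hu, act_apply, cm, mulVec, dotProduct]
    rw [h1, dot_cm hM', hnΦ z hz]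
  have hb₀ : b z₀ = (s : ℂ) • bonnetExp := by
    rw [hb]
    simp only
    rw [hΦ₀, mulVec_smul, mulVec_mulVec, ← cm_mul, hM, cm_one, one_mulVec]
  -- The rotation puts the tangent plane at `z₀` in horizontal position, so the constant normal
  -- becomes vertical.
  have hu01 : u 0 = 0 ∧ u 1 = 0 := by
    have h1 := hub z₀ hz₀
    rw [hb₀, dotProduct_smul, smul_eq_mul] at h1
    have h2 := (mul_eq_zero.1 h1).resolve_left hs0
    simp only [dotProduct, Fin.sum_univ_three, ofReal, bonnetExp, cons_val_zero, cons_val_one,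
      cons_val] at h2
    have hre := congrArg Complex.re h2
    have him := congrArg Complex.im h2
    simp at hre him
    exact ⟨hre, him⟩
  have hu2 : u 2 ≠ 0 := by
    intro h0
    have h1 := inner_act hM' n n
    rw [hn, ← hu, inner_eq_sum, hu01.1, hu01.2, h0] at h1
    norm_num at h1
  have hb2 : ∀ z ∈ D, b z 2 = 0 := fun z hz => by
    have h1 := hub z hz
    simp only [dotProduct, Fin.sum_univ_three, ofReal, hu01.1, hu01.2] at h1
    simpa [hu2] using h1
  have hbb : ∀ z ∈ D, b z 0 ^ 2 + b z 1 ^ 2 = 0 := fun z hz => by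
    have h1 : b z ⬝ᵥ b z = 0 := by rw [hb, dot_cm hM', h.null z hz]
    simp only [dotProduct, Fin.sum_univ_three, hb2 z hz] at h1
    linear_combination h1
  have hb0 : ∀ z ∈ D, b z 0 ≠ 0 := fun z hz h0 => by
    have h1 := hbb z hz
    rw [h0] at h1
    have h2 : b z 1 = 0 := by simpa using h1
    apply h.ne_zero z hz
    refine cm_mulVec_injective hM' ?_
    rw [mulVec_zero]
    ext i
    fin_cases i
    · exact h0
    · exact h2
    · exact hb2 z hz
  set Z : ℂ → E3 := fun z => act Mᵀ (X z) with hZ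
  have hZd : HasData D Z b := fun z hz => by
    have h1 := (act Mᵀ).hasFDerivAt.comp z (h.hasData z hz)
    have h2 : (act Mᵀ).comp (reMul (Φ z)) = reMul (b z) := by
      ext1 w
      exact (reMul_cm Mᵀ (Φ z) w).symm
    rwa [h2] at h1
  have hZi : ∀ z ∈ D, ∀ i, HasFDerivAt (fun w => Z w i)
      ((EuclideanSpace.proj i : E3 →L[ℝ] ℝ).comp (reMul (b z))) z := fun z hz i =>
    (EuclideanSpace.proj i : E3 →L[ℝ] ℝ).hasFDerivAt.comp z (hZd z hz)
  obtain ⟨k, hk⟩ := h.isOpen.exists_is_const_of_fderiv_eq_zero hc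
    (fun z hz => (hZi z hz 2).differentiableAt.differentiableWithinAt)
    (fun z hz => by
      rw [(hZi z hz 2).fderiv]
      ext1 w
      simp [hb2 z hz])
  have hZsm : ContDiffOn ℝ ∞ Z D := (act Mᵀ).contDiff.comp_contDiffOn hsm
  have hZism : ∀ i, ContDiffOn ℝ ∞ (fun z => Z z i) D := fun i =>
    (EuclideanSpace.proj i : E3 →L[ℝ] ℝ).contDiff.comp_contDiffOn hZsm
  -- The horizontal coordinates of the rotated surface serve as parameters. The minus sign matches
  -- `plane`, which sends `u + i v` to `(u, -v, 0)`.
  refine ⟨1, affineIso M hM (act M !₂[0, 0, k]),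
    fun z => (Z z 0 : ℂ) - Complex.I * (Z z 1 : ℂ), one_pos, ?_, fun z hz => ?_, fun z hz => ?_⟩
  · exact (Complex.ofRealCLM.contDiff.comp_contDiffOn (hZism 0)).sub
      (contDiffOn_const.mul (Complex.ofRealCLM.contDiff.comp_contDiffOn (hZism 1)))
  · have h1 := (Complex.ofRealCLM.hasFDerivAt.comp z (hZi z hz 0)).sub
      ((Complex.ofRealCLM.hasFDerivAt.comp z (hZi z hz 1)).const_mul Complex.I)
    have h2 : fderiv ℝ (fun z => (Z z 0 : ℂ) - Complex.I * (Z z 1 : ℂ)) z = _ := h1.fderiv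
    rw [h2]
    refine (fun hi => ⟨hi, LinearMap.injective_iff_surjective.1 hi⟩)
      ((injective_iff_map_eq_zero _).2 fun w hw => ?_)
    have hre := congrArg Complex.re hw
    have him := congrArg Complex.im hw
    simp at hre him
    -- Nullity gives `b₁ = ± i b₀`, so the vanishing of both `Re (b₀ w)` and `Re (b₁ w)` means `b₀ w
    -- = 0`.
    have h3 : (b z 1 - Complex.I * b z 0) * (b z 1 + Complex.I * b z 0) = 0 := by
      linear_combination hbb z hz - b z 0 ^ 2 * Complex.I_sq
    have h4 : b z 0 * w = 0 := by
      rcases mul_eq_zero.1 h3 with h5 | h5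
      · rw [sub_eq_zero.1 h5] at him
        apply Complex.ext <;> simp at him ⊢ <;> linarith
      · rw [eq_neg_of_add_eq_zero_left h5] at him
        apply Complex.ext <;> simp at him ⊢ <;> linarith
    exact (mul_eq_zero.1 h4).resolve_left (hb0 z hz)
  · have h1 : plane ((Z z 0 : ℂ) - Complex.I * (Z z 1 : ℂ)) + !₂[0, 0, k] = Z z := by
      rw [plane_apply, ← hk z hz]
      ext i
      fin_cases i <;> simp
    rw [one_smul, affineIso_apply, ← map_add, h1, hZ]
    ext i
    have h2 : M *ᵥ (Mᵀ *ᵥ (X z).ofLp) = (X z).ofLp := by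
      rw [mulVec_mulVec, mul_eq_one_comm.1 hM, one_mulVec]
    exact (congrFun h2 i).symm

/-! ### The classification -/

theorem hasData_enneper : HasData univ enneper enneperData := by
  rw [← weierstrassData_id]
  exact hasData_weierstrass (by fun_prop) (by fun_prop)

theorem hasData_bonnet (t : ℝ) : HasData univ (bonnet t) (bonnetData t) := by
  rw [← weierstrassData_exp]
  exact hasData_weierstrass (by fun_prop) (by fun_prop)

theorem bonnet_zero : bonnet 0 = catenoid := by
  simp [bonnet, catenoid]

theorem exists_isPieceOfType {D : Set ℂ} {X : ℂ → E3} (h : IsMinimalSurface D X)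
    (hpl : HasPlanarCurvatureLines D X) : ∃ τ, IsPieceOfType D X τ := by
  have hc : IsPreconnected D := h.simplyConnected.isPathConnected.isConnected.isPreconnected
  have hN := h.isNullData
  rcases hN.hopf_eq_zero_or_ne_zero hpl hc with hQ | hQ
  · exact ⟨.plane, plane, rfl,
      hN.isPieceOf_plane h.conformal.smooth hc h.simplyConnected.nonempty hQ⟩
  rcases hN.exists_isRep hpl h.isOpen subset_rfl h.simplyConnected hQ with
    ⟨t, ht, r, M, φ, φ', hrep⟩ | ⟨r, M, φ, φ', hrep⟩
  · have hp : IsPieceOf D X (bonnet t) := isPieceOf_of_data h.isOpen hc hN.hasData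
      (hasData_bonnet t) hrep.hasDerivAt hrep.ne_zero hrep.pos hrep.orthogonal hrep.eq
    rcases ht.eq_or_lt with rfl | ht
    · rw [bonnet_zero] at hp
      exact ⟨.catenoid, _, rfl, hp⟩
    · exact ⟨.bonnet, _, ⟨t, ht, rfl⟩, hp⟩
  · exact ⟨.enneper, enneper, rfl, isPieceOf_of_data h.isOpen hc hN.hasData hasData_enneper
      hrep.hasDerivAt hrep.ne_zero hrep.pos hrep.orthogonal hrep.eq⟩

/-! ### The explicit family in complex form -/

theorem rootCos_sq (θ : ℝ) : rootCos θ ^ 2 = (Real.cos (2 * θ) : ℂ) := by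
  unfold rootCos
  rw [one_div]
  exact_mod_cast Complex.cpow_nat_inv_pow (Real.cos (2 * θ) : ℂ) (n := 2) (by norm_num)

theorem conj_rootCos (θ : ℝ) : (starRingEnd ℂ) (rootCos θ) = rootCos θ ∨
    (starRingEnd ℂ) (rootCos θ) = -rootCos θ := by
  rcases rootCos_cases θ with ⟨k, h⟩ | ⟨k, h⟩ <;> rw [h] <;> simp

/-- Real square roots of negative numbers are `0`, so at most one term is nonzero. Written in this
way, the root is visibly continuous where `cos 2θ` changes sign. -/
theorem rootCos_eq (θ : ℝ) :
    rootCos θ = √(Real.cos (2 * θ)) + √(-Real.cos (2 * θ)) * Complex.I := by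
  unfold rootCos
  generalize Real.cos (2 * θ) = κ
  rcases le_total 0 κ with h | h
  · rw [Real.sqrt_eq_zero_of_nonpos (neg_nonpos.2 h), Real.sqrt_eq_rpow, Complex.ofReal_cpow h]
    simp
  · have h1 : 0 ≤ -κ := neg_nonneg.2 h
    rw [Real.sqrt_eq_zero_of_nonpos h, Real.sqrt_eq_rpow, Complex.ofReal_cpow h1,
      Complex.ofReal_cpow_of_nonpos h]
    have h2 : (Real.pi * Complex.I * (1 / 2) : ℂ) = Real.pi / 2 * Complex.I := by ring
    rw [h2, Complex.exp_pi_div_two_mul_I]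
    simp

theorem continuous_rootCos : Continuous rootCos := by
  have : rootCos = fun θ : ℝ =>
      (√(Real.cos (2 * θ)) + √(-Real.cos (2 * θ)) * Complex.I : ℂ) := funext rootCos_eq
  rw [this]
  fun_prop

section Generic

variable {θ : ℝ}

theorem sinh_mul_add (k : ℂ) (z : ℂ) : Complex.sinh (k * z) =
    Complex.sinh (z.re * k) * Complex.cos (z.im * k) +
      Complex.cosh (z.re * k) * Complex.sin (z.im * k) * Complex.I := by
  conv_lhs => rw [← Complex.re_add_im z, show k * (z.re + z.im * Complex.I) =
    z.re * k + (z.im * k) * Complex.I by ring, Complex.sinh_add, Complex.sinh_mul_I,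
    Complex.cosh_mul_I]
  ring

theorem cosh_mul_add (k : ℂ) (z : ℂ) : Complex.cosh (k * z) =
    Complex.cosh (z.re * k) * Complex.cos (z.im * k) +
      Complex.sinh (z.re * k) * Complex.sin (z.im * k) * Complex.I := by
  conv_lhs => rw [← Complex.re_add_im z, show k * (z.re + z.im * Complex.I) =
    z.re * k + (z.im * k) * Complex.I by ring, Complex.cosh_add, Complex.sinh_mul_I,
    Complex.cosh_mul_I]
  ring

theorem re_im_of_add_mul_I {w a b : ℂ} (h : w = a + b * Complex.I) (ha : a.im = 0)
    (hb : b.im = 0) : (w.re : ℂ) = a ∧ (w.im : ℂ) = b := by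
  rw [h]
  constructor <;> apply Complex.ext <;> simp [ha, hb]

/-- The two expressions are even in the root, and conjugation sends the root to itself or to its
negative. Hence they are real. -/
theorem sinh_div_rootCos (θ : ℝ) (z : ℂ) :
    ((Complex.sinh (rootCos θ * z) / rootCos θ).re : ℂ) =
      Complex.sinh (z.re * rootCos θ) * Complex.cos (z.im * rootCos θ) / rootCos θ ∧
    ((Complex.sinh (rootCos θ * z) / rootCos θ).im : ℂ) =
      Complex.cosh (z.re * rootCos θ) * Complex.sin (z.im * rootCos θ) / rootCos θ := by
  refine re_im_of_add_mul_I ?_ ?_ ?_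
  · rw [sinh_mul_add]
    ring
  all_goals
    rw [← Complex.conj_eq_iff_im]
    simp only [map_div₀, map_mul, Complex.conj_ofReal, ← Complex.sinh_conj, ← Complex.cosh_conj,
      ← Complex.cos_conj, ← Complex.sin_conj]
    rcases conj_rootCos θ with h | h
    · rw [h]
    · rw [h]
      simp only [mul_neg, Complex.sinh_neg, Complex.cosh_neg, Complex.sin_neg, Complex.cos_neg,
        neg_mul, neg_div_neg_eq]

theorem cosh_rootCos_re (θ : ℝ) (z : ℂ) : ((Complex.cosh (rootCos θ * z)).re : ℂ) =
      Complex.cosh (z.re * rootCos θ) * Complex.cos (z.im * rootCos θ) := by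
  refine (re_im_of_add_mul_I (cosh_mul_add _ z) ?_ ?_).1
  all_goals
    rw [← Complex.conj_eq_iff_im]
    simp only [map_mul, Complex.conj_ofReal, ← Complex.sinh_conj, ← Complex.cosh_conj,
      ← Complex.cos_conj, ← Complex.sin_conj]
    rcases conj_rootCos θ with h | h
    · rw [h]
    · rw [h]
      simp only [mul_neg, Complex.sinh_neg, Complex.cosh_neg, Complex.sin_neg, Complex.cos_neg,
        neg_mul, neg_neg]

/-- The holomorphic curve `S(z) = sinh(kz)/k` with `k² = cos 2θ`. -/
def sinhRoot (θ : ℝ) (z : ℂ) : ℂ := Complex.sinh (rootCos θ * z) / rootCos θ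

theorem generic_re (hκ : Real.cos (2 * θ) ≠ 0) (z : ℂ) :
    (WithLp.toLp 2 fun i => (generic θ z.re z.im i).re : E3) =
      !₂[(z.re * Real.cos θ - Real.sin θ * (sinhRoot θ z).re) / Real.cos (2 * θ),
        (z.im * Real.sin θ - Real.cos θ * (sinhRoot θ z).im) / Real.cos (2 * θ),
        ((Complex.cosh (rootCos θ * z)).re - 1) / Real.cos (2 * θ)] := by
  have hκ' : (Real.cos (2 * θ) : ℂ) ≠ 0 := by exact_mod_cast hκ
  have hk : rootCos θ ≠ 0 := by
    intro h0
    apply hκ'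
    rw [← rootCos_sq, h0]
    simp
  have h32 : (Real.cos (2 * θ) : ℂ) ^ (3 / 2 : ℂ) = Real.cos (2 * θ) * rootCos θ :=
    cpow_three_halves _ hκ'
  have e : ∀ {x : ℂ} {y : ℝ}, x = y → x.re = y := fun h => by rw [h, Complex.ofReal_re]
  ext i
  fin_cases i
  · refine e ?_
    change (z.re * Real.cos θ * rootCos θ - Real.sin θ * Complex.sinh (z.re * rootCos θ) *
      Complex.cos (z.im * rootCos θ)) / (Real.cos (2 * θ) : ℂ) ^ (3 / 2 : ℂ) =
      (((z.re * Real.cos θ - Real.sin θ * (sinhRoot θ z).re) / Real.cos (2 * θ) : ℝ) : ℂ)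
    rw [h32]
    simp only [Complex.ofReal_sub, Complex.ofReal_mul, Complex.ofReal_div, sinhRoot,
      (sinh_div_rootCos θ z).1]
    field_simp
  · refine e ?_
    change (z.im * Real.sin θ * rootCos θ - Real.cos θ * Complex.cosh (z.re * rootCos θ) *
      Complex.sin (z.im * rootCos θ)) / (Real.cos (2 * θ) : ℂ) ^ (3 / 2 : ℂ) =
      (((z.im * Real.sin θ - Real.cos θ * (sinhRoot θ z).im) / Real.cos (2 * θ) : ℝ) : ℂ)
    rw [h32]
    simp only [Complex.ofReal_sub, Complex.ofReal_mul, Complex.ofReal_div, sinhRoot,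
      (sinh_div_rootCos θ z).2]
    field_simp
  · refine e ?_
    change (Complex.cosh (z.re * rootCos θ) * Complex.cos (z.im * rootCos θ) - 1) /
      (Real.cos (2 * θ) : ℂ) =
      ((((Complex.cosh (rootCos θ * z)).re - 1) / Real.cos (2 * θ) : ℝ) : ℂ)
    simp only [Complex.ofReal_sub, Complex.ofReal_div, cosh_rootCos_re, Complex.ofReal_one]

end Generic

/-! ### Continuity in the parameter -/

/-- `(cosh(kz) - 1) / k²` with `k² = cos 2θ`. -/
def coshRem (θ : ℝ) (z : ℂ) : ℂ :=
  ∫ t in (0 : ℝ)..1, (1 - t) * z ^ 2 * Complex.cosh (rootCos θ * t * z)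

/-- `(sinh(kz)/k - z) / k²` with `k² = cos 2θ`. -/
def sinhRem (θ : ℝ) (z : ℂ) : ℂ :=
  ∫ t in (0 : ℝ)..1, (1 - t) ^ 2 / 2 * z ^ 3 * Complex.cosh (rootCos θ * t * z)

theorem continuous_coshRem : Continuous fun x : ℝ × ℂ => coshRem x.1 x.2 := by
  have := continuous_rootCos
  unfold coshRem
  refine intervalIntegral.continuous_parametric_intervalIntegral_of_continuous' ?_ 0 1
  unfold Function.uncurry
  fun_prop

theorem continuous_sinhRem : Continuous fun x : ℝ × ℂ => sinhRem x.1 x.2 := by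
  have := continuous_rootCos
  unfold sinhRem
  refine intervalIntegral.continuous_parametric_intervalIntegral_of_continuous' ?_ 0 1
  unfold Function.uncurry
  fun_prop

section Remainder

variable {θ : ℝ}

theorem hasDerivAt_cosh_segment (k z : ℂ) (t : ℝ) :
    HasDerivAt (fun t : ℝ => Complex.cosh (k * t * z)) (Complex.sinh (k * t * z) * (k * z)) t := by
  have h := (((hasDerivAt_id (t : ℂ)).const_mul k).mul_const z).ccosh.comp_ofReal
  simpa using h

theorem hasDerivAt_sinh_segment (k z : ℂ) (t : ℝ) :
    HasDerivAt (fun t : ℝ => Complex.sinh (k * t * z)) (Complex.cosh (k * t * z) * (k * z)) t := by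
  have h := (((hasDerivAt_id (t : ℂ)).const_mul k).mul_const z).csinh.comp_ofReal
  simpa using h

theorem hasDerivAt_one_sub (t : ℝ) : HasDerivAt (fun t : ℝ => (1 - t : ℂ)) (-1) t := by
  simpa using (Complex.ofRealCLM.hasDerivAt (x := t)).const_sub (1 : ℂ)

theorem coshRem_eq (hk : rootCos θ ≠ 0) (z : ℂ) :
    coshRem θ z = (Complex.cosh (rootCos θ * z) - 1) / rootCos θ ^ 2 := by
  unfold coshRem
  generalize rootCos θ = k at *
  -- The antiderivative in `t` obtained by integrating Taylor's remainder by parts.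
  have hd : ∀ t ∈ uIcc (0 : ℝ) 1, HasDerivAt (fun t : ℝ => (1 - t : ℂ) *
      (z / k * Complex.sinh (k * t * z)) + Complex.cosh (k * t * z) / k ^ 2)
      ((1 - t) * z ^ 2 * Complex.cosh (k * t * z)) t := fun t _ => by
    refine (((hasDerivAt_one_sub t).mul ((hasDerivAt_sinh_segment k z t).const_mul (z / k))).add
      ((hasDerivAt_cosh_segment k z t).div_const (k ^ 2))).congr_deriv ?_
    field_simp
    ring
  rw [intervalIntegral.integral_eq_sub_of_hasDerivAt hd
    (Continuous.intervalIntegrable (by fun_prop) _ _)]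
  simp
  ring

theorem sinhRem_eq (hk : rootCos θ ≠ 0) (z : ℂ) :
    sinhRem θ z = (sinhRoot θ z - z) / rootCos θ ^ 2 := by
  unfold sinhRem sinhRoot
  generalize rootCos θ = k at *
  have hd : ∀ t ∈ uIcc (0 : ℝ) 1, HasDerivAt (fun t : ℝ => (1 - t : ℂ) ^ 2 *
      (z ^ 2 / (2 * k) * Complex.sinh (k * t * z)) + (1 - t : ℂ) *
      (z / k ^ 2 * Complex.cosh (k * t * z)) + Complex.sinh (k * t * z) / k ^ 3)
      ((1 - t) ^ 2 / 2 * z ^ 3 * Complex.cosh (k * t * z)) t := fun t _ => by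
    refine (((((hasDerivAt_one_sub t).fun_pow 2).mul
      ((hasDerivAt_sinh_segment k z t).const_mul (z ^ 2 / (2 * k)))).add
      ((hasDerivAt_one_sub t).mul ((hasDerivAt_cosh_segment k z t).const_mul (z / k ^ 2)))).add
      ((hasDerivAt_sinh_segment k z t).div_const (k ^ 3))).congr_deriv ?_
    simp
    field_simp
    ring
  rw [intervalIntegral.integral_eq_sub_of_hasDerivAt hd
    (Continuous.intervalIntegrable (by fun_prop) _ _)]
  simp
  field_simp

theorem coshRem_of_rootCos_eq_zero (hk : rootCos θ = 0) (z : ℂ) : coshRem θ z = z ^ 2 / 2 := by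
  unfold coshRem
  rw [hk]
  have hd : ∀ t ∈ uIcc (0 : ℝ) 1, HasDerivAt (fun t : ℝ => (1 - t : ℂ) ^ 2 * (-z ^ 2 / 2))
      ((1 - t) * z ^ 2 * Complex.cosh (0 * t * z)) t := fun t _ => by
    refine (((hasDerivAt_one_sub t).fun_pow 2).mul_const (-z ^ 2 / 2)).congr_deriv ?_
    simp
    ring
  rw [intervalIntegral.integral_eq_sub_of_hasDerivAt hd
    (Continuous.intervalIntegrable (by fun_prop) _ _)]
  simp
  ring

theorem sinhRem_of_rootCos_eq_zero (hk : rootCos θ = 0) (z : ℂ) : sinhRem θ z = z ^ 3 / 6 := by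
  unfold sinhRem
  rw [hk]
  have hd : ∀ t ∈ uIcc (0 : ℝ) 1, HasDerivAt (fun t : ℝ => (1 - t : ℂ) ^ 3 * (-z ^ 3 / 6))
      ((1 - t) ^ 2 / 2 * z ^ 3 * Complex.cosh (0 * t * z)) t := fun t _ => by
    refine (((hasDerivAt_one_sub t).fun_pow 3).mul_const (-z ^ 3 / 6)).congr_deriv ?_
    simp
    ring
  rw [intervalIntegral.integral_eq_sub_of_hasDerivAt hd
    (Continuous.intervalIntegrable (by fun_prop) _ _)]
  simp
  ring

end Remainder

/-- A formula for the family without exceptional parameters. -/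
def uniformFormula (θ : ℝ) (z : ℂ) : E3 :=
  !₂[(2 * (1 - Real.sin (θ + Real.pi / 4)) * |Real.cos (θ + Real.pi / 4)| + 1) * (z.re / √2) -
      R θ * Real.sin θ * (sinhRem θ z).re,
    -((2 * (1 - Real.sin (θ + Real.pi / 4)) * |Real.cos (θ + Real.pi / 4)| + 1) * (z.im / √2)) -
      R θ * Real.cos θ * (sinhRem θ z).im,
    R θ * (coshRem θ z).re]

theorem continuous_uniformFormula : Continuous fun x : ℝ × ℂ => uniformFormula x.1 x.2 := by
  have h1 := continuous_sinhRem
  have h2 := continuous_coshRem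
  have hR : Continuous R := by
    unfold R
    fun_prop
  unfold uniformFormula
  refine (PiLp.continuous_toLp 2 _).comp (continuous_pi fun i => ?_)
  fin_cases i <;> simp <;> fun_prop

/-! ### Trigonometry of the angle and agreement with the uniform formula. -/

theorem cos_add_sin (θ : ℝ) : Real.cos θ + Real.sin θ = √2 * Real.sin (θ + Real.pi / 4) := by
  rw [Real.sin_add, Real.cos_pi_div_four, Real.sin_pi_div_four]
  have : √2 * √2 = 2 := Real.mul_self_sqrt (by norm_num)
  linear_combination (-(Real.cos θ + Real.sin θ) / 2) * this

theorem cos_sub_sin (θ : ℝ) : Real.cos θ - Real.sin θ = √2 * Real.cos (θ + Real.pi / 4) := by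
  rw [Real.cos_add, Real.cos_pi_div_four, Real.sin_pi_div_four]
  have : √2 * √2 = 2 := Real.mul_self_sqrt (by norm_num)
  linear_combination (-(Real.cos θ - Real.sin θ) / 2) * this

theorem cos_two_mul_eq (θ : ℝ) : Real.cos (2 * θ) =
    2 * Real.sin (θ + Real.pi / 4) * Real.cos (θ + Real.pi / 4) := by
  have : √2 * √2 = 2 := Real.mul_self_sqrt (by norm_num)
  have h1 : Real.cos (2 * θ) = (Real.cos θ + Real.sin θ) * (Real.cos θ - Real.sin θ) := by
    rw [Real.cos_two_mul']
    ring
  rw [h1, cos_add_sin, cos_sub_sin]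
  linear_combination Real.sin (θ + Real.pi / 4) * Real.cos (θ + Real.pi / 4) * this

theorem sin_add_pos {θ : ℝ} (hθ : θ ∈ Ioo (-(Real.pi / 4)) (3 * Real.pi / 4)) :
    0 < Real.sin (θ + Real.pi / 4) :=
  Real.sin_pos_of_pos_of_lt_pi (by linarith [hθ.1]) (by linarith [hθ.2])

theorem R_pos {θ : ℝ} (hθ : θ ∈ Ioo (-(Real.pi / 4)) (3 * Real.pi / 4)) : 0 < R θ := by
  have h1 := sin_add_pos hθ
  have h2 := Real.sin_le_one (θ + Real.pi / 4)
  exact add_pos_of_nonneg_of_pos (mul_nonneg (by linarith) (abs_nonneg _)) h1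

theorem cos_two_mul_ne_zero {θ : ℝ} (hθ : θ ∈ Ioo (-(Real.pi / 4)) (3 * Real.pi / 4))
    (h : θ ≠ Real.pi / 4) : Real.cos (2 * θ) ≠ 0 := by
  intro h0
  obtain ⟨k, hk⟩ := Real.cos_eq_zero_iff.1 h0
  have hπ := Real.pi_pos
  have h1 : (-1 : ℝ) < k := by nlinarith [hθ.1]
  have h2 : (k : ℝ) < 1 := by nlinarith [hθ.2]
  have h3 : k = 0 := by
    have h1' : (-1 : ℤ) < k := by exact_mod_cast h1
    have h2' : k < 1 := by exact_mod_cast h2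
    omega
  apply h
  rw [h3] at hk
  push_cast at hk
  linarith

theorem rootCos_ne_zero {θ : ℝ} (h : Real.cos (2 * θ) ≠ 0) : rootCos θ ≠ 0 := by
  intro h0
  have h1 := rootCos_sq θ
  rw [h0, zero_pow two_ne_zero, eq_comm, Complex.ofReal_eq_zero] at h1
  exact h h1

theorem rootCos_eq_zero {θ : ℝ} (h : Real.cos (2 * θ) = 0) : rootCos θ = 0 := by
  have h1 := rootCos_sq θ
  rw [h] at h1
  simpa using h1

theorem Xtilde_of_end {θ : ℝ} (h : θ = -(Real.pi / 4) ∨ θ = 3 * Real.pi / 4) (z : ℂ) :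
    Xtilde θ z = (3 / √2) • !₂[z.re, -z.im, 0] := by
  rw [Xtilde, if_pos h]

theorem Xtilde_pi_div_four (z : ℂ) : Xtilde (Real.pi / 4) z =
    !₂[-(z.re * (-6 + z.re ^ 2 - 3 * z.im ^ 2) / (6 * √2)),
       z.im * (-6 - 3 * z.re ^ 2 + z.im ^ 2) / (6 * √2),
       (z.re ^ 2 - z.im ^ 2) / 2] := by
  have hπ := Real.pi_pos
  rw [Xtilde, if_neg, if_pos rfl]
  rintro (h | h) <;> linarith

theorem Xtilde_of_generic {θ : ℝ} (hθ : θ ∈ Ioo (-(Real.pi / 4)) (3 * Real.pi / 4))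
    (h : θ ≠ Real.pi / 4) (z : ℂ) : Xtilde θ z = R θ •
      !₂[(z.re * Real.cos θ - Real.sin θ * (sinhRoot θ z).re) / Real.cos (2 * θ),
        (z.im * Real.sin θ - Real.cos θ * (sinhRoot θ z).im) / Real.cos (2 * θ),
        ((Complex.cosh (rootCos θ * z)).re - 1) / Real.cos (2 * θ)] := by
  rw [Xtilde, if_neg, if_neg h, generic_re (cos_two_mul_ne_zero hθ h)]
  rintro (h | h)
  · exact absurd hθ.1 (by rw [h]; exact lt_irrefl _)
  · exact absurd hθ.2 (by rw [h]; exact lt_irrefl _)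

/-- The factor of `cos 2θ` that vanishes at both ends of the parameter interval divides `R θ`. The
remaining quotient is `3` there, the constant in the planar case of `Xtilde`. -/
theorem R_eq {θ : ℝ} (h : 0 ≤ Real.sin (θ + Real.pi / 4)) : R θ = Real.sin (θ + Real.pi / 4) *
    (2 * (1 - Real.sin (θ + Real.pi / 4)) * |Real.cos (θ + Real.pi / 4)| + 1) := by
  rw [R, cos_two_mul_eq, abs_mul, abs_of_nonneg (mul_nonneg zero_le_two h)]
  ring

theorem Xtilde_eq_uniformFormula {θ : ℝ} (hθ : θ ∈ Icc (-(Real.pi / 4)) (3 * Real.pi / 4))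
    (z : ℂ) : Xtilde θ z = uniformFormula θ z := by
  have hs2 : √2 * √2 = 2 := Real.mul_self_sqrt (by norm_num)
  have hs0 : √2 ≠ 0 := by positivity
  by_cases hend : θ = -(Real.pi / 4) ∨ θ = 3 * Real.pi / 4
  · have h1 : Real.sin (θ + Real.pi / 4) = 0 ∧ |Real.cos (θ + Real.pi / 4)| = 1 := by
      rcases hend with rfl | rfl
      · simp
      · rw [show 3 * Real.pi / 4 + Real.pi / 4 = Real.pi by ring]
        simp
    rw [Xtilde_of_end hend, uniformFormula, R_eq h1.1.ge, h1.1, h1.2]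
    ext i
    fin_cases i <;> simp <;> ring
  by_cases h4 : θ = Real.pi / 4
  · subst h4
    have hk : rootCos (Real.pi / 4) = 0 := rootCos_eq_zero (by
      rw [show 2 * (Real.pi / 4) = Real.pi / 2 by ring, Real.cos_pi_div_two])
    have hσ : Real.sin (Real.pi / 4 + Real.pi / 4) = 1 := by
      rw [show Real.pi / 4 + Real.pi / 4 = Real.pi / 2 by ring, Real.sin_pi_div_two]
    rw [Xtilde_pi_div_four, uniformFormula, R_eq (by rw [hσ]; exact zero_le_one), hσ,
      sinhRem_of_rootCos_eq_zero hk, coshRem_of_rootCos_eq_zero hk, Real.sin_pi_div_four,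
      Real.cos_pi_div_four]
    have hz := Complex.re_add_im z
    have h3 : (z ^ 3 / 6).re = (z.re ^ 3 - 3 * z.re * z.im ^ 2) / 6 ∧
        (z ^ 3 / 6).im = (3 * z.re ^ 2 * z.im - z.im ^ 3) / 6 := by
      rw [show z ^ 3 / 6 = ((1 / 6 : ℝ) : ℂ) * (z * z * z) by push_cast; ring]
      rw [Complex.re_ofReal_mul, Complex.im_ofReal_mul]
      simp only [Complex.mul_re, Complex.mul_im]
      constructor <;> ring
    have h2 : (z ^ 2 / 2).re = (z.re ^ 2 - z.im ^ 2) / 2 := by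
      rw [show z ^ 2 / 2 = ((1 / 2 : ℝ) : ℂ) * (z * z) by push_cast; ring, Complex.re_ofReal_mul]
      simp only [Complex.mul_re]
      ring
    rw [h3.1, h3.2, h2]
    ext i
    fin_cases i
    · simp
      field_simp
      linear_combination (z.re ^ 3 - 3 * z.re * z.im ^ 2) * hs2
    · simp
      field_simp
      linear_combination (3 * z.re ^ 2 * z.im - z.im ^ 3) * hs2
    · simp
  have hθ' : θ ∈ Ioo (-(Real.pi / 4)) (3 * Real.pi / 4) :=
    ⟨lt_of_le_of_ne hθ.1 fun h => hend (Or.inl h.symm),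
      lt_of_le_of_ne hθ.2 fun h => hend (Or.inr h)⟩
  have hκ := cos_two_mul_ne_zero hθ' h4
  have hκ' : (Real.cos (2 * θ) : ℂ) ≠ 0 := by exact_mod_cast hκ
  have hσ := sin_add_pos hθ'
  rw [Xtilde_of_generic hθ' h4, uniformFormula, sinhRem_eq (rootCos_ne_zero hκ),
    coshRem_eq (rootCos_ne_zero hκ), rootCos_sq]
  -- Splitting `sinh(kz)/k` into `z` and its remainder leaves the linear coefficient `R (cos θ - sin
  -- θ) / cos 2θ`, that is, `R` divided by `√2 sin (θ + π/4)`.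
  have e1 : (2 * (1 - Real.sin (θ + Real.pi / 4)) * |Real.cos (θ + Real.pi / 4)| + 1) / √2 =
      R θ * (Real.cos θ - Real.sin θ) / Real.cos (2 * θ) := by
    rw [div_eq_div_iff hs0 hκ, R_eq hσ.le, cos_sub_sin, cos_two_mul_eq]
    linear_combination (-(Real.sin (θ + Real.pi / 4) * (2 * (1 - Real.sin (θ + Real.pi / 4)) *
      |Real.cos (θ + Real.pi / 4)| + 1) * Real.cos (θ + Real.pi / 4))) * hs2
  have e2 : ∀ x : ℝ, (2 * (1 - Real.sin (θ + Real.pi / 4)) * |Real.cos (θ + Real.pi / 4)| + 1) *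
      (x / √2) = R θ * (Real.cos θ - Real.sin θ) / Real.cos (2 * θ) * x := fun x => by
    rw [← e1]
    ring
  rw [e2, e2, Complex.div_ofReal_re, Complex.div_ofReal_im, Complex.div_ofReal_re]
  ext i
  fin_cases i <;> simp <;> field_simp <;> ring

theorem tendstoUniformlyOn_Xtilde {θ₀ : ℝ} (hθ₀ : θ₀ ∈ Icc (-(Real.pi / 4)) (3 * Real.pi / 4))
    {K : Set ℂ} (hK : IsCompact K) : TendstoUniformlyOn Xtilde (Xtilde θ₀)
      (𝓝[Icc (-(Real.pi / 4)) (3 * Real.pi / 4)] θ₀) K := by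
  -- Joint continuity on the compact product of the parameter interval with `K` is uniform.
  refine UniformContinuousOn.tendstoUniformlyOn
    ((isCompact_Icc.prod hK).uniformContinuousOn_of_continuous ?_) hθ₀
  refine continuous_uniformFormula.continuousOn.congr fun x hx => ?_
  exact Xtilde_eq_uniformFormula hx.1 x.2

/-! ### The types of the members of the family -/

theorem isSimilar_of_data {X Y : ℂ → E3} {Φ Ψ : ℂ → Fin 3 → ℂ} (hX : HasData univ X Φ)
    (hY : HasData univ Y Ψ) {r : ℝ} (hr : 0 < r) {a b : ℂ} (ha : a ≠ 0)
    {M : Matrix (Fin 3) (Fin 3) ℝ} (hM : Mᵀ * M = 1)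
    (h : ∀ z, Φ z = (r * a) • cm M *ᵥ Ψ (a * z + b)) : IsSimilar X Y := by
  have h1 : ∀ z, HasDerivAt (fun z : ℂ => a * z + b) a z := fun z => by
    simpa using ((hasDerivAt_id z).const_mul a).add_const b
  obtain ⟨A, hA⟩ := exists_eq_of_data isOpen_univ isPreconnected_univ hX hY
    (φ := fun z => a * z + b) (φ' := fun _ => a) (fun z _ => h1 z) hr hM fun z _ => h z
  exact ⟨r, A, a, b, hr, ha, fun z => hA z (mem_univ z)⟩

theorem IsSimilar.refl (X : ℂ → E3) : IsSimilar X X :=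
  ⟨1, AffineIsometryEquiv.refl ℝ E3, 1, 0, one_pos, one_ne_zero, fun z => by simp⟩

theorem isSimilar_plane {θ : ℝ} (h : θ = -(Real.pi / 4) ∨ θ = 3 * Real.pi / 4) :
    IsSimilar (Xtilde θ) plane :=
  ⟨3 / √2, AffineIsometryEquiv.refl ℝ E3, 1, 0, by positivity, one_ne_zero, fun z => by
    rw [Xtilde_of_end h, plane_apply]
    simp⟩

theorem isSimilar_enneper : IsSimilar (Xtilde (Real.pi / 4)) enneper := by
  have hs2 : (√2 : ℂ) * √2 = 2 := by exact_mod_cast Real.mul_self_sqrt (by norm_num : (0 : ℝ) ≤ 2)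
  have hs0 : (√2 : ℂ) ≠ 0 := by
    intro h0
    simp [h0] at hs2
  have hs0' : √2 ≠ 0 := by positivity
  set F : ℂ → Fin 3 → ℂ := fun z => ![((1 / (6 * √2) : ℝ) : ℂ) * (6 * z - z * z * z),
    ((1 / (6 * √2) : ℝ) : ℂ) * ((6 * z + z * z * z) * Complex.I),
    ((1 / 2 : ℝ) : ℂ) * (z * z)] with hF
  have hXF : Xtilde (Real.pi / 4) = fun z => (WithLp.toLp 2 fun i => (F z i).re : E3) := by
    funext z
    rw [Xtilde_pi_div_four]
    ext i
    fin_cases i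
    · simp only [hF, Fin.zero_eta, cons_val_zero, Complex.re_ofReal_mul]
      simp
      field_simp
      ring
    · simp only [hF, Fin.mk_one, cons_val_one, cons_val_zero, Complex.re_ofReal_mul, Complex.mul_I_re]
      simp
      field_simp
      ring
    · simp only [hF, Fin.reduceFinMk, cons_val, Complex.re_ofReal_mul]
      simp
      field_simp
  -- The complex derivative is `enneperData (z / √2) / √2`, so neither a rotation nor a homothety is
  -- needed.
  have hd : HasData univ (Xtilde (Real.pi / 4))
      fun z => (((1 : ℝ) : ℂ) * (√2 : ℂ)⁻¹) • cm 1 *ᵥ enneperData ((√2 : ℂ)⁻¹ * z + 0) := by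
    intro z _
    rw [hXF]
    have hz := hasDerivAt_id z
    have hs3 : (√2 : ℂ) ^ 2 = 2 := by rw [pow_two, hs2]
    refine hasFDerivAt_re fun i => ?_
    simp only [cm_one, one_mulVec]
    fin_cases i
    · refine (((hz.const_mul 6).sub ((hz.mul hz).mul hz)).const_mul
        ((1 / (6 * √2) : ℝ) : ℂ)).congr_deriv ?_
      simp [enneperData]
      field_simp
      rw [hs3]
      ring
    · refine ((((hz.const_mul 6).add ((hz.mul hz).mul hz)).mul_const Complex.I).const_mul
        ((1 / (6 * √2) : ℝ) : ℂ)).congr_deriv ?_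
      simp [enneperData]
      field_simp
      rw [hs3]
      ring
    · refine ((hz.mul hz).const_mul ((1 / 2 : ℝ) : ℂ)).congr_deriv ?_
      simp [enneperData]
      field_simp
      rw [hs3]
      ring
  exact isSimilar_of_data hd hasData_enneper one_pos (inv_ne_zero hs0)
    (by rw [transpose_one, one_mul]) fun z => rfl

/-- The complex derivative of `X̃ ^ θ`, divided by `√(cos 2θ)`. -/
theorem exists_hasData_Xtilde {θ : ℝ} (hθ : θ ∈ Ioo (-(Real.pi / 4)) (3 * Real.pi / 4))
    (h : θ ≠ Real.pi / 4) {k a : ℂ} (hk : k = rootCos θ) (ha : a = R θ / (2 * k ^ 3)) :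
    HasData univ (Xtilde θ) fun z => k •
      ((2 * a) • ![(Real.cos θ : ℂ), -(Complex.I * Real.sin θ), 0] +
        Complex.exp (k * z) • a • ![-(Real.sin θ : ℂ), Complex.I * Real.cos θ, k] +
        Complex.exp (-(k * z)) • a • ![-(Real.sin θ : ℂ), Complex.I * Real.cos θ, -k]) := by
  have hκ := cos_two_mul_ne_zero hθ h
  have hk0 : k ≠ 0 := by rw [hk]; exact rootCos_ne_zero hκ
  have hκk : (Real.cos (2 * θ) : ℂ) = k ^ 2 := by rw [hk, rootCos_sq]
  have hκ' : (Real.cos (2 * θ) : ℂ) ≠ 0 := by exact_mod_cast hκ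
  -- A holomorphic curve whose real part is `Xtilde θ`; the factor `i` in the second component turns
  -- imaginary parts into real ones.
  set F : ℂ → Fin 3 → ℂ := fun z =>
    ![((R θ / Real.cos (2 * θ) : ℝ) : ℂ) * (Real.cos θ * z - Real.sin θ * sinhRoot θ z),
      ((R θ / Real.cos (2 * θ) : ℝ) : ℂ) *
        ((Real.cos θ * sinhRoot θ z - Real.sin θ * z) * Complex.I),
      ((R θ / Real.cos (2 * θ) : ℝ) : ℂ) * (Complex.cosh (rootCos θ * z) - 1)] with hF
  have hXF : Xtilde θ = fun z => (WithLp.toLp 2 fun i => (F z i).re : E3) := by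
    funext z
    rw [Xtilde_of_generic hθ h]
    ext i
    fin_cases i
    · simp only [hF, Fin.zero_eta, cons_val_zero, Complex.re_ofReal_mul, Complex.sub_re]
      simp
      ring
    · simp only [hF, Fin.mk_one, cons_val_one, cons_val_zero, Complex.re_ofReal_mul, Complex.mul_I_re,
        Complex.sub_im, Complex.im_ofReal_mul]
      simp
      ring
    · simp only [hF, Fin.reduceFinMk, cons_val, Complex.re_ofReal_mul, Complex.sub_re]
      simp
      ring
  intro z _
  rw [hXF]
  have hz := hasDerivAt_id z
  have hkz : HasDerivAt (fun w => k * w) k z := by simpa using hz.const_mul k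
  have hS : HasDerivAt (sinhRoot θ) (Complex.cosh (k * z)) z := by
    unfold sinhRoot
    rw [← hk]
    refine (hkz.csinh.div_const k).congr_deriv ?_
    field_simp
  have hcosh : Complex.cosh (k * z) = (Complex.exp (k * z) + Complex.exp (-(k * z))) / 2 := rfl
  have hsinh : Complex.sinh (k * z) = (Complex.exp (k * z) - Complex.exp (-(k * z))) / 2 := rfl
  have hR : ((R θ / Real.cos (2 * θ) : ℝ) : ℂ) = R θ / k ^ 2 := by
    rw [Complex.ofReal_div, hκk]
  refine hasFDerivAt_re fun i => ?_
  fin_cases i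
  · refine (((hz.const_mul (Real.cos θ : ℂ)).sub (hS.const_mul (Real.sin θ : ℂ))).const_mul
      ((R θ / Real.cos (2 * θ) : ℝ) : ℂ)).congr_deriv ?_
    rw [hR, hcosh, ha]
    simp
    field_simp
    ring
  · refine ((((hS.const_mul (Real.cos θ : ℂ)).sub (hz.const_mul (Real.sin θ : ℂ))).mul_const
      Complex.I).const_mul ((R θ / Real.cos (2 * θ) : ℝ) : ℂ)).congr_deriv ?_
    rw [hR, hcosh, ha]
    simp
    field_simp
    ring
  · have h1 := ((hkz.ccosh.sub_const 1).const_mul ((R θ / Real.cos (2 * θ) : ℝ) : ℂ))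
    rw [hk] at h1
    refine h1.congr_deriv ?_
    rw [← hk, hR, hsinh, ha]
    simp
    field_simp
    ring

/-- The relation for `t` comes from computing `C₀ ⬝ C̄₀` twice: it is `4 |a|²` directly and `ρ² (8
t² + 4)` in the normal form, where `ρ² = |a|² |cos 2θ|`. -/
theorem exists_isSimilar_bonnet {θ : ℝ} (hθ : θ ∈ Ioo (-(Real.pi / 4)) (3 * Real.pi / 4))
    (h : θ ≠ Real.pi / 4) :
    ∃ t : ℝ, 0 ≤ t ∧ |Real.cos (2 * θ)| * (2 * t ^ 2 + 1) = 1 ∧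
      IsSimilar (Xtilde θ) (bonnet t) := by
  have hκ := cos_two_mul_ne_zero hθ h
  have hκ0 : 0 < |Real.cos (2 * θ)| := abs_pos.2 hκ
  have hκ' : (Real.cos (2 * θ) : ℂ) ≠ 0 := by exact_mod_cast hκ
  obtain ⟨k, hk⟩ : ∃ k, k = rootCos θ := ⟨_, rfl⟩
  have hk0 : k ≠ 0 := by rw [hk]; exact rootCos_ne_zero hκ
  have hκk : k ^ 2 = (Real.cos (2 * θ) : ℂ) := by rw [hk, rootCos_sq]
  obtain ⟨a, ha⟩ : ∃ a : ℂ, a = R θ / (2 * k ^ 3) := ⟨_, rfl⟩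
  have hd := exists_hasData_Xtilde hθ h hk ha
  have hR := R_pos hθ
  -- This `ρ` is forced by `4 ρ² = C₀ ⬝ C₀ = 4 a² k²`.
  have hρ : 0 < R θ / (2 * |Real.cos (2 * θ)|) := by positivity
  have hρ2 : ((R θ / (2 * |Real.cos (2 * θ)|) : ℝ) : ℂ) ^ 2 = a ^ 2 * k ^ 2 := by
    have h1 : (R θ / (2 * |Real.cos (2 * θ)|)) ^ 2 = R θ ^ 2 / (4 * Real.cos (2 * θ) ^ 2) := by
      rw [div_pow, mul_pow, sq_abs]
      norm_num
    rw [← Complex.ofReal_pow, h1, ha]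
    simp only [Complex.ofReal_div, Complex.ofReal_mul, Complex.ofReal_pow, Complex.ofReal_ofNat,
      ← hκk]
    field_simp
    norm_num
  have hcs : (Real.cos θ : ℂ) ^ 2 - (Real.sin θ : ℂ) ^ 2 = k ^ 2 := by
    rw [hκk, Real.cos_two_mul']
    push_cast
    ring
  have hI := Complex.I_sq
  obtain ⟨M, t, c, hM, ht, hstar, hform⟩ := exists_bonnet_normal_form hρ
    (C₀ := (2 * a) • ![(Real.cos θ : ℂ), -(Complex.I * Real.sin θ), 0])
    (C₁ := a • ![-(Real.sin θ : ℂ), Complex.I * Real.cos θ, k])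
    (C₂ := a • ![-(Real.sin θ : ℂ), Complex.I * Real.cos θ, -k])
    (by
      rw [hρ2]
      simp only [dotProduct, Fin.sum_univ_three, Pi.smul_apply, smul_eq_mul,
        cons_val_zero, cons_val_one, cons_val]
      linear_combination (4 * a ^ 2) * hcs + (4 * a ^ 2 * (Real.sin θ : ℂ) ^ 2) * hI)
    (by
      simp only [dotProduct, Fin.sum_univ_three, Pi.smul_apply, smul_eq_mul,
        cons_val_zero, cons_val_one, cons_val]
      linear_combination (-2 * a ^ 2 * (Real.sin θ : ℂ) * (Real.cos θ : ℂ)) * hI)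
    (by
      simp only [dotProduct, Fin.sum_univ_three, Pi.smul_apply, smul_eq_mul,
        cons_val_zero, cons_val_one, cons_val]
      linear_combination (-2 * a ^ 2 * (Real.sin θ : ℂ) * (Real.cos θ : ℂ)) * hI)
    (by
      simp only [dotProduct, Fin.sum_univ_three, Pi.smul_apply, smul_eq_mul,
        cons_val_zero, cons_val_one, cons_val]
      linear_combination (-a ^ 2) * hcs + (a ^ 2 * (Real.cos θ : ℂ) ^ 2) * hI)
    (by
      rw [hρ2]
      simp only [dotProduct, Fin.sum_univ_three, Pi.smul_apply, smul_eq_mul,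
        cons_val_zero, cons_val_one, cons_val]
      linear_combination (-a ^ 2) * hcs + (a ^ 2 * (Real.cos θ : ℂ) ^ 2) * hI)
    (by
      simp only [dotProduct, Fin.sum_univ_three, Pi.smul_apply, smul_eq_mul,
        cons_val_zero, cons_val_one, cons_val]
      linear_combination (-a ^ 2) * hcs + (a ^ 2 * (Real.cos θ : ℂ) ^ 2) * hI)
  refine ⟨t, ht, ?_, isSimilar_of_data hd (hasData_bonnet t) hρ (b := c) hk0 hM fun z => ?_⟩
  · have hnorm : ‖a‖ ^ 2 * |Real.cos (2 * θ)| = (R θ / (2 * |Real.cos (2 * θ)|)) ^ 2 := by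
      have h1 := congrArg norm hρ2
      rw [hκk, norm_pow, norm_mul, norm_pow, Complex.norm_real, Complex.norm_real,
        Real.norm_eq_abs, Real.norm_eq_abs, abs_of_pos hρ] at h1
      exact h1.symm
    have h2 : (((2 * a) • ![(Real.cos θ : ℂ), -(Complex.I * Real.sin θ), 0]) ⬝ᵥ
        star ((2 * a) • ![(Real.cos θ : ℂ), -(Complex.I * Real.sin θ), 0])) =
        ((4 * ‖a‖ ^ 2 : ℝ) : ℂ) := by
      have h3 : a * (starRingEnd ℂ) a = ((‖a‖ ^ 2 : ℝ) : ℂ) := by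
        rw [Complex.mul_conj, Complex.normSq_eq_norm_sq]
      have h4 : (Real.cos θ : ℂ) ^ 2 + (Real.sin θ : ℂ) ^ 2 = 1 := by
        exact_mod_cast Real.cos_sq_add_sin_sq θ
      simp only [dotProduct, Fin.sum_univ_three, Pi.smul_apply, Pi.star_apply, smul_eq_mul,
        cons_val_zero, cons_val_one, cons_val, star_mul', RCLike.star_def, map_neg, map_mul,
        Complex.conj_ofReal, Complex.conj_I, Complex.conj_ofNat, map_zero]
      rw [Complex.ofReal_mul, ← h3, Complex.ofReal_ofNat]
      linear_combination (4 * a * (starRingEnd ℂ) a) * h4 -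
        (4 * a * (starRingEnd ℂ) a * (Real.sin θ : ℂ) ^ 2) * hI
    rw [h2] at hstar
    have h5 : 4 * ‖a‖ ^ 2 = (R θ / (2 * |Real.cos (2 * θ)|)) ^ 2 * (8 * t ^ 2 + 4) := by
      exact_mod_cast hstar
    rw [← hnorm] at h5
    have h6 : 4 * ‖a‖ ^ 2 * (|Real.cos (2 * θ)| * (2 * t ^ 2 + 1) - 1) = 0 := by
      linear_combination -h5
    have ha0 : a ≠ 0 := by
      rw [ha]
      exact div_ne_zero (by exact_mod_cast hR.ne') (mul_ne_zero two_ne_zero (pow_ne_zero 3 hk0))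
    have h7 := (mul_eq_zero.1 h6).resolve_left (by positivity)
    linarith
  · rw [hform, smul_smul]
    congr 1
    ring

theorem abs_cos_two_mul_eq_one_iff {θ : ℝ}
    (hθ : θ ∈ Ioo (-(Real.pi / 4)) (3 * Real.pi / 4)) :
    |Real.cos (2 * θ)| = 1 ↔ θ = 0 ∨ θ = Real.pi / 2 := by
  have hπ := Real.pi_pos
  constructor
  · intro h
    have h1 : Real.sin (2 * θ) = 0 := by
      have h2 := Real.sin_sq_add_cos_sq (2 * θ)
      rw [← sq_abs (Real.cos (2 * θ)), h] at h2
      have h3 : Real.sin (2 * θ) ^ 2 = 0 := by linarith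
      exact pow_eq_zero_iff two_ne_zero |>.1 h3
    obtain ⟨n, hn⟩ := Real.sin_eq_zero_iff.1 h1
    have h2 : (-1 : ℝ) < n := by nlinarith [hθ.1]
    have h3 : (n : ℝ) < 2 := by nlinarith [hθ.2]
    have h2' : (-1 : ℤ) < n := by exact_mod_cast h2
    have h3' : n < 2 := by exact_mod_cast h3
    have h4 : n = 0 ∨ n = 1 := by omega
    rcases h4 with rfl | rfl
    · left
      push_cast at hn
      linarith
    · right
      push_cast at hn
      linarith
  · rintro (rfl | rfl)
    · simp
    · rw [show 2 * (Real.pi / 2) = Real.pi by ring, Real.cos_pi]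
      simp

theorem exists_isSimilar_of_mem_angles {θ : ℝ}
    (hθ : θ ∈ Icc (-(Real.pi / 4)) (3 * Real.pi / 4)) {τ : SurfaceType} (hτ : θ ∈ τ.angles) :
    ∃ Y ∈ τ.models, IsSimilar (Xtilde θ) Y := by
  have hπ := Real.pi_pos
  cases τ with
  | plane => exact ⟨plane, rfl, isSimilar_plane hτ⟩
  | enneper =>
    have h : θ = Real.pi / 4 := hτ
    subst h
    exact ⟨enneper, rfl, isSimilar_enneper⟩
  | catenoid =>
    have h : θ = 0 ∨ θ = Real.pi / 2 := hτ
    have hθ' : θ ∈ Ioo (-(Real.pi / 4)) (3 * Real.pi / 4) := by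
      rcases h with rfl | rfl <;> constructor <;> linarith
    have h4 : θ ≠ Real.pi / 4 := by
      rcases h with rfl | rfl <;> intro h <;> linarith
    obtain ⟨t, ht, h1, hsim⟩ := exists_isSimilar_bonnet hθ' h4
    rw [(abs_cos_two_mul_eq_one_iff hθ').2 h] at h1
    have h2 : t = 0 := by
      have : t ^ 2 = 0 := by linarith
      exact pow_eq_zero_iff two_ne_zero |>.1 this
    rw [h2, bonnet_zero] at hsim
    exact ⟨catenoid, rfl, hsim⟩
  | bonnet =>
    obtain ⟨hθ', h⟩ := hτ
    simp only [mem_insert_iff, mem_singleton_iff, not_or] at h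
    obtain ⟨t, ht, h1, hsim⟩ := exists_isSimilar_bonnet hθ' h.2.1
    refine ⟨bonnet t, ⟨t, lt_of_le_of_ne ht ?_, rfl⟩, hsim⟩
    rintro rfl
    have h2 : |Real.cos (2 * θ)| = 1 := by linarith
    rcases (abs_cos_two_mul_eq_one_iff hθ').1 h2 with h3 | h3
    · exact h.1 h3
    · exact h.2.2 h3

theorem exists_mem_angles {θ : ℝ} (hθ : θ ∈ Icc (-(Real.pi / 4)) (3 * Real.pi / 4)) :
    ∃ τ : SurfaceType, θ ∈ τ.angles := by
  by_cases h1 : θ = -(Real.pi / 4) ∨ θ = 3 * Real.pi / 4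
  · exact ⟨.plane, h1⟩
  by_cases h2 : θ = 0 ∨ θ = Real.pi / 2
  · exact ⟨.catenoid, h2⟩
  by_cases h3 : θ = Real.pi / 4
  · exact ⟨.enneper, h3⟩
  rw [not_or] at h1 h2
  refine ⟨.bonnet, ⟨lt_of_le_of_ne hθ.1 (Ne.symm h1.1), lt_of_le_of_ne hθ.2 h1.2⟩, ?_⟩
  simp only [mem_insert_iff, mem_singleton_iff, not_or]
  exact ⟨h2.1, h3, h2.2⟩

theorem exists_isSimilar_of_mem_models {τ : SurfaceType} {Y : ℂ → E3} (hY : Y ∈ τ.models) :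
    ∃ θ ∈ Icc (-(Real.pi / 4)) (3 * Real.pi / 4), IsSimilar (Xtilde θ) Y := by
  have hπ := Real.pi_pos
  cases τ with
  | plane =>
    have h : Y = plane := hY
    subst h
    exact ⟨-(Real.pi / 4), ⟨le_rfl, by linarith⟩, isSimilar_plane (Or.inl rfl)⟩
  | enneper =>
    have h : Y = enneper := hY
    subst h
    exact ⟨Real.pi / 4, ⟨by linarith, by linarith⟩, isSimilar_enneper⟩
  | catenoid =>
    have h : Y = catenoid := hY
    have h0 : (0 : ℝ) ∈ Icc (-(Real.pi / 4)) (3 * Real.pi / 4) := ⟨by linarith, by linarith⟩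
    obtain ⟨Z, hZ, hsim⟩ := exists_isSimilar_of_mem_angles h0 (τ := .catenoid) (Or.inl rfl)
    have hZ' : Z = catenoid := hZ
    rw [hZ', ← h] at hsim
    exact ⟨0, h0, hsim⟩
  | bonnet =>
    obtain ⟨t, ht, rfl⟩ := hY
    -- The angle is found by solving `cos 2θ = 1 / (2 t² + 1)` in `(-π/4, 0)`.
    set x : ℝ := (2 * t ^ 2 + 1)⁻¹ with hx
    have hx0 : 0 < x := by positivity
    have hx1 : x < 1 := inv_lt_one_of_one_lt₀ (by nlinarith)
    have ha := Real.arccos_lt_pi_div_two.2 hx0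
    have ha' := Real.arccos_pos.2 hx1
    set θ : ℝ := -(Real.arccos x / 2) with hθ
    have hθ' : θ ∈ Ioo (-(Real.pi / 4)) (3 * Real.pi / 4) := ⟨by linarith, by linarith⟩
    have hcos : Real.cos (2 * θ) = x := by
      rw [hθ, show 2 * -(Real.arccos x / 2) = -Real.arccos x by ring, Real.cos_neg,
        Real.cos_arccos (by linarith) hx1.le]
    obtain ⟨s, hs, h1, hsim⟩ := exists_isSimilar_bonnet hθ' (by linarith)
    rw [hcos, abs_of_pos hx0, hx, inv_mul_eq_one₀ (by positivity)] at h1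
    have h2 : s = t := (sq_eq_sq₀ hs ht.le).1 (by linarith)
    rw [h2] at hsim
    exact ⟨θ, Ioo_subset_Icc_self hθ', hsim⟩

/-! ### Reading the type off the angle, and the assembled classification. -/

theorem isPieceOfType_of_mem_angles {D : Set ℂ} (hD : IsOpen D) {X : ℂ → E3} {θ : ℝ}
    (hθ : θ ∈ Icc (-(Real.pi / 4)) (3 * Real.pi / 4)) (hX : IsPieceOf D X (Xtilde θ))
    {τ : SurfaceType} (hτ : θ ∈ τ.angles) : IsPieceOfType D X τ := by
  obtain ⟨Y, hY, hsim⟩ := exists_isSimilar_of_mem_angles hθ hτ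
  exact ⟨Y, hY, hX.trans hD (hsim.isPieceOf univ)⟩

theorem isPieceOfType_iff_mem_angles {D : Set ℂ} (hD : IsOpen D) {X : ℂ → E3} {θ : ℝ}
    (hθ : θ ∈ Icc (-(Real.pi / 4)) (3 * Real.pi / 4)) (hX : IsPieceOf D X (Xtilde θ))
    (huniq : ∀ τ₁ τ₂, IsPieceOfType D X τ₁ → IsPieceOfType D X τ₂ → τ₁ = τ₂) (τ : SurfaceType) :
    IsPieceOfType D X τ ↔ θ ∈ τ.angles := by
  refine ⟨fun h => ?_, isPieceOfType_of_mem_angles hD hθ hX⟩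
  obtain ⟨τ₀, hτ₀⟩ := exists_mem_angles hθ
  rwa [huniq τ τ₀ h (isPieceOfType_of_mem_angles hD hθ hX hτ₀)]

/-- The uniqueness argument is applied to the similar model `Y`, whose Weierstrass data are at hand;
similarity carries the types over. -/
theorem Xtilde_type_unique {θ : ℝ} (hθ : θ ∈ Icc (-(Real.pi / 4)) (3 * Real.pi / 4))
    (τ₁ τ₂ : SurfaceType) (h₁ : IsPieceOfType univ (Xtilde θ) τ₁)
    (h₂ : IsPieceOfType univ (Xtilde θ) τ₂) : τ₁ = τ₂ := by
  obtain ⟨τ, hτ⟩ := exists_mem_angles hθ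
  obtain ⟨Y, hY, hsim⟩ := exists_isSimilar_of_mem_angles hθ hτ
  obtain ⟨f, η, hd, hη, -⟩ := exists_data_of_mem_models hY
  have key : ∀ τ, IsPieceOfType univ (Xtilde θ) τ → IsPieceOfType univ Y τ := by
    rintro τ ⟨Z, hZ, h⟩
    exact ⟨Z, hZ, (hsim.symm.isPieceOf univ).trans isOpen_univ h⟩
  exact IsPieceOfType.unique isOpen_univ univ_nonempty hd
    (fun z _ => weierstrassData_dot_self f η z) (fun z _ => weierstrassData_ne_zero (hη z))
    (key τ₁ h₁) (key τ₂ h₂)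

theorem classification {D : Set ℂ} {X : ℂ → E3} (hX : IsMinimalSurface D X)
    (hpl : HasPlanarCurvatureLines D X) :
    (∃ θ ∈ Icc (-(Real.pi / 4)) (3 * Real.pi / 4), IsPieceOf D X (Xtilde θ)) ∧
      (∃! τ : SurfaceType, IsPieceOfType D X τ) ∧
      ∀ θ ∈ Icc (-(Real.pi / 4)) (3 * Real.pi / 4), IsPieceOf D X (Xtilde θ) →
        ∀ τ : SurfaceType, IsPieceOfType D X τ ↔ θ ∈ τ.angles := by
  have hN := hX.isNullData
  have huniq : ∀ τ₁ τ₂, IsPieceOfType D X τ₁ → IsPieceOfType D X τ₂ → τ₁ = τ₂ := fun _ _ =>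
    IsPieceOfType.unique hX.isOpen hX.simplyConnected.nonempty hN.hasData hN.null hN.ne_zero
  obtain ⟨τ, hτ⟩ := exists_isPieceOfType hX hpl
  refine ⟨?_, ⟨τ, hτ, fun τ' hτ' => huniq τ' τ hτ' hτ⟩, fun θ hθ h =>
    isPieceOfType_iff_mem_angles hX.isOpen hθ h huniq⟩
  obtain ⟨Y, hY, hXY⟩ := hτ
  obtain ⟨θ, hθ, hsim⟩ := exists_isSimilar_of_mem_models hY
  exact ⟨θ, hθ, hXY.trans hX.isOpen (hsim.symm.isPieceOf univ)⟩

theorem isPieceOfType_Xtilde_iff {θ : ℝ} (hθ : θ ∈ Icc (-(Real.pi / 4)) (3 * Real.pi / 4))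
    (τ : SurfaceType) : IsPieceOfType univ (Xtilde θ) τ ↔ θ ∈ τ.angles :=
  isPieceOfType_iff_mem_angles isOpen_univ hθ ((IsSimilar.refl _).isPieceOf univ)
    (Xtilde_type_unique hθ) τ

end PlanarCurvature

end

/-- Classification, parametrization and deformation of the minimal surfaces with planar
curvature lines. -/
theorem theorem3p1 :
    -- every minimal surface with planar curvature lines is a piece of some member of the family,
    (∀ (D : Set ℂ) (X : ℂ → PlanarCurvature.E3),
      PlanarCurvature.IsMinimalSurface D X → PlanarCurvature.HasPlanarCurvatureLines D X →
        (∃ θ ∈ Set.Icc (-(Real.pi / 4)) (3 * Real.pi / 4),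
          PlanarCurvature.IsPieceOf D X (PlanarCurvature.Xtilde θ)) ∧
        -- and a piece of a surface of one, and only one, of the four types,
        (∃! τ : PlanarCurvature.SurfaceType, PlanarCurvature.IsPieceOfType D X τ) ∧
        -- which is read off from the parameter;
        (∀ θ ∈ Set.Icc (-(Real.pi / 4)) (3 * Real.pi / 4),
          PlanarCurvature.IsPieceOf D X (PlanarCurvature.Xtilde θ) →
            ∀ τ : PlanarCurvature.SurfaceType,
              PlanarCurvature.IsPieceOfType D X τ ↔ θ ∈ τ.angles)) ∧
    -- each member of the family is itself of the type that its parameter says;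
    (∀ θ ∈ Set.Icc (-(Real.pi / 4)) (3 * Real.pi / 4), ∀ τ : PlanarCurvature.SurfaceType,
      PlanarCurvature.IsPieceOfType Set.univ (PlanarCurvature.Xtilde θ) τ ↔ θ ∈ τ.angles) ∧
    -- the family is continuous in the parameter, uniformly on compact sets.
    (∀ θ₀ ∈ Set.Icc (-(Real.pi / 4)) (3 * Real.pi / 4), ∀ K : Set ℂ, IsCompact K →
      TendstoUniformlyOn PlanarCurvature.Xtilde (PlanarCurvature.Xtilde θ₀)
        (nhdsWithin θ₀ (Set.Icc (-(Real.pi / 4)) (3 * Real.pi / 4))) K) := by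
  exact ⟨fun _ _ hX hpl => PlanarCurvature.classification hX hpl,
    fun _ hθ τ => PlanarCurvature.isPieceOfType_Xtilde_iff hθ τ,
    fun _ hθ₀ _ hK => PlanarCurvature.tendstoUniformlyOn_Xtilde hθ₀ hK⟩
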